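/- Let $(V,h)$ be a three-dimensional real vector space with a nondegenerate symmetric bilinear form $h$ of signature $(-,+,+)$ (e.g. $\mathbb R^3_1$), and let $SO(1,2)$ be the group of linear automorphisms of $V$ of determinant $1$ preserving $h$. Let $K:V\times V\to V$ be bilinear such that $h(K(X,Y),Z)$ is totally symmetric in $X,Y,Z$ and $\operatorname{tr}K_X=0$ for all $X\in V$, where $K_X=K(X,\cdot)$. Its stabilizer is $$\mathrm{Stab}(K)=\{L\in SO(1,2): h(K(LX,LY),LZ)=h(K(X,Y),Z)\ \ \forall X,Y,Z\in V\}.$$ An ONB is a basis $(\mathbf t,\mathbf v,\mathbf w)$ with $h(\mathbf t,\mathbf t)=-1$, $h(\mathbf v,\mathbf v)=h(\mathbf w,\mathbf w)=1$ and all other products zero; an LVB is a basis $(\mathbf e,\mathbf v,\mathbf f)$ with $h(\mathbf e,\mathbf f)=h(\mathbf v,\mathbf v)=1$ and all other products zero. The coefficients $a_1,\dots,a_7$ of $K$ in an ONB are defined by $$K_{\mathbf t}=\begin{pmatrix}-a_1&-a_2&-a_3\\a_2&a_4&a_5\\a_3&a_5&a_1-a_4\end{pmatrix},\quad K_{\mathbf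 v}=\begin{pmatrix}-a_2&-a_4&-a_5\\a_4&a_6&a_7\\a_5&a_7&a_2-a_6\end{pmatrix},\quad K_{\mathbf w}=\begin{pmatrix}-a_3&-a_5&-(a_1-a_4)\\a_5&a_7&a_2-a_6\\a_1-a_4&a_2-a_6&a_3-a_7\end{pmatrix},$$ and the coefficients $b_1,\dots,b_7$ in an LVB by $$K_{\mathbf e}=\begin{pmatrix}b_1&b_4&b_5\\b_2&-2b_1&b_4\\b_3&b_2&b_1\end{pmatrix},\quad K_{\mathbf v}=\begin{pmatrix}b_4&-2b_5&b_6\\-2b_1&-2b_4&-2b_5\\b_2&-2b_1&b_4\end{pmatrix},\quad K_{\mathbf f}=\begin{pmatrix}b_5&b_6&b_7\\b_4&-2b_5&b_6\\b_1&b_4&b_5\end{pmatrix}.$$ With respect to such a basis put $$A_s=\begin{pmatrix}1&0&0\\0&\cos s&-\sin s\\0&\sin s&\cos s\end{pmatrix},\quad B=\begin{pmatrix}-1&0&0\\0&1&0\\0&0&-1\end{pmatrix},\quad C_l=\begin{pmatrix}l&0&0\\0&1&0\\0&0&\frac1l\end{pmatrix},\quad N_m=\begin{pmatrix}1&-m&-\frac{m^2}2\\0&1&m\\0&0&1\end{pmatrix}.$$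 Assume that $\mathrm{Stab}(K)$ contains an element different from the identity. Then exactly one of the following nine statements holds (coefficients that are not mentioned are zero): 1. $K=0$, and $\mathrm{Stab}(K)=SO(1,2)$; 2. there is an ONB in which $a_1=2a_4$, $a_4>0$, and $\mathrm{Stab}(K)=\{A_s:s\in\mathbb R\}\cong SO(2)$; 3. there is an ONB in which $a_6>0$, and $\mathrm{Stab}(K)=\langle A_{2\pi/3},B\rangle\cong S_3$; 4. there is an ONB in which $a_1=2a_4$, $a_4>0$, $a_6>0$, and $\mathrm{Stab}(K)=\langle A_{2\pi/3}\rangle\cong\mathbb Z_3$; 5. there is an ONB in which $a_2,a_5\in\mathbb R$, $a_6\ge0$, $(a_2,a_6)\ne(0,0)$, and $\mathrm{Stab}(K)=\langle B\rangle\cong\mathbb Z_2$; 6. there is an ONB in which $a_5>0$, and $\mathrm{Stab}(K)=\langle A_\pi,B\rangle\cong\mathbb Z_2\times\mathbb Z_2$; 7. there is an ONB in which $a_1>0$ or $a_4>0$, $a_1\ne2a_4$, and $\mathrm{Stab}(K)=\langle A_\pi\rangle\cong\mathbb Z_2$; 8. there is an LVB in which $b_4>0$, and $\mathrm{Stab}(K)=\{C_l:l\in\mathbb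 R\setminus\{0\}\}\cong SO(1,1)$; 9. there is an LVB in which $b_7>0$, and $\mathrm{Stab}(K)=\{N_m:m\in\mathbb R\}\cong(\mathbb R,+)$. Moreover, whenever $K$ has one of these nine forms in some ONB (respectively LVB), the group listed with that form, taken with respect to that basis, is contained in $\mathrm{Stab}(K)$; for all forms except 5 and 7 it is equal to $\mathrm{Stab}(K)$. -/

import Mathlib

open LinearMap (BilinForm)

noncomputable section

namespace LorentzCubic

variable {V : Type*} [AddCommGroup V] [Module ℝ V]

/-- The special isometry group of a bilinear form: linear automorphisms of determinant one
which preserve the form. -/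
def specialIsometryGroup (h : BilinForm ℝ V) : Subgroup (V ≃ₗ[ℝ] V) where
  carrier := {L | (∀ x y, h (L x) (L y) = h x y) ∧ LinearMap.det (L : V →ₗ[ℝ] V) = 1}
  one_mem' := ⟨fun _ _ => rfl, LinearMap.det_id⟩
  mul_mem' := by
    rintro L M ⟨hL, dL⟩ ⟨hM, dM⟩
    refine ⟨fun x y => ?_, ?_⟩
    · rw [LinearEquiv.mul_apply, LinearEquiv.mul_apply, hL, hM]
    · have : ((L * M : V ≃ₗ[ℝ] V) : V →ₗ[ℝ] V) = (L : V →ₗ[ℝ] V) * (M : V →ₗ[ℝ] V) := rfl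
      rw [this, map_mul, dL, dM, one_mul]
  inv_mem' := by
    rintro L ⟨hL, dL⟩
    refine ⟨fun x y => ?_, ?_⟩
    · have e : ∀ z, L (L⁻¹ z) = z := fun z => L.apply_symm_apply z
      rw [← hL, e, e]
    · have : (L : V →ₗ[ℝ] V) * ((L⁻¹ : V ≃ₗ[ℝ] V) : V →ₗ[ℝ] V) = 1 := by
        ext z
        exact L.apply_symm_apply z
      have h2 := congrArg LinearMap.det this
      rw [map_mul, dL, one_mul, map_one] at h2
      exact h2

/-- The standard Lorentzian form `-x₀ y₀ + x₁ y₁ + ⋯ + xₙ yₙ`. -/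
def lorentzForm (n : ℕ) : BilinForm ℝ (Fin (n + 1) → ℝ) :=
  Matrix.toBilin' (Matrix.diagonal (Fin.cons (-1) (fun _ => 1)))

/-- The group `SO(1,n)`. -/
abbrev SO1 (n : ℕ) : Subgroup ((Fin (n + 1) → ℝ) ≃ₗ[ℝ] (Fin (n + 1) → ℝ)) :=
  specialIsometryGroup (lorentzForm n)

/-- Orthonormal basis `(t, v, w) = (b 0, b 1, b 2)` with `t` timelike, `v`, `w` spacelike. -/
def IsONB (h : BilinForm ℝ V) (b : Module.Basis (Fin 3) ℝ V) : Prop :=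
  h (b 0) (b 0) = -1 ∧ h (b 1) (b 1) = 1 ∧ h (b 2) (b 2) = 1 ∧
    h (b 0) (b 1) = 0 ∧ h (b 0) (b 2) = 0 ∧ h (b 1) (b 2) = 0

/-- Light-vector basis `(e, v, f) = (b 0, b 1, b 2)` with `e`, `f` lightlike, `v` spacelike. -/
def IsLVB (h : BilinForm ℝ V) (b : Module.Basis (Fin 3) ℝ V) : Prop :=
  h (b 0) (b 0) = 0 ∧ h (b 2) (b 2) = 0 ∧ h (b 0) (b 2) = 1 ∧
    h (b 0) (b 1) = 0 ∧ h (b 2) (b 1) = 0 ∧ h (b 1) (b 1) = 1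

/-- `h (K(X,Y), Z)` is totally symmetric in `X, Y, Z`, and every `K_X = K(X, ·)` is traceless. -/
def IsTracelessCubic (h : BilinForm ℝ V) (K : V →ₗ[ℝ] V →ₗ[ℝ] V) : Prop :=
  (∀ X Y Z, h (K X Y) Z = h (K Y X) Z) ∧ (∀ X Y Z, h (K X Y) Z = h (K X Z) Y) ∧
    ∀ X, LinearMap.trace ℝ V (K X) = 0

/-- The stabilizer, in the special isometry group of `h`, of the cubic form `h (K(·,·), ·)`
under `L ↦ h (K(L·, L·), L·)`. -/
def cubicStabilizer (h : BilinForm ℝ V) (K : V →ₗ[ℝ] V →ₗ[ℝ] V) : Subgroup (V ≃ₗ[ℝ] V) where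
  carrier := {L | L ∈ specialIsometryGroup h ∧
    ∀ X Y Z, h (K (L X) (L Y)) (L Z) = h (K X Y) Z}
  one_mem' := ⟨one_mem _, fun _ _ _ => rfl⟩
  mul_mem' := by
    rintro L M ⟨hL, kL⟩ ⟨hM, kM⟩
    refine ⟨mul_mem hL hM, fun X Y Z => ?_⟩
    rw [LinearEquiv.mul_apply, LinearEquiv.mul_apply, LinearEquiv.mul_apply, kL, kM]
  inv_mem' := by
    rintro L ⟨hL, kL⟩
    refine ⟨inv_mem hL, fun X Y Z => ?_⟩
    have e : ∀ z, L (L⁻¹ z) = z := fun z => L.apply_symm_apply z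
    rw [← kL, e, e, e]

/-- The coefficients of `K` with respect to an orthonormal basis `(t, v, w)`: the matrices of
`K_t`, `K_v`, `K_w` in this basis. -/
def HasONBCoeffs (K : V →ₗ[ℝ] V →ₗ[ℝ] V) (b : Module.Basis (Fin 3) ℝ V)
    (a₁ a₂ a₃ a₄ a₅ a₆ a₇ : ℝ) : Prop :=
  LinearMap.toMatrix b b (K (b 0)) =
    !![-a₁, -a₂, -a₃; a₂, a₄, a₅; a₃, a₅, a₁ - a₄] ∧
  LinearMap.toMatrix b b (K (b 1)) =
    !![-a₂, -a₄, -a₅; a₄, a₆, a₇; a₅, a₇, a₂ - a₆] ∧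
  LinearMap.toMatrix b b (K (b 2)) =
    !![-a₃, -a₅, -(a₁ - a₄); a₅, a₇, a₂ - a₆; a₁ - a₄, a₂ - a₆, a₃ - a₇]

/-- The coefficients of `K` with respect to a light-vector basis `(e, v, f)`: the matrices of
`K_e`, `K_v`, `K_f` in this basis. -/
def HasLVBCoeffs (K : V →ₗ[ℝ] V →ₗ[ℝ] V) (b : Module.Basis (Fin 3) ℝ V)
    (b₁ b₂ b₃ b₄ b₅ b₆ b₇ : ℝ) : Prop :=
  LinearMap.toMatrix b b (K (b 0)) =
    !![b₁, b₄, b₅; b₂, -2 * b₁, b₄; b₃, b₂, b₁] ∧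
  LinearMap.toMatrix b b (K (b 1)) =
    !![b₄, -2 * b₅, b₆; -2 * b₁, -2 * b₄, -2 * b₅; b₂, -2 * b₁, b₄] ∧
  LinearMap.toMatrix b b (K (b 2)) =
    !![b₅, b₆, b₇; b₄, -2 * b₅, b₆; b₁, b₄, b₅]

/-- Rotation by the angle `s` fixing the timelike vector of an orthonormal basis. -/
def matA (s : ℝ) : Matrix (Fin 3) (Fin 3) ℝ :=
  !![1, 0, 0; 0, Real.cos s, -Real.sin s; 0, Real.sin s, Real.cos s]

/-- Half-turn about the spacelike vector `b 1`. -/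
def matB : Matrix (Fin 3) (Fin 3) ℝ := !![-1, 0, 0; 0, 1, 0; 0, 0, -1]

/-- Boost with respect to a light-vector basis. -/
def matC (l : ℝ) : Matrix (Fin 3) (Fin 3) ℝ := !![l, 0, 0; 0, 1, 0; 0, 0, 1 / l]

/-- Null rotation with respect to a light-vector basis. -/
def matN (m : ℝ) : Matrix (Fin 3) (Fin 3) ℝ := !![1, -m, -(m ^ 2 / 2); 0, 1, m; 0, 0, 1]

/-- The automorphisms represented by the matrix `A` in the basis `b`
(exactly one if `A` is invertible). -/
def represented (b : Module.Basis (Fin 3) ℝ V) (A : Matrix (Fin 3) (Fin 3) ℝ) :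
    Set (V ≃ₗ[ℝ] V) :=
  {L | LinearMap.toMatrix b b (L : V →ₗ[ℝ] V) = A}

/-- Labels of the nine normal forms; the two forms with symmetry `ℤ/2` are labelled by the
generator, `B` or `A_π`. -/
inductive FormType
  | zero
  | so2
  | s3
  | z3
  | z2B
  | z2z2
  | z2A
  | so11
  | real

/-- The kind of basis used for each normal form. -/
def IsAdapted (h : BilinForm ℝ V) (b : Module.Basis (Fin 3) ℝ V) : FormType → Prop
  | .so11 => IsLVB h b
  | .real => IsLVB h b
  | _ => IsONB h b

/-- `K` has the normal form with the given label in the basis `b`. -/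
def HasNormalForm (K : V →ₗ[ℝ] V →ₗ[ℝ] V) (b : Module.Basis (Fin 3) ℝ V) : FormType → Prop
  | .zero => K = 0
  | .so2 => ∃ a₄ : ℝ, 0 < a₄ ∧ HasONBCoeffs K b (2 * a₄) 0 0 a₄ 0 0 0
  | .s3 => ∃ a₆ : ℝ, 0 < a₆ ∧ HasONBCoeffs K b 0 0 0 0 0 a₆ 0
  | .z3 => ∃ a₄ a₆ : ℝ, 0 < a₄ ∧ 0 < a₆ ∧ HasONBCoeffs K b (2 * a₄) 0 0 a₄ 0 a₆ 0
  | .z2B => ∃ a₂ a₅ a₆ : ℝ, 0 ≤ a₆ ∧ (a₂, a₆) ≠ (0, 0) ∧ HasONBCoeffs K b 0 a₂ 0 0 a₅ a₆ 0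
  | .z2z2 => ∃ a₅ : ℝ, 0 < a₅ ∧ HasONBCoeffs K b 0 0 0 0 a₅ 0 0
  | .z2A => ∃ a₁ a₄ : ℝ, (0 < a₁ ∨ 0 < a₄) ∧ a₁ ≠ 2 * a₄ ∧ HasONBCoeffs K b a₁ 0 0 a₄ 0 0 0
  | .so11 => ∃ b₄ : ℝ, 0 < b₄ ∧ HasLVBCoeffs K b 0 0 0 b₄ 0 0 0
  | .real => ∃ b₇ : ℝ, 0 < b₇ ∧ HasLVBCoeffs K b 0 0 0 0 0 0 b₇

/-- The group attached to each normal form, with respect to the basis `b`. -/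
def symmetrySet (h : BilinForm ℝ V) (b : Module.Basis (Fin 3) ℝ V) :
    FormType → Set (V ≃ₗ[ℝ] V)
  | .zero => specialIsometryGroup h
  | .so2 => {L | ∃ s : ℝ, L ∈ represented b (matA s)}
  | .s3 => Subgroup.closure (represented b (matA (2 * Real.pi / 3)) ∪ represented b matB)
  | .z3 => Subgroup.closure (represented b (matA (2 * Real.pi / 3)))
  | .z2B => Subgroup.closure (represented b matB)
  | .z2z2 => Subgroup.closure (represented b (matA Real.pi) ∪ represented b matB)
  | .z2A => Subgroup.closure (represented b (matA Real.pi))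
  | .so11 => {L | ∃ l : ℝ, l ≠ 0 ∧ L ∈ represented b (matC l)}
  | .real => {L | ∃ m : ℝ, L ∈ represented b (matN m)}

/-- The abstract isomorphism type attached to each normal form. -/
def HasIsoType (G : Type*) [Group G] : FormType → Prop
  | .zero => Nonempty (G ≃* SO1 2)
  | .so2 => Nonempty (G ≃* Matrix.specialOrthogonalGroup (Fin 2) ℝ)
  | .s3 => Nonempty (G ≃* Equiv.Perm (Fin 3))
  | .z3 => Nonempty (G ≃* Multiplicative (ZMod 3))
  | .z2B => Nonempty (G ≃* Multiplicative (ZMod 2))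
  | .z2z2 => Nonempty (G ≃* Multiplicative (ZMod 2) × Multiplicative (ZMod 2))
  | .z2A => Nonempty (G ≃* Multiplicative (ZMod 2))
  | .so11 => Nonempty (G ≃* SO1 1)
  | .real => Nonempty (G ≃* Multiplicative ℝ)

end LorentzCubic

end

namespace LorentzCubic

variable {V : Type*} [AddCommGroup V] [Module ℝ V]

/-! Existence rests on the geometry of `SO(1,2)`. In odd dimension a special isometry fixes a
nonzero vector, and the causal type of that vector makes the isometry a rotation `A_s`, some `C_l`
(a boost, possibly times a half-turn) or a null rotation `N_m` in an adapted basis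
(`specialIsometryGroup_cases`). The seven coefficients of `K` split into weight spaces under each of
these. Invariance under an element that is neither the identity nor a half-turn therefore kills so
many coefficients that what remains is a normal form up to changes of sign and a rotation.

If every nontrivial symmetry is a half-turn, the stabilizer has exponent two and is abelian.
Distinct commuting half-turns have orthogonal axes, and two such symmetries leave only the
coefficient `a₅`. Otherwise there is a single half-turn, and the causal type of its axis decides
between the two forms with group of order two, apart from parameter values that fall under other
forms (`attainsNormalForm`).

Stabilizers are computed with the invariant quadratic form `X ↦ tr (K_X ∘ K_X)`. For the axial forms
and for `.so11` it is a combination of `h` and the square of one coordinate, with nonzero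
coefficient on the square, so symmetries preserve that coordinate up to sign. For `.z2z2` the trace
form is a multiple of `h`, and for `.real` the cubic is itself the cube of a linear form; these two
are treated directly. For `.zero` nothing is to be computed.

Uniqueness holds because the forms are told apart by basis-free data (`Signature`): vanishing of
`K`, the order of the stabilizer, the traces of its elements, and whether a nontrivial symmetry
fixes a timelike vector. -/

/-! ### Coordinates and automorphisms represented by matrices -/

theorem exists_coords (b : Module.Basis (Fin 3) ℝ V) (x : V) :
    ∃ p q r : ℝ, x = p • b 0 + q • b 1 + r • b 2 :=
  ⟨b.repr x 0, b.repr x 1, b.repr x 2, by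
    conv_lhs => rw [← b.sum_repr x, Fin.sum_univ_three]⟩

theorem toMatrix_eq_iff (b : Module.Basis (Fin 3) ℝ V) (f : V →ₗ[ℝ] V)
    (A : Matrix (Fin 3) (Fin 3) ℝ) :
    LinearMap.toMatrix b b f = A ↔
      ∀ j, f (b j) = A 0 j • b 0 + A 1 j • b 1 + A 2 j • b 2 := by
  constructor
  · rintro rfl j
    conv_lhs => rw [← b.sum_repr (f (b j)), Fin.sum_univ_three]
    simp [LinearMap.toMatrix_apply]
  · intro H
    ext i j
    rw [LinearMap.toMatrix_apply, H j]
    fin_cases i <;> simp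

theorem mem_represented_iff {b : Module.Basis (Fin 3) ℝ V} {A : Matrix (Fin 3) (Fin 3) ℝ}
    {L : V ≃ₗ[ℝ] V} :
    L ∈ represented b A ↔ ∀ j, L (b j) = A 0 j • b 0 + A 1 j • b 1 + A 2 j • b 2 :=
  toMatrix_eq_iff b (L : V →ₗ[ℝ] V) A

theorem represented_inj {b : Module.Basis (Fin 3) ℝ V} {A : Matrix (Fin 3) (Fin 3) ℝ}
    {L M : V ≃ₗ[ℝ] V} (hL : L ∈ represented b A) (hM : M ∈ represented b A) : L = M := by
  rw [mem_represented_iff] at hL hM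
  apply LinearEquiv.toLinearMap_injective
  exact b.ext fun j => (hL j).trans (hM j).symm

theorem represented_mul {b : Module.Basis (Fin 3) ℝ V} {A B : Matrix (Fin 3) (Fin 3) ℝ}
    {L M : V ≃ₗ[ℝ] V} (hL : L ∈ represented b A) (hM : M ∈ represented b B) :
    L * M ∈ represented b (A * B) := by
  have : ((L * M : V ≃ₗ[ℝ] V) : V →ₗ[ℝ] V) = (L : V →ₗ[ℝ] V) ∘ₗ (M : V →ₗ[ℝ] V) := rfl
  simp only [represented, Set.mem_ofPred_eq] at *
  rw [this, LinearMap.toMatrix_comp b b b, hL, hM]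

theorem one_mem_represented (b : Module.Basis (Fin 3) ℝ V) :
    (1 : V ≃ₗ[ℝ] V) ∈ represented b 1 :=
  LinearMap.toMatrix_id b

theorem exists_represented (b : Module.Basis (Fin 3) ℝ V) {A : Matrix (Fin 3) (Fin 3) ℝ}
    (hA : A.det = 1) : ∃ L : V ≃ₗ[ℝ] V, L ∈ represented b A := by
  refine ⟨Matrix.toLinearEquiv b A (by simp [hA]), ?_⟩
  have : ((Matrix.toLinearEquiv b A (by simp [hA]) : V ≃ₗ[ℝ] V) : V →ₗ[ℝ] V)
      = Matrix.toLin b b A := by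
    ext x
    exact Matrix.toLinearEquiv_apply b A _ x
  simp [represented, this]

theorem mem_represented_toMatrix (b : Module.Basis (Fin 3) ℝ V) (L : V ≃ₗ[ℝ] V) :
    L ∈ represented b (LinearMap.toMatrix b b (L : V →ₗ[ℝ] V)) := rfl

theorem det_of_mem_represented {b : Module.Basis (Fin 3) ℝ V} {A : Matrix (Fin 3) (Fin 3) ℝ}
    {L : V ≃ₗ[ℝ] V} (hL : L ∈ represented b A) :
    LinearMap.det (L : V →ₗ[ℝ] V) = A.det := by
  rw [← LinearMap.det_toMatrix b, show LinearMap.toMatrix b b (L : V →ₗ[ℝ] V) = A from hL]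

theorem trace_of_mem_represented {b : Module.Basis (Fin 3) ℝ V}
    {A : Matrix (Fin 3) (Fin 3) ℝ} {L : V ≃ₗ[ℝ] V} (hL : L ∈ represented b A) :
    LinearMap.trace ℝ V (L : V →ₗ[ℝ] V) = A 0 0 + A 1 1 + A 2 2 := by
  rw [LinearMap.trace_eq_matrix_trace ℝ b,
    show LinearMap.toMatrix b b (L : V →ₗ[ℝ] V) = A from hL, Matrix.trace_fin_three]

theorem trace_eq_sum (b : Module.Basis (Fin 3) ℝ V) (f : V →ₗ[ℝ] V) :
    LinearMap.trace ℝ V f = b.repr (f (b 0)) 0 + b.repr (f (b 1)) 1 + b.repr (f (b 2)) 2 := by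
  rw [LinearMap.trace_eq_matrix_trace ℝ b, Matrix.trace_fin_three]
  simp [LinearMap.toMatrix_apply]

/-! ### The form `h` and the seven coefficients of `K` in adapted bases -/

section Forms

variable {h : BilinForm ℝ V} {K : V →ₗ[ℝ] V →ₗ[ℝ] V} {b : Module.Basis (Fin 3) ℝ V}

theorem IsONB.apply_eq (hs : h.IsSymm) (hb : IsONB h b) (p q r p' q' r' : ℝ) :
    h (p • b 0 + q • b 1 + r • b 2) (p' • b 0 + q' • b 1 + r' • b 2) =
      -(p * p') + q * q' + r * r' := by
  obtain ⟨h1, h2, h3, h4, h5, h6⟩ := hb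
  have h7 := hs.eq (b 0) (b 1)
  have h8 := hs.eq (b 0) (b 2)
  have h9 := hs.eq (b 1) (b 2)
  simp [h1, h2, h3, h4, h5, h6, ← h7, ← h8, ← h9]

theorem IsLVB.apply_eq (hs : h.IsSymm) (hb : IsLVB h b) (p q r p' q' r' : ℝ) :
    h (p • b 0 + q • b 1 + r • b 2) (p' • b 0 + q' • b 1 + r' • b 2) =
      p * r' + q * q' + r * p' := by
  obtain ⟨h1, h2, h3, h4, h5, h6⟩ := hb
  have h7 := hs.eq (b 0) (b 1)
  have h8 := hs.eq (b 0) (b 2)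
  have h9 := hs.eq (b 2) (b 1)
  simp [h1, h2, h3, h4, h5, h6, ← h7, ← h8, ← h9]

theorem IsONB.repr_eq (hs : h.IsSymm) (hb : IsONB h b) (x : V) :
    b.repr x 0 = -h x (b 0) ∧ b.repr x 1 = h x (b 1) ∧ b.repr x 2 = h x (b 2) := by
  obtain ⟨p, q, r, rfl⟩ := exists_coords b x
  have e0 := hb.apply_eq hs p q r 1 0 0
  have e1 := hb.apply_eq hs p q r 0 1 0
  have e2 := hb.apply_eq hs p q r 0 0 1
  simp only [one_smul, zero_smul, add_zero, zero_add] at e0 e1 e2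
  rw [e0, e1, e2]
  simp

theorem IsLVB.repr_eq (hs : h.IsSymm) (hb : IsLVB h b) (x : V) :
    b.repr x 0 = h x (b 2) ∧ b.repr x 1 = h x (b 1) ∧ b.repr x 2 = h x (b 0) := by
  obtain ⟨p, q, r, rfl⟩ := exists_coords b x
  have e0 := hb.apply_eq hs p q r 1 0 0
  have e1 := hb.apply_eq hs p q r 0 1 0
  have e2 := hb.apply_eq hs p q r 0 0 1
  simp only [one_smul, zero_smul, add_zero, zero_add] at e0 e1 e2
  rw [e0, e1, e2]
  simp

theorem IsTracelessCubic.perm1 (hK : IsTracelessCubic h K) (x y z : V) :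
    h (K x y) z = h (K y x) z := hK.1 x y z

theorem IsTracelessCubic.perm2 (hK : IsTracelessCubic h K) (x y z : V) :
    h (K x y) z = h (K x z) y := hK.2.1 x y z

/-- A symmetric trilinear form in three variables has ten values on basis vectors, and the three
trace conditions express those with two or three entries `b 2` through the other seven. Finding the
coefficients in a new basis thus reduces to seven evaluations. -/
theorem hasONBCoeffs_iff (hs : h.IsSymm) (hK : IsTracelessCubic h K) (hb : IsONB h b)
    {a₁ a₂ a₃ a₄ a₅ a₆ a₇ : ℝ} :
    HasONBCoeffs K b a₁ a₂ a₃ a₄ a₅ a₆ a₇ ↔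
      h (K (b 0) (b 0)) (b 0) = a₁ ∧ h (K (b 0) (b 0)) (b 1) = a₂ ∧
      h (K (b 0) (b 0)) (b 2) = a₃ ∧ h (K (b 0) (b 1)) (b 1) = a₄ ∧
      h (K (b 0) (b 1)) (b 2) = a₅ ∧ h (K (b 1) (b 1)) (b 1) = a₆ ∧
      h (K (b 1) (b 1)) (b 2) = a₇ := by
  have R := fun x => hb.repr_eq hs x
  constructor
  · rintro ⟨H0, H1, H2⟩
    have F : ∀ i j, LinearMap.toMatrix b b (K (b 0)) i j = b.repr (K (b 0) (b j)) i :=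
      fun i j => LinearMap.toMatrix_apply ..
    have G : ∀ i j, LinearMap.toMatrix b b (K (b 1)) i j = b.repr (K (b 1) (b j)) i :=
      fun i j => LinearMap.toMatrix_apply ..
    rw [H0] at F
    rw [H1] at G
    have f00 := F 0 0
    have f10 := F 1 0
    have f20 := F 2 0
    have f11 := F 1 1
    have f21 := F 2 1
    have g11 := G 1 1
    have g21 := G 2 1
    simp [(R _).1, (R _).2.1, (R _).2.2] at f00 f10 f20 f11 f21 g11 g21
    exact ⟨f00.symm, f10.symm, f20.symm, f11.symm, f21.symm, g11.symm, g21.symm⟩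
  · rintro ⟨e1, e2, e3, e4, e5, e6, e7⟩
    have tr : ∀ x, h (K x (b 2)) (b 2) = h (K x (b 0)) (b 0) - h (K x (b 1)) (b 1) := by
      intro x
      have := hK.2.2 x
      rw [trace_eq_sum b, (R _).1, (R _).2.1, (R _).2.2] at this
      linarith
    have p := hK.perm1
    have q := hK.perm2
    have e10 : h (K (b 1) (b 0)) (b 0) = a₂ := by rw [p, q, e2]
    have e20 : h (K (b 2) (b 0)) (b 0) = a₃ := by rw [p, q, e3]
    have e11 : h (K (b 1) (b 0)) (b 1) = a₄ := by rw [p, e4]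
    have e12 : h (K (b 1) (b 0)) (b 2) = a₅ := by rw [p, e5]
    have e21 : h (K (b 2) (b 0)) (b 1) = a₅ := by rw [p, q, e5]
    have e121 : h (K (b 2) (b 1)) (b 1) = a₇ := by rw [p, q, e7]
    have t0 := tr (b 0)
    have t1 := tr (b 1)
    have t2 := tr (b 2)
    rw [e1, e4] at t0
    rw [e10, e6] at t1
    rw [e20, e121] at t2
    have e022 : h (K (b 2) (b 0)) (b 2) = a₁ - a₄ := by rw [p, t0]
    have e122 : h (K (b 2) (b 1)) (b 2) = a₂ - a₆ := by rw [p, t1]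
    refine ⟨?_, ?_, ?_⟩
    · ext i j
      rw [LinearMap.toMatrix_apply]
      fin_cases i <;> fin_cases j <;> simp [(R _).1, (R _).2.1, (R _).2.2]
      · exact e1
      · rw [q, e2]
      · rw [q, e3]
      · exact e2
      · exact e4
      · rw [q, e5]
      · exact e3
      · exact e5
      · exact t0
    · ext i j
      rw [LinearMap.toMatrix_apply]
      fin_cases i <;> fin_cases j <;> simp [(R _).1, (R _).2.1, (R _).2.2]
      · exact e10
      · rw [q, e11]
      · rw [q, e12]
      · exact e11
      · exact e6
      · rw [q, e7]
      · exact e12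
      · exact e7
      · exact t1
    · ext i j
      rw [LinearMap.toMatrix_apply]
      fin_cases i <;> fin_cases j <;> simp [(R _).1, (R _).2.1, (R _).2.2]
      · exact e20
      · rw [q, e21]
      · rw [q, e022]; ring
      · exact e21
      · exact e121
      · rw [q, e122]
      · exact e022
      · exact e122
      · exact t2

/-- The basis dual to `(e, v, f)` under `h` is `(f, v, e)`, so tracelessness reads `h (K_X v) v = -2
h (K_X e) f`; this accounts for every factor `-2` in the matrices. -/
theorem hasLVBCoeffs_iff (hs : h.IsSymm) (hK : IsTracelessCubic h K) (hb : IsLVB h b)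
    {b₁ b₂ b₃ b₄ b₅ b₆ b₇ : ℝ} :
    HasLVBCoeffs K b b₁ b₂ b₃ b₄ b₅ b₆ b₇ ↔
      h (K (b 0) (b 0)) (b 2) = b₁ ∧ h (K (b 0) (b 0)) (b 1) = b₂ ∧
      h (K (b 0) (b 0)) (b 0) = b₃ ∧ h (K (b 0) (b 1)) (b 2) = b₄ ∧
      h (K (b 0) (b 2)) (b 2) = b₅ ∧ h (K (b 1) (b 2)) (b 2) = b₆ ∧
      h (K (b 2) (b 2)) (b 2) = b₇ := by
  have R := fun x => hb.repr_eq hs x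
  constructor
  · rintro ⟨H0, H1, H2⟩
    have F : ∀ i j, LinearMap.toMatrix b b (K (b 0)) i j = b.repr (K (b 0) (b j)) i :=
      fun i j => LinearMap.toMatrix_apply ..
    have G : ∀ i j, LinearMap.toMatrix b b (K (b 1)) i j = b.repr (K (b 1) (b j)) i :=
      fun i j => LinearMap.toMatrix_apply ..
    have H : ∀ i j, LinearMap.toMatrix b b (K (b 2)) i j = b.repr (K (b 2) (b j)) i :=
      fun i j => LinearMap.toMatrix_apply ..
    rw [H0] at F
    rw [H1] at G
    rw [H2] at H
    have f00 := F 0 0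
    have f10 := F 1 0
    have f20 := F 2 0
    have f01 := F 0 1
    have f02 := F 0 2
    have g02 := G 0 2
    have k02 := H 0 2
    simp [(R _).1, (R _).2.1, (R _).2.2] at f00 f10 f20 f01 f02 g02 k02
    exact ⟨f00.symm, f10.symm, f20.symm, f01.symm, f02.symm, g02.symm, k02.symm⟩
  · rintro ⟨e1, e2, e3, e4, e5, e6, e7⟩
    have p := hK.perm1
    have q := hK.perm2
    have tr : ∀ x, h (K x (b 1)) (b 1) = -2 * h (K x (b 0)) (b 2) := by
      intro x
      have := hK.2.2 x
      rw [trace_eq_sum b, (R _).1, (R _).2.1, (R _).2.2, q x (b 2) (b 0)] at this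
      linarith
    have e10 : h (K (b 1) (b 0)) (b 0) = b₂ := by rw [p, q, e2]
    have e20 : h (K (b 2) (b 0)) (b 0) = b₁ := by rw [p, q, e1]
    have e102 : h (K (b 1) (b 0)) (b 2) = b₄ := by rw [p, e4]
    have e201 : h (K (b 2) (b 0)) (b 1) = b₄ := by rw [p, q, e4]
    have e202 : h (K (b 2) (b 0)) (b 2) = b₅ := by rw [p, e5]
    have e212 : h (K (b 2) (b 1)) (b 2) = b₆ := by rw [p, e6]
    have t0 := tr (b 0)
    have t1 := tr (b 1)
    have t2 := tr (b 2)
    rw [e1] at t0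
    rw [e102] at t1
    rw [e202] at t2
    have t0' : h (K (b 1) (b 1)) (b 0) = -2 * b₁ := by rw [q, p, t0]
    have t2' : h (K (b 1) (b 1)) (b 2) = -2 * b₅ := by rw [q, p, t2]
    refine ⟨?_, ?_, ?_⟩
    · ext i j
      rw [LinearMap.toMatrix_apply]
      fin_cases i <;> fin_cases j <;> simp [(R _).1, (R _).2.1, (R _).2.2]
      · exact e1
      · exact e4
      · exact e5
      · exact e2
      · rw [t0]; ring
      · rw [q, e4]
      · exact e3
      · rw [q, e2]
      · rw [q, e1]
    · ext i j
      rw [LinearMap.toMatrix_apply]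
      fin_cases i <;> fin_cases j <;> simp [(R _).1, (R _).2.1, (R _).2.2]
      · exact e102
      · rw [t2']; ring
      · exact e6
      · rw [q, t0']; ring
      · rw [t1]; ring
      · rw [q, t2']; ring
      · exact e10
      · rw [t0']; ring
      · rw [q, e102]
    · ext i j
      rw [LinearMap.toMatrix_apply]
      fin_cases i <;> fin_cases j <;> simp [(R _).1, (R _).2.1, (R _).2.2]
      · exact e202
      · exact e212
      · exact e7
      · exact e201
      · rw [t2]; ring
      · rw [q, e212]
      · exact e20
      · rw [q, e201]
      · rw [q, e202]

end Forms

variable {h : BilinForm ℝ V} {K : V →ₗ[ℝ] V →ₗ[ℝ] V} {b : Module.Basis (Fin 3) ℝ V}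

/-- Turns invariance of the cubic form into polynomial identities in the coefficients and the matrix
entries. -/
theorem HasONBCoeffs.trilinear_eq (hs : h.IsSymm) (hb : IsONB h b)
    {a₁ a₂ a₃ a₄ a₅ a₆ a₇ : ℝ} (H : HasONBCoeffs K b a₁ a₂ a₃ a₄ a₅ a₆ a₇)
    (p q r p' q' r' p'' q'' r'' : ℝ) :
    h (K (p • b 0 + q • b 1 + r • b 2) (p' • b 0 + q' • b 1 + r' • b 2))
        (p'' • b 0 + q'' • b 1 + r'' • b 2) =
      a₁ * (p * p' * p'') + a₂ * (p * p' * q'' + p * q' * p'' + q * p' * p'') +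
      a₃ * (p * p' * r'' + p * r' * p'' + r * p' * p'') +
      a₄ * (p * q' * q'' + q * p' * q'' + q * q' * p'') +
      a₅ * (p * q' * r'' + p * r' * q'' + q * p' * r'' + q * r' * p'' + r * p' * q''
        + r * q' * p'') +
      (a₁ - a₄) * (p * r' * r'' + r * p' * r'' + r * r' * p'') +
      a₆ * (q * q' * q'') + a₇ * (q * q' * r'' + q * r' * q'' + r * q' * q'') +
      (a₂ - a₆) * (q * r' * r'' + r * q' * r'' + r * r' * q'') +
      (a₃ - a₇) * (r * r' * r'') := by
  obtain ⟨H0, H1, H2⟩ := H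
  rw [toMatrix_eq_iff] at H0 H1 H2
  obtain ⟨h1, h2, h3, h4, h5, h6⟩ := hb
  have h7 := hs.eq (b 0) (b 1)
  have h8 := hs.eq (b 0) (b 2)
  have h9 := hs.eq (b 1) (b 2)
  simp [H0, H1, H2, h1, h2, h3, h4, h5, h6, ← h7, ← h8, ← h9]
  ring

theorem HasLVBCoeffs.trilinear_eq (hs : h.IsSymm) (hb : IsLVB h b)
    {b₁ b₂ b₃ b₄ b₅ b₆ b₇ : ℝ} (H : HasLVBCoeffs K b b₁ b₂ b₃ b₄ b₅ b₆ b₇)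
    (p q r p' q' r' p'' q'' r'' : ℝ) :
    h (K (p • b 0 + q • b 1 + r • b 2) (p' • b 0 + q' • b 1 + r' • b 2))
        (p'' • b 0 + q'' • b 1 + r'' • b 2) =
      b₃ * (p * p' * p'') + b₂ * (p * p' * q'' + p * q' * p'' + q * p' * p'') +
      b₁ * (p * p' * r'' + p * r' * p'' + r * p' * p'') -
      2 * b₁ * (p * q' * q'' + q * p' * q'' + q * q' * p'') +
      b₄ * (p * q' * r'' + p * r' * q'' + q * p' * r'' + q * r' * p'' + r * p' * q''
        + r * q' * p'') +
      b₅ * (p * r' * r'' + r * p' * r'' + r * r' * p'') -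
      2 * b₄ * (q * q' * q'') - 2 * b₅ * (q * q' * r'' + q * r' * q'' + r * q' * q'') +
      b₆ * (q * r' * r'' + r * q' * r'' + r * r' * q'') +
      b₇ * (r * r' * r'') := by
  obtain ⟨H0, H1, H2⟩ := H
  rw [toMatrix_eq_iff] at H0 H1 H2
  obtain ⟨h1, h2, h3, h4, h5, h6⟩ := hb
  have h7 := hs.eq (b 0) (b 1)
  have h8 := hs.eq (b 0) (b 2)
  have h9 := hs.eq (b 2) (b 1)
  simp [H0, H1, H2, h1, h2, h3, h4, h5, h6, ← h7, ← h8, ← h9]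
  ring

theorem exists_hasONBCoeffs (hs : h.IsSymm) (hK : IsTracelessCubic h K) (hb : IsONB h b) :
    ∃ a₁ a₂ a₃ a₄ a₅ a₆ a₇, HasONBCoeffs K b a₁ a₂ a₃ a₄ a₅ a₆ a₇ :=
  ⟨_, _, _, _, _, _, _, (hasONBCoeffs_iff hs hK hb).2
    ⟨rfl, rfl, rfl, rfl, rfl, rfl, rfl⟩⟩

theorem exists_hasLVBCoeffs (hs : h.IsSymm) (hK : IsTracelessCubic h K) (hb : IsLVB h b) :
    ∃ b₁ b₂ b₃ b₄ b₅ b₆ b₇, HasLVBCoeffs K b b₁ b₂ b₃ b₄ b₅ b₆ b₇ :=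
  ⟨_, _, _, _, _, _, _, (hasLVBCoeffs_iff hs hK hb).2
    ⟨rfl, rfl, rfl, rfl, rfl, rfl, rfl⟩⟩

theorem eq_zero_of_toMatrix_eq_zero (H : ∀ i, LinearMap.toMatrix b b (K (b i)) = 0) :
    K = 0 := by
  refine b.ext fun i => ?_
  rw [LinearMap.zero_apply]
  exact (LinearMap.toMatrix b b).map_eq_zero_iff.1 (H i)

theorem hasONBCoeffs_zero_iff : HasONBCoeffs K b 0 0 0 0 0 0 0 ↔ K = 0 := by
  have e : (!![0, 0, 0; 0, 0, 0; 0, 0, 0] : Matrix (Fin 3) (Fin 3) ℝ) = 0 := by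
    ext i j; fin_cases i <;> fin_cases j <;> rfl
  constructor
  · rintro ⟨H0, H1, H2⟩
    simp only [neg_zero, sub_zero, e] at H0 H1 H2
    refine eq_zero_of_toMatrix_eq_zero (b := b) fun i => ?_
    fin_cases i
    exacts [H0, H1, H2]
  · rintro rfl
    simp [HasONBCoeffs, e]

theorem hasLVBCoeffs_zero_iff : HasLVBCoeffs K b 0 0 0 0 0 0 0 ↔ K = 0 := by
  have e : (!![0, 0, 0; 0, 0, 0; 0, 0, 0] : Matrix (Fin 3) (Fin 3) ℝ) = 0 := by
    ext i j; fin_cases i <;> fin_cases j <;> rfl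
  constructor
  · rintro ⟨H0, H1, H2⟩
    simp only [mul_zero, e] at H0 H1 H2
    refine eq_zero_of_toMatrix_eq_zero (b := b) fun i => ?_
    fin_cases i
    exacts [H0, H1, H2]
  · rintro rfl
    simp [HasLVBCoeffs, e]

/-! ### Isometries and stabilizers in coordinates -/

theorem mem_specialIsometryGroup {L : V ≃ₗ[ℝ] V} :
    L ∈ specialIsometryGroup h ↔
      (∀ x y, h (L x) (L y) = h x y) ∧ LinearMap.det (L : V →ₗ[ℝ] V) = 1 := Iff.rfl

theorem mem_cubicStabilizer {L : V ≃ₗ[ℝ] V} :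
    L ∈ cubicStabilizer h K ↔ L ∈ specialIsometryGroup h ∧
      ∀ X Y Z, h (K (L X) (L Y)) (L Z) = h (K X Y) Z := Iff.rfl

/-- Image of a linear combination of a basis under a represented automorphism. -/
theorem represented_apply {A : Matrix (Fin 3) (Fin 3) ℝ} {L : V ≃ₗ[ℝ] V}
    (hL : L ∈ represented b A) (p q r : ℝ) :
    L (p • b 0 + q • b 1 + r • b 2) =
      (A 0 0 * p + A 0 1 * q + A 0 2 * r) • b 0 + (A 1 0 * p + A 1 1 * q + A 1 2 * r) • b 1
        + (A 2 0 * p + A 2 1 * q + A 2 2 * r) • b 2 := by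
  rw [mem_represented_iff] at hL
  simp only [map_add, map_smul, hL]
  module

theorem IsONB.mem_specialIsometryGroup_iff (hs : h.IsSymm) (hb : IsONB h b)
    {A : Matrix (Fin 3) (Fin 3) ℝ} {L : V ≃ₗ[ℝ] V} (hL : L ∈ represented b A) :
    L ∈ specialIsometryGroup h ↔
      (∀ p q r p' q' r' : ℝ,
        -((A 0 0 * p + A 0 1 * q + A 0 2 * r) * (A 0 0 * p' + A 0 1 * q' + A 0 2 * r')) +
        (A 1 0 * p + A 1 1 * q + A 1 2 * r) * (A 1 0 * p' + A 1 1 * q' + A 1 2 * r') +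
        (A 2 0 * p + A 2 1 * q + A 2 2 * r) * (A 2 0 * p' + A 2 1 * q' + A 2 2 * r') =
        -(p * p') + q * q' + r * r') ∧ A.det = 1 := by
  rw [mem_specialIsometryGroup, det_of_mem_represented hL]
  refine and_congr_left fun _ => ⟨fun H p q r p' q' r' => ?_, fun H x y => ?_⟩
  · have := H (p • b 0 + q • b 1 + r • b 2) (p' • b 0 + q' • b 1 + r' • b 2)
    rwa [represented_apply hL, represented_apply hL, hb.apply_eq hs, hb.apply_eq hs] at this
  · obtain ⟨p, q, r, rfl⟩ := exists_coords b x
    obtain ⟨p', q', r', rfl⟩ := exists_coords b y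
    rw [represented_apply hL, represented_apply hL, hb.apply_eq hs, hb.apply_eq hs, H]

theorem IsLVB.mem_specialIsometryGroup_iff (hs : h.IsSymm) (hb : IsLVB h b)
    {A : Matrix (Fin 3) (Fin 3) ℝ} {L : V ≃ₗ[ℝ] V} (hL : L ∈ represented b A) :
    L ∈ specialIsometryGroup h ↔
      (∀ p q r p' q' r' : ℝ,
        (A 0 0 * p + A 0 1 * q + A 0 2 * r) * (A 2 0 * p' + A 2 1 * q' + A 2 2 * r') +
        (A 1 0 * p + A 1 1 * q + A 1 2 * r) * (A 1 0 * p' + A 1 1 * q' + A 1 2 * r') +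
        (A 2 0 * p + A 2 1 * q + A 2 2 * r) * (A 0 0 * p' + A 0 1 * q' + A 0 2 * r') =
        p * r' + q * q' + r * p') ∧ A.det = 1 := by
  rw [mem_specialIsometryGroup, det_of_mem_represented hL]
  refine and_congr_left fun _ => ⟨fun H p q r p' q' r' => ?_, fun H x y => ?_⟩
  · have := H (p • b 0 + q • b 1 + r • b 2) (p' • b 0 + q' • b 1 + r' • b 2)
    rwa [represented_apply hL, represented_apply hL, hb.apply_eq hs, hb.apply_eq hs] at this
  · obtain ⟨p, q, r, rfl⟩ := exists_coords b x
    obtain ⟨p', q', r', rfl⟩ := exists_coords b y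
    rw [represented_apply hL, represented_apply hL, hb.apply_eq hs, hb.apply_eq hs, H]

/-- The quadratic form `X ↦ tr (K_X ∘ K_X)` is invariant under the stabilizer. -/
theorem trace_comp_apply_of_mem_cubicStabilizer (hnd : ∀ x, (∀ y, h x y = 0) → x = 0)
    {L : V ≃ₗ[ℝ] V} (hL : L ∈ cubicStabilizer h K) (x : V) :
    LinearMap.trace ℝ V (K (L x) ∘ₗ K (L x)) = LinearMap.trace ℝ V (K x ∘ₗ K x) := by
  -- Nondegeneracy upgrades invariance of the trilinear form to equivariance of `K`, so `K_{Lx}` is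
  -- the conjugate of `K_x` by `L`.
  have key : ∀ x y, K (L x) (L y) = L (K x y) := by
    intro x y
    rw [← sub_eq_zero]
    apply hnd
    intro z
    obtain ⟨z, rfl⟩ := L.surjective z
    rw [map_sub, LinearMap.sub_apply, hL.2, hL.1.1, sub_self]
  have e : K (L x) ∘ₗ K (L x) = L.conj (K x ∘ₗ K x) := by
    ext y
    obtain ⟨y, rfl⟩ := L.surjective y
    simp [LinearEquiv.conj_apply, key]
  rw [e, LinearMap.trace_conj']

theorem IsONB.nondegenerate (hs : h.IsSymm) (hb : IsONB h b) (x : V) (hx : ∀ y, h x y = 0) :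
    x = 0 := by
  have := hb.repr_eq hs x
  simp only [hx, neg_zero] at this
  apply b.repr.map_eq_zero_iff.1
  ext i
  fin_cases i
  exacts [this.1, this.2.1, this.2.2]

theorem IsLVB.nondegenerate (hs : h.IsSymm) (hb : IsLVB h b) (x : V) (hx : ∀ y, h x y = 0) :
    x = 0 := by
  have := hb.repr_eq hs x
  simp only [hx] at this
  apply b.repr.map_eq_zero_iff.1
  ext i
  fin_cases i
  exacts [this.1, this.2.1, this.2.2]

/-- An automorphism preserving the cubic polynomial `h (K(x,x),x)` preserves the trilinear form. -/
theorem mem_cubicStabilizer_of_cubic (hK : IsTracelessCubic h K) {L : V ≃ₗ[ℝ] V}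
    (hL : L ∈ specialIsometryGroup h) (H : ∀ x, h (K (L x) (L x)) (L x) = h (K x x) x) :
    L ∈ cubicStabilizer h K := by
  refine ⟨hL, fun x y z => ?_⟩
  -- Polarization: a symmetric trilinear form is determined by its values on the diagonal.
  have polar : ∀ x y z : V, 6 * h (K x y) z = h (K (x + y + z) (x + y + z)) (x + y + z)
      - h (K (x + y) (x + y)) (x + y) - h (K (x + z) (x + z)) (x + z)
      - h (K (y + z) (y + z)) (y + z) + h (K x x) x + h (K y y) y + h (K z z) z := by
    intro x y z
    simp only [map_add, LinearMap.add_apply]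
    rw [hK.perm2 x z y, hK.perm1 y x z, hK.perm2 y z x, hK.perm1 y x z, hK.perm1 z x y,
      hK.perm2 x z y, hK.perm2 z y x, hK.perm1 z x y, hK.perm2 x z y]
    ring
  have h6 : 6 * h (K (L x) (L y)) (L z) = 6 * h (K x y) z := by
    rw [polar, polar x y z]
    simp only [← map_add, H]
  linarith

/-! ### Isometries preserving a timelike axis -/

/-- The matrix of an isometry preserving the line of the timelike vector of an orthonormal
basis. -/
def axisMat (ε c s : ℝ) : Matrix (Fin 3) (Fin 3) ℝ := !![ε, 0, 0; 0, c, -(ε * s); 0, s, ε * c]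

theorem matA_eq (s : ℝ) : matA s = axisMat 1 (Real.cos s) (Real.sin s) := by
  simp [matA, axisMat]

theorem matB_eq : matB = axisMat (-1) 1 0 := by
  simp [matB, axisMat]

theorem axisMat_det {ε c s : ℝ} (hε : ε ^ 2 = 1) (hcs : c ^ 2 + s ^ 2 = 1) :
    (axisMat ε c s).det = 1 := by
  simp [axisMat, Matrix.det_fin_three]
  linear_combination ε ^ 2 * hcs + hε

theorem axisMat_mul (ε c s ε' c' s' : ℝ) :
    axisMat ε c s * axisMat ε' c' s' =
      !![ε * ε', 0, 0; 0, c * c' - ε * s * s', -(ε' * (c * s' + ε * s * c'));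
        0, s * c' + ε * c * s', ε' * (ε * c * c' - s * s')] := by
  ext i j
  fin_cases i <;> fin_cases j <;> simp [axisMat, Matrix.mul_apply, Fin.sum_univ_three] <;> ring

theorem axisMat_apply {ε c s : ℝ} {L : V ≃ₗ[ℝ] V} (hL : L ∈ represented b (axisMat ε c s))
    (p q r : ℝ) :
    L (p • b 0 + q • b 1 + r • b 2) =
      (ε * p) • b 0 + (c * q - ε * s * r) • b 1 + (s * q + ε * c * r) • b 2 := by
  rw [represented_apply hL]
  simp [axisMat, sub_eq_add_neg]

theorem axisMat_mem_specialIsometryGroup (hs : h.IsSymm) (hb : IsONB h b) {ε c s : ℝ}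
    (hε : ε ^ 2 = 1) (hcs : c ^ 2 + s ^ 2 = 1) {L : V ≃ₗ[ℝ] V}
    (hL : L ∈ represented b (axisMat ε c s)) : L ∈ specialIsometryGroup h := by
  rw [hb.mem_specialIsometryGroup_iff hs hL]
  refine ⟨fun p q r p' q' r' => ?_, axisMat_det hε hcs⟩
  simp [axisMat]
  linear_combination (q * q' + ε ^ 2 * r * r') * hcs + (-p * p' + r * r') * hε

/-- A special isometry mapping the timelike axis of an orthonormal basis to itself has the
standard shape. -/
theorem exists_axisMat (hs : h.IsSymm) (hb : IsONB h b) {L : V ≃ₗ[ℝ] V}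
    (hL : L ∈ specialIsometryGroup h)
    (H : ∀ p q r : ℝ, h (L (p • b 0 + q • b 1 + r • b 2)) (b 0) ^ 2 = p ^ 2) :
    ∃ ε c s : ℝ, ε ^ 2 = 1 ∧ c ^ 2 + s ^ 2 = 1 ∧ L ∈ represented b (axisMat ε c s) := by
  have hLA := mem_represented_toMatrix b L
  generalize LinearMap.toMatrix b b (L : V →ₗ[ℝ] V) = A at hLA
  obtain ⟨G, hdet⟩ := (hb.mem_specialIsometryGroup_iff hs hLA).1 hL
  have H' : ∀ p q r : ℝ, (A 0 0 * p + A 0 1 * q + A 0 2 * r) ^ 2 = p ^ 2 := by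
    intro p q r
    have e := hb.apply_eq hs (A 0 0 * p + A 0 1 * q + A 0 2 * r)
      (A 1 0 * p + A 1 1 * q + A 1 2 * r) (A 2 0 * p + A 2 1 * q + A 2 2 * r) 1 0 0
    have := H p q r
    simp only [one_smul, zero_smul, add_zero] at e
    rw [represented_apply hLA, e] at this
    linear_combination this
  have h00 := H' 1 0 0
  have h01 := H' 0 1 0
  have h02 := H' 0 0 1
  have g00 := G 1 0 0 1 0 0
  have g11 := G 0 1 0 0 1 0
  have g12 := G 0 1 0 0 0 1
  have g22 := G 0 0 1 0 0 1
  simp only [mul_one, mul_zero, add_zero, zero_add] at h00 h01 h02 g00 g11 g12 g22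
  have z01 : A 0 1 = 0 := by simpa using h01
  have z02 : A 0 2 = 0 := by simpa using h02
  -- The image of the timelike vector has square `-1` and time component `±1`, so its spatial part
  -- vanishes.
  have z10 : A 1 0 = 0 := by nlinarith [sq_nonneg (A 1 0), sq_nonneg (A 2 0)]
  have z20 : A 2 0 = 0 := by nlinarith [sq_nonneg (A 1 0), sq_nonneg (A 2 0)]
  rw [Matrix.det_fin_three, z01, z02, z10, z20] at hdet
  rw [z01] at g11 g12
  rw [z02] at g22
  have k11 : A 1 1 ^ 2 + A 2 1 ^ 2 = 1 := by linear_combination g11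
  -- The spatial block is orthogonal with determinant `A 0 0 = ±1`, so its first column determines
  -- the second.
  have z12 : A 1 2 = -(A 0 0 * A 2 1) := by
    linear_combination A 1 1 * g12 - A 0 0 * A 2 1 * hdet - A 1 2 * k11
      + A 2 1 * (A 1 1 * A 2 2 - A 1 2 * A 2 1) * h00
  have z22 : A 2 2 = A 0 0 * A 1 1 := by
    linear_combination A 2 1 * g12 + A 0 0 * A 1 1 * hdet - A 2 2 * k11
      - A 1 1 * (A 1 1 * A 2 2 - A 1 2 * A 2 1) * h00
  refine ⟨A 0 0, A 1 1, A 2 1, by linear_combination h00, k11, ?_⟩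
  convert hLA
  ext i j
  fin_cases i <;> fin_cases j <;> simp [axisMat, *]

theorem trace_comp_self (b : Module.Basis (Fin 3) ℝ V) (K : V →ₗ[ℝ] V →ₗ[ℝ] V) (p q r : ℝ) :
    LinearMap.trace ℝ V (K (p • b 0 + q • b 1 + r • b 2) ∘ₗ K (p • b 0 + q • b 1 + r • b 2)) =
      ((p • LinearMap.toMatrix b b (K (b 0)) + q • LinearMap.toMatrix b b (K (b 1))
        + r • LinearMap.toMatrix b b (K (b 2))) * (p • LinearMap.toMatrix b b (K (b 0))
        + q • LinearMap.toMatrix b b (K (b 1)) + r • LinearMap.toMatrix b b (K (b 2)))).trace := by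
  rw [LinearMap.trace_eq_matrix_trace ℝ b, LinearMap.toMatrix_comp b b b]
  simp only [map_add, map_smul]

/-- Isometries preserving a nonzero cubic with axial threefold symmetry preserve the axis. -/
theorem exists_axisMat_of_mem_cubicStabilizer (hs : h.IsSymm) (hb : IsONB h b) {a₄ a₆ : ℝ}
    (ha : a₄ ≠ 0 ∨ a₆ ≠ 0) (H : HasONBCoeffs K b (2 * a₄) 0 0 a₄ 0 a₆ 0) {L : V ≃ₗ[ℝ] V}
    (hL : L ∈ cubicStabilizer h K) :
    ∃ ε c s : ℝ, ε ^ 2 = 1 ∧ c ^ 2 + s ^ 2 = 1 ∧ L ∈ represented b (axisMat ε c s) ∧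
      ε * a₄ = a₄ ∧ a₆ * (c ^ 3 - 3 * c * s ^ 2) = a₆ := by
  have pos : 0 < 4 * a₄ ^ 2 + 2 * a₆ ^ 2 := by
    rcases ha with ha | ha <;> positivity
  -- The trace form is a positive multiple of `p ^ 2` plus a multiple of `h`; as both it and `h` are
  -- invariant, so is `p ^ 2`.
  have tr : ∀ p q r : ℝ, LinearMap.trace ℝ V
      (K (p • b 0 + q • b 1 + r • b 2) ∘ₗ K (p • b 0 + q • b 1 + r • b 2)) =
      (4 * a₄ ^ 2 + 2 * a₆ ^ 2) * p ^ 2 + (2 * a₆ ^ 2 - 2 * a₄ ^ 2) *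
        (-(p * p) + q * q + r * r) := by
    intro p q r
    rw [trace_comp_self, H.1, H.2.1, H.2.2, Matrix.trace_fin_three]
    simp [Matrix.mul_apply, Fin.sum_univ_three]
    ring
  obtain ⟨ε, c, s, hε, hcs, hLA⟩ := exists_axisMat hs hb hL.1 (by
    intro p q r
    obtain ⟨p', q', r', e⟩ := exists_coords b (L (p • b 0 + q • b 1 + r • b 2))
    have t1 := trace_comp_apply_of_mem_cubicStabilizer (hb.nondegenerate hs) hL
      (p • b 0 + q • b 1 + r • b 2)
    have t2 := hL.1.1 (p • b 0 + q • b 1 + r • b 2) (p • b 0 + q • b 1 + r • b 2)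
    rw [e, tr, tr] at t1
    rw [e, hb.apply_eq hs, hb.apply_eq hs] at t2
    have t3 := hb.apply_eq hs p' q' r' 1 0 0
    simp only [one_smul, zero_smul, add_zero] at t3
    rw [e, t3]
    apply mul_left_cancel₀ pos.ne'
    linear_combination t1 - (2 * a₆ ^ 2 - 2 * a₄ ^ 2) * t2)
  refine ⟨ε, c, s, hε, hcs, hLA, ?_, ?_⟩
  -- The two remaining conditions come from evaluating the cubic at `b 0` and at `b 1`; the latter
  -- gives the real part of `(c + i s) ^ 3`.
  · have := hL.2 ((1 : ℝ) • b 0 + (0 : ℝ) • b 1 + (0 : ℝ) • b 2)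
      ((1 : ℝ) • b 0 + (0 : ℝ) • b 1 + (0 : ℝ) • b 2)
      ((1 : ℝ) • b 0 + (0 : ℝ) • b 1 + (0 : ℝ) • b 2)
    rw [axisMat_apply hLA, H.trilinear_eq hs hb, H.trilinear_eq hs hb] at this
    linear_combination this / 2 - ε * a₄ * hε
  · have := hL.2 ((0 : ℝ) • b 0 + (1 : ℝ) • b 1 + (0 : ℝ) • b 2)
      ((0 : ℝ) • b 0 + (1 : ℝ) • b 1 + (0 : ℝ) • b 2)
      ((0 : ℝ) • b 0 + (1 : ℝ) • b 1 + (0 : ℝ) • b 2)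
    rw [axisMat_apply hLA, H.trilinear_eq hs hb, H.trilinear_eq hs hb] at this
    linear_combination this

/-- Sufficient condition for an automorphism preserving the axis to stabilize a cubic with axial
threefold symmetry. -/
theorem axisMat_mem_cubicStabilizer (hs : h.IsSymm) (hK : IsTracelessCubic h K) (hb : IsONB h b)
    {a₄ a₆ : ℝ} (H : HasONBCoeffs K b (2 * a₄) 0 0 a₄ 0 a₆ 0) {ε c s : ℝ}
    (hε : ε ^ 2 = 1) (hcs : c ^ 2 + s ^ 2 = 1) (h4 : ε * a₄ = a₄)
    (h6 : a₆ * (c ^ 3 - 3 * c * s ^ 2) = a₆) (h6' : a₆ * (3 * c ^ 2 * s - s ^ 3) = 0)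
    {L : V ≃ₗ[ℝ] V} (hL : L ∈ represented b (axisMat ε c s)) : L ∈ cubicStabilizer h K := by
  refine mem_cubicStabilizer_of_cubic hK
    (axisMat_mem_specialIsometryGroup hs hb hε hcs hL) fun x => ?_
  obtain ⟨p, q, r, rfl⟩ := exists_coords b x
  rw [axisMat_apply hL, H.trilinear_eq hs hb, H.trilinear_eq hs hb]
  -- The cubic is `2 a₄ p³ + 3 a₄ p (q² + r²) + a₆ Re (q + i r)³`, and `L` sends `q + i r` to `(c +
  -- i s)(q + i ε r)`; `h6` and `h6'` are the real and imaginary parts of `a₆ (c + i s)³ = a₆`.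
  linear_combination (2 * p ^ 3 * ε ^ 2 + 3 * p * (q ^ 2 + r ^ 2)) * h4 + 2 * p ^ 3 * a₄ * hε +
    3 * p * ε * a₄ * (q ^ 2 + ε ^ 2 * r ^ 2) * hcs + 3 * p * ε * a₄ * r ^ 2 * hε +
    (q ^ 3 - 3 * q * ε ^ 2 * r ^ 2) * h6 - 3 * a₆ * q * r ^ 2 * hε -
    (3 * q ^ 2 * ε * r - ε ^ 3 * r ^ 3) * h6'

theorem cos_two_pi_div_three : Real.cos (2 * Real.pi / 3) = -1 / 2 := by
  rw [show 2 * Real.pi / 3 = Real.pi - Real.pi / 3 by ring, Real.cos_pi_sub, Real.cos_pi_div_three]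
  ring

theorem sin_two_pi_div_three : Real.sin (2 * Real.pi / 3) = √3 / 2 := by
  rw [show 2 * Real.pi / 3 = Real.pi - Real.pi / 3 by ring, Real.sin_pi_sub, Real.sin_pi_div_three]

theorem exists_cos_sin {c s : ℝ} (hcs : c ^ 2 + s ^ 2 = 1) :
    ∃ t, c = Real.cos t ∧ s = Real.sin t := by
  have hz : ‖(⟨c, s⟩ : ℂ)‖ = 1 := by
    rw [Complex.norm_eq_sqrt_sq_add_sq, hcs, Real.sqrt_one]
  have h0 : (⟨c, s⟩ : ℂ) ≠ 0 := by
    intro h0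
    rw [h0] at hz
    simp at hz
  refine ⟨Complex.arg ⟨c, s⟩, ?_, ?_⟩
  · rw [Complex.cos_arg h0, hz, div_one]
  · rw [Complex.sin_arg, hz, div_one]

theorem exists_mem_represented_axisMat (b : Module.Basis (Fin 3) ℝ V) {ε c s : ℝ}
    (hε : ε ^ 2 = 1) (hcs : c ^ 2 + s ^ 2 = 1) :
    ∃ L : V ≃ₗ[ℝ] V, L ∈ represented b (axisMat ε c s) :=
  exists_represented b (axisMat_det hε hcs)

theorem axisMat_one : axisMat 1 1 0 = 1 := by
  ext i j
  fin_cases i <;> fin_cases j <;> simp [axisMat]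

theorem eq_one_of_mem_represented {L : V ≃ₗ[ℝ] V} (hL : L ∈ represented b 1) : L = 1 :=
  represented_inj hL (one_mem_represented b)

/-- The point `c + i s` of the unit circle has a cube of real part one, hence is a cube root of
unity. Eliminating `s` leaves `4 c³ - 3 c - 1 = (c - 1)(2 c + 1)²`. -/
theorem triple_angle_cases {c s : ℝ} (hcs : c ^ 2 + s ^ 2 = 1) (h3 : c ^ 3 - 3 * c * s ^ 2 = 1) :
    (c = 1 ∧ s = 0) ∨ (c = -1 / 2 ∧ s = √3 / 2) ∨ (c = -1 / 2 ∧ s = -(√3 / 2)) := by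
  have h : (c - 1) * (2 * c + 1) ^ 2 = 0 := by linear_combination h3 + 3 * c * hcs
  rcases mul_eq_zero.1 h with h | h
  · have hc : c = 1 := by linarith
    subst hc
    exact Or.inl ⟨rfl, by nlinarith⟩
  · have hc : c = -1 / 2 := by
      have := pow_eq_zero_iff (two_ne_zero) |>.1 h
      linarith
    subst hc
    have h3 : √3 ^ 2 = (3 : ℝ) := Real.sq_sqrt (by norm_num)
    have : (s - √3 / 2) * (s + √3 / 2) = 0 := by linear_combination hcs - h3 / 4
    rcases mul_eq_zero.1 this with h | h
    · exact Or.inr (Or.inl ⟨rfl, by linarith⟩)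
    · exact Or.inr (Or.inr ⟨rfl, by linarith⟩)

/-- The powers of a rotation of order three. -/
theorem represented_matA_sq {r : V ≃ₗ[ℝ] V} (hr : r ∈ represented b (matA (2 * Real.pi / 3))) :
    r * r ∈ represented b (axisMat 1 (-1 / 2) (-(√3 / 2))) := by
  have h3 : √3 * √3 = (3 : ℝ) := Real.mul_self_sqrt (by norm_num)
  convert represented_mul hr hr using 2
  rw [matA_eq, cos_two_pi_div_three, sin_two_pi_div_three, axisMat_mul, axisMat]
  ext i j
  fin_cases i <;> fin_cases j <;> simp <;> first | ring1 | linear_combination h3 / 4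

theorem represented_mul_matB {r B : V ≃ₗ[ℝ] V} {c s : ℝ} (hr : r ∈ represented b (axisMat 1 c s))
    (hB : B ∈ represented b matB) : r * B ∈ represented b (axisMat (-1) c s) := by
  convert represented_mul hr hB using 2
  rw [matB_eq, axisMat_mul, axisMat]
  ext i j
  fin_cases i <;> fin_cases j <;> simp

/-! ### Stabilizers of the normal forms in orthonormal bases -/

theorem symmetrySet_so2 (hs : h.IsSymm) (hK : IsTracelessCubic h K) (hb : IsONB h b)
    (H : HasNormalForm K b .so2) :
    symmetrySet h b .so2 = (cubicStabilizer h K : Set (V ≃ₗ[ℝ] V)) := by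
  obtain ⟨a₄, ha, H⟩ := H
  apply Set.Subset.antisymm
  · rintro L ⟨s, hL⟩
    rw [matA_eq] at hL
    exact axisMat_mem_cubicStabilizer hs hK hb H (by norm_num)
      (Real.cos_sq_add_sin_sq s) (by ring) (by ring) (by ring) hL
  · intro L hL
    obtain ⟨ε, c, s, -, hcs, hLA, h4, -⟩ :=
      exists_axisMat_of_mem_cubicStabilizer hs hb (Or.inl ha.ne') H hL
    have hε : ε = 1 := mul_right_cancel₀ ha.ne' (h4.trans (one_mul _).symm)
    subst hε
    obtain ⟨t, rfl, rfl⟩ := exists_cos_sin hcs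
    exact ⟨t, by rwa [matA_eq]⟩

theorem symmetrySet_z3 (hs : h.IsSymm) (hK : IsTracelessCubic h K) (hb : IsONB h b)
    (H : HasNormalForm K b .z3) :
    symmetrySet h b .z3 = (cubicStabilizer h K : Set (V ≃ₗ[ℝ] V)) := by
  obtain ⟨a₄, a₆, ha₄, ha, H⟩ := H
  have h3 : √3 ^ 2 = (3 : ℝ) := Real.sq_sqrt (by norm_num)
  apply Set.Subset.antisymm
  · simp only [symmetrySet, SetLike.coe_subset_coe, Subgroup.closure_le]
    intro L hL
    rw [matA_eq, cos_two_pi_div_three, sin_two_pi_div_three] at hL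
    exact axisMat_mem_cubicStabilizer hs hK hb H (by norm_num)
      (by linear_combination h3 / 4) (by ring) (by linear_combination 3 / 8 * a₆ * h3)
      (by linear_combination -a₆ * √3 / 8 * h3) hL
  · intro L hL
    obtain ⟨ε, c, s, -, hcs, hLA, h4, h6⟩ :=
      exists_axisMat_of_mem_cubicStabilizer hs hb (Or.inl ha₄.ne') H hL
    have hε : ε = 1 := mul_right_cancel₀ ha₄.ne' (h4.trans (one_mul _).symm)
    subst hε
    obtain ⟨r, hr⟩ := exists_mem_represented_axisMat b (one_pow 2)
      (Real.cos_sq_add_sin_sq (2 * Real.pi / 3))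
    rw [← matA_eq] at hr
    have hrm : r ∈ Subgroup.closure (represented b (matA (2 * Real.pi / 3))) :=
      Subgroup.subset_closure hr
    have hr' := hr
    rw [matA_eq, cos_two_pi_div_three, sin_two_pi_div_three] at hr'
    rcases triple_angle_cases hcs (mul_left_cancel₀ ha.ne' (h6.trans (mul_one _).symm)) with
      ⟨rfl, rfl⟩ | ⟨rfl, rfl⟩ | ⟨rfl, rfl⟩
    · rw [axisMat_one] at hLA
      rw [eq_one_of_mem_represented hLA]
      exact one_mem _
    · rw [represented_inj hLA hr']
      exact hrm
    · rw [represented_inj hLA (represented_matA_sq hr)]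
      exact mul_mem hrm hrm

/-- With `a₄ = 0` the time orientation `ε` is unconstrained, which doubles the three rotations to
six elements. -/
theorem symmetrySet_s3 (hs : h.IsSymm) (hK : IsTracelessCubic h K) (hb : IsONB h b)
    (H : HasNormalForm K b .s3) :
    symmetrySet h b .s3 = (cubicStabilizer h K : Set (V ≃ₗ[ℝ] V)) := by
  obtain ⟨a₆, ha, H⟩ := H
  have H : HasONBCoeffs K b (2 * 0) 0 0 0 0 a₆ 0 := by rwa [mul_zero]
  have h3 : √3 ^ 2 = (3 : ℝ) := Real.sq_sqrt (by norm_num)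
  apply Set.Subset.antisymm
  · simp only [symmetrySet, SetLike.coe_subset_coe, Subgroup.closure_le]
    rintro L (hL | hL)
    · rw [matA_eq, cos_two_pi_div_three, sin_two_pi_div_three] at hL
      exact axisMat_mem_cubicStabilizer hs hK hb H (by norm_num)
        (by linear_combination h3 / 4) (by ring) (by linear_combination 3 / 8 * a₆ * h3)
        (by linear_combination -a₆ * √3 / 8 * h3) hL
    · rw [matB_eq] at hL
      exact axisMat_mem_cubicStabilizer hs hK hb H (by norm_num)
        (by norm_num) (by ring) (by ring) (by ring) hL
  · intro L hL
    obtain ⟨ε, c, s, hε, hcs, hLA, -, h6⟩ :=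
      exists_axisMat_of_mem_cubicStabilizer hs hb (Or.inr ha.ne') H hL
    obtain ⟨r, hr⟩ := exists_mem_represented_axisMat b (one_pow 2)
      (Real.cos_sq_add_sin_sq (2 * Real.pi / 3))
    obtain ⟨B, hB⟩ := exists_mem_represented_axisMat b (ε := -1) (c := 1) (s := 0)
      (by norm_num) (by norm_num)
    rw [← matA_eq] at hr
    rw [← matB_eq] at hB
    have hrm : r ∈ (Subgroup.closure (represented b (matA (2 * Real.pi / 3)) ∪
        represented b matB)) := Subgroup.subset_closure (Or.inl hr)
    have hBm : B ∈ (Subgroup.closure (represented b (matA (2 * Real.pi / 3)) ∪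
        represented b matB)) := Subgroup.subset_closure (Or.inr hB)
    have hr' := hr
    rw [matA_eq, cos_two_pi_div_three, sin_two_pi_div_three] at hr'
    have hε' : ε = 1 ∨ ε = -1 := by simpa using hε
    rcases triple_angle_cases hcs (mul_left_cancel₀ ha.ne' (h6.trans (mul_one _).symm)) with
      ⟨rfl, rfl⟩ | ⟨rfl, rfl⟩ | ⟨rfl, rfl⟩ <;> rcases hε' with rfl | rfl
    · rw [axisMat_one] at hLA
      rw [eq_one_of_mem_represented hLA]
      exact one_mem _
    · rw [← matB_eq] at hLA
      rw [represented_inj hLA hB]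
      exact hBm
    · rw [represented_inj hLA hr']
      exact hrm
    · rw [represented_inj hLA (represented_mul_matB hr' hB)]
      exact mul_mem hrm hBm
    · rw [represented_inj hLA (represented_matA_sq hr)]
      exact mul_mem hrm hrm
    · rw [represented_inj hLA (represented_mul_matB (represented_matA_sq hr) hB)]
      exact mul_mem (mul_mem hrm hrm) hBm

theorem symmetrySet_zero (H : K = 0) :
    symmetrySet h b .zero = (cubicStabilizer h K : Set (V ≃ₗ[ℝ] V)) := by
  subst H
  ext L
  simp [symmetrySet, mem_cubicStabilizer]

/-- Every monomial of this cubic has even degree in the two coordinates that `B` negates. -/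
theorem z2B_le (hs : h.IsSymm) (hK : IsTracelessCubic h K) (hb : IsONB h b)
    {a₂ a₅ a₆ : ℝ} (H : HasONBCoeffs K b 0 a₂ 0 0 a₅ a₆ 0) :
    represented b matB ⊆ (cubicStabilizer h K : Set (V ≃ₗ[ℝ] V)) := by
  intro L hL
  rw [matB_eq] at hL
  refine mem_cubicStabilizer_of_cubic hK
    (axisMat_mem_specialIsometryGroup hs hb (by norm_num) (by norm_num) hL) fun x => ?_
  obtain ⟨p, q, r, rfl⟩ := exists_coords b x
  rw [axisMat_apply hL, H.trilinear_eq hs hb, H.trilinear_eq hs hb]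
  ring

/-- Every monomial has even degree in the two spatial coordinates. The coefficient `a₅` is kept so
that the same statement serves `.z2z2`. -/
theorem z2A_le (hs : h.IsSymm) (hK : IsTracelessCubic h K) (hb : IsONB h b)
    {a₁ a₄ a₅ : ℝ} (H : HasONBCoeffs K b a₁ 0 0 a₄ a₅ 0 0) :
    represented b (matA Real.pi) ⊆ (cubicStabilizer h K : Set (V ≃ₗ[ℝ] V)) := by
  intro L hL
  rw [matA_eq, Real.cos_pi, Real.sin_pi] at hL
  refine mem_cubicStabilizer_of_cubic hK
    (axisMat_mem_specialIsometryGroup hs hb (by norm_num) (by norm_num) hL) fun x => ?_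
  obtain ⟨p, q, r, rfl⟩ := exists_coords b x
  rw [axisMat_apply hL, H.trilinear_eq hs hb, H.trilinear_eq hs hb]
  ring

/-- Here the trace form is `-2 a₅² h` and carries no information. Instead one uses that the cubic is
`6 a₅ p q r`, a product of three coordinates, and compares its values on basis vectors. -/
theorem exists_axisMat_of_mem_cubicStabilizer_z2z2 (hs : h.IsSymm) (hb : IsONB h b) {a₅ : ℝ}
    (ha : a₅ ≠ 0) (H : HasONBCoeffs K b 0 0 0 0 a₅ 0 0) {L : V ≃ₗ[ℝ] V}
    (hL : L ∈ cubicStabilizer h K) :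
    ∃ ε c : ℝ, ε ^ 2 = 1 ∧ c ^ 2 = 1 ∧ L ∈ represented b (axisMat ε c 0) := by
  have hLA := mem_represented_toMatrix b L
  generalize LinearMap.toMatrix b b (L : V →ₗ[ℝ] V) = A at hLA
  obtain ⟨G, hdet⟩ := (hb.mem_specialIsometryGroup_iff hs hLA).1 hL.1
  have T : ∀ p q r p' q' r' p'' q'' r'' : ℝ, _ := fun p q r p' q' r' p'' q'' r'' =>
    hL.2 (p • b 0 + q • b 1 + r • b 2) (p' • b 0 + q' • b 1 + r' • b 2)
      (p'' • b 0 + q'' • b 1 + r'' • b 2)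
  simp only [represented_apply hLA, H.trilinear_eq hs hb] at T
  have t000 := T 1 0 0 1 0 0 1 0 0
  have t001 := T 1 0 0 1 0 0 0 1 0
  have t002 := T 1 0 0 1 0 0 0 0 1
  have t011 := T 1 0 0 0 1 0 0 1 0
  have t022 := T 1 0 0 0 0 1 0 0 1
  have t012 := T 1 0 0 0 1 0 0 0 1
  have g00 := G 1 0 0 1 0 0
  have g01 := G 1 0 0 0 1 0
  have g02 := G 1 0 0 0 0 1
  have g11 := G 0 1 0 0 1 0
  clear T G
  simp only [mul_one, mul_zero, add_zero, zero_add] at *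
  rw [Matrix.det_fin_three] at hdet
  -- The image of `b 0` is timelike, so its time component is nonzero.
  have n00 : A 0 0 ≠ 0 := by
    intro h0
    rw [h0] at g00
    nlinarith [sq_nonneg (A 1 0), sq_nonneg (A 2 0)]
  have u000 : A 1 0 * A 2 0 = 0 := by
    apply mul_left_cancel₀ (mul_ne_zero ha n00)
    linear_combination t000 / 6
  -- One of the two entries vanishes by `u000`. If the other did not, `t001` and `t002` would kill
  -- the rest of the row of the vanishing one, against `det A = 1`.
  have z : A 1 0 = 0 ∧ A 2 0 = 0 := by
    by_contra hne
    rcases mul_eq_zero.1 u000 with h0 | h0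
    · have h2 : A 2 0 ≠ 0 := fun h2 => hne ⟨h0, h2⟩
      have z1 : A 1 1 = 0 := by
        apply mul_left_cancel₀ (mul_ne_zero ha (mul_ne_zero n00 h2))
        rw [h0] at t001
        linear_combination t001 / 2
      have z2 : A 1 2 = 0 := by
        apply mul_left_cancel₀ (mul_ne_zero ha (mul_ne_zero n00 h2))
        rw [h0] at t002
        linear_combination t002 / 2
      rw [h0, z1, z2] at hdet
      norm_num at hdet
    · have h2 : A 1 0 ≠ 0 := fun h2 => hne ⟨h2, h0⟩
      have z1 : A 2 1 = 0 := by
        apply mul_left_cancel₀ (mul_ne_zero ha (mul_ne_zero n00 h2))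
        rw [h0] at t001
        linear_combination t001 / 2
      have z2 : A 2 2 = 0 := by
        apply mul_left_cancel₀ (mul_ne_zero ha (mul_ne_zero n00 h2))
        rw [h0] at t002
        linear_combination t002 / 2
      rw [h0, z1, z2] at hdet
      norm_num at hdet
  obtain ⟨z10, z20⟩ := z
  rw [z10, z20] at g00 g01 g02 t011 t022 t012 hdet
  have z01 : A 0 1 = 0 := by
    apply mul_left_cancel₀ n00
    linear_combination -g01
  have z02 : A 0 2 = 0 := by
    apply mul_left_cancel₀ n00
    linear_combination -g02
  have u012 : A 0 0 * (A 1 1 * A 2 2 + A 1 2 * A 2 1) = 1 := by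
    apply mul_left_cancel₀ ha
    linear_combination t012
  -- The value at `(b 0, b 1, b 2)` yields a permanent where the determinant has a minus sign; their
  -- mean isolates the diagonal product.
  have u : A 0 0 * A 1 1 * A 2 2 = 1 := by linear_combination u012 / 2 + hdet / 2
  have n11 : A 1 1 ≠ 0 := by rintro e; simp [e] at u
  have n22 : A 2 2 ≠ 0 := by rintro e; simp [e] at u
  have z21 : A 2 1 = 0 := by
    apply mul_left_cancel₀ (mul_ne_zero ha (mul_ne_zero n00 n11))
    linear_combination t011 / 2
  have z12 : A 1 2 = 0 := by
    apply mul_left_cancel₀ (mul_ne_zero ha (mul_ne_zero n00 n22))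
    linear_combination t022 / 2
  rw [z01, z21] at g11
  have q00 : A 0 0 ^ 2 = 1 := by linear_combination -g00
  have q11 : A 1 1 ^ 2 = 1 := by linear_combination g11
  have e22 : A 2 2 = A 0 0 * A 1 1 := by
    linear_combination A 0 0 * A 1 1 * u - A 2 2 * A 0 0 ^ 2 * q11 - A 2 2 * q00
  refine ⟨A 0 0, A 1 1, q00, q11, ?_⟩
  convert hLA
  ext i j
  fin_cases i <;> fin_cases j <;> simp [axisMat, *]

theorem represented_matA_pi_mul_matB {r B : V ≃ₗ[ℝ] V} (hr : r ∈ represented b (matA Real.pi))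
    (hB : B ∈ represented b matB) : r * B ∈ represented b (axisMat (-1) (-1) 0) := by
  rw [matA_eq, Real.cos_pi, Real.sin_pi] at hr
  exact represented_mul_matB hr hB

theorem matA_det (s : ℝ) : (matA s).det = 1 := by
  rw [matA_eq]
  exact axisMat_det (one_pow 2) (Real.cos_sq_add_sin_sq s)

theorem matB_det : matB.det = 1 := by
  rw [matB_eq]
  exact axisMat_det (by norm_num) (by norm_num)

/-- The diagonal automorphisms generated by two half-turns. -/
theorem mem_closure_z2z2 {ε c : ℝ} (hε : ε ^ 2 = 1) (hc : c ^ 2 = 1) {L : V ≃ₗ[ℝ] V}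
    (hLA : L ∈ represented b (axisMat ε c 0)) :
    L ∈ Subgroup.closure (represented b (matA Real.pi) ∪ represented b matB) := by
  obtain ⟨r, hr⟩ := exists_represented b (matA_det Real.pi)
  obtain ⟨B, hB⟩ := exists_represented b matB_det
  have hrm : r ∈ (Subgroup.closure (represented b (matA Real.pi) ∪
      represented b matB)) := Subgroup.subset_closure (Or.inl hr)
  have hBm : B ∈ (Subgroup.closure (represented b (matA Real.pi) ∪
      represented b matB)) := Subgroup.subset_closure (Or.inr hB)
  have hε' : ε = 1 ∨ ε = -1 := by simpa using hε
  have hc' : c = 1 ∨ c = -1 := by simpa using hc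
  rcases hε' with rfl | rfl <;> rcases hc' with rfl | rfl
  · rw [axisMat_one] at hLA
    rw [eq_one_of_mem_represented hLA]
    exact one_mem _
  · have hr' := hr
    rw [matA_eq, Real.cos_pi, Real.sin_pi] at hr'
    rw [represented_inj hLA hr']
    exact hrm
  · rw [← matB_eq] at hLA
    rw [represented_inj hLA hB]
    exact hBm
  · rw [represented_inj hLA (represented_matA_pi_mul_matB hr hB)]
    exact mul_mem hrm hBm

theorem symmetrySet_z2z2 (hs : h.IsSymm) (hK : IsTracelessCubic h K) (hb : IsONB h b)
    (H : HasNormalForm K b .z2z2) :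
    symmetrySet h b .z2z2 = (cubicStabilizer h K : Set (V ≃ₗ[ℝ] V)) := by
  obtain ⟨a₅, ha, H⟩ := H
  apply Set.Subset.antisymm
  · simp only [symmetrySet, SetLike.coe_subset_coe, Subgroup.closure_le]
    exact Set.union_subset (z2A_le hs hK hb H) (z2B_le hs hK hb H)
  · intro L hL
    obtain ⟨ε, c, hε, hc, hLA⟩ := exists_axisMat_of_mem_cubicStabilizer_z2z2 hs hb ha.ne' H hL
    exact mem_closure_z2z2 hε hc hLA

/-! ### Stabilizers of the normal forms in light-vector bases -/

theorem matC_apply {l : ℝ} {L : V ≃ₗ[ℝ] V} (hL : L ∈ represented b (matC l)) (p q r : ℝ) :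
    L (p • b 0 + q • b 1 + r • b 2) = (l * p) • b 0 + q • b 1 + (1 / l * r) • b 2 := by
  rw [represented_apply hL]
  simp [matC]

theorem matN_apply {m : ℝ} {L : V ≃ₗ[ℝ] V} (hL : L ∈ represented b (matN m)) (p q r : ℝ) :
    L (p • b 0 + q • b 1 + r • b 2) =
      (p - m * q - m ^ 2 / 2 * r) • b 0 + (q + m * r) • b 1 + r • b 2 := by
  rw [represented_apply hL]
  simp [matN, sub_eq_add_neg]

theorem matC_det {l : ℝ} (hl : l ≠ 0) : (matC l).det = 1 := by
  simp [matC, Matrix.det_fin_three, hl]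

theorem matN_det (m : ℝ) : (matN m).det = 1 := by
  simp [matN, Matrix.det_fin_three]

theorem matC_mem_specialIsometryGroup (hs : h.IsSymm) (hb : IsLVB h b) {l : ℝ} (hl : l ≠ 0)
    {L : V ≃ₗ[ℝ] V} (hL : L ∈ represented b (matC l)) : L ∈ specialIsometryGroup h := by
  rw [hb.mem_specialIsometryGroup_iff hs hL]
  refine ⟨fun p q r p' q' r' => ?_, matC_det hl⟩
  simp [matC]
  field_simp

theorem matN_mem_specialIsometryGroup (hs : h.IsSymm) (hb : IsLVB h b) {m : ℝ}
    {L : V ≃ₗ[ℝ] V} (hL : L ∈ represented b (matN m)) : L ∈ specialIsometryGroup h := by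
  rw [hb.mem_specialIsometryGroup_iff hs hL]
  refine ⟨fun p q r p' q' r' => ?_, matN_det m⟩
  simp [matN]
  ring

/-- A special isometry fixing the spacelike vector of a light-vector basis, in terms of its
matrix. -/
theorem IsLVB.eq_matC (hs : h.IsSymm) (hb : IsLVB h b) {A : Matrix (Fin 3) (Fin 3) ℝ}
    {L : V ≃ₗ[ℝ] V} (hLA : L ∈ represented b A) (hL : L ∈ specialIsometryGroup h)
    (h01 : A 0 1 = 0) (h11 : A 1 1 = 1) (h21 : A 2 1 = 0) :
    A 0 0 ≠ 0 ∧ A = matC (A 0 0) := by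
  obtain ⟨G, hdet⟩ := (hb.mem_specialIsometryGroup_iff hs hLA).1 hL
  have g00 := G 1 0 0 1 0 0
  have g01 := G 1 0 0 0 1 0
  have g12 := G 0 1 0 0 0 1
  have g02 := G 1 0 0 0 0 1
  have g22 := G 0 0 1 0 0 1
  clear G
  simp only [mul_one, mul_zero, add_zero, zero_add, h01, h11, h21, one_mul, zero_mul]
    at g00 g01 g12 g02 g22
  rw [Matrix.det_fin_three, h01, h11, h21, g01, g12] at hdet
  rw [g01] at g00 g02
  rw [g12] at g22
  -- `h (L e) (L f) = 1` and `det A = 1` differ only in the sign of `A 0 2 * A 2 0`.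
  have u : A 0 0 * A 2 2 = 1 := by linear_combination g02 / 2 + hdet / 2
  have n00 : A 0 0 ≠ 0 := by rintro e; simp [e] at u
  have n22 : A 2 2 ≠ 0 := by rintro e; simp [e] at u
  have z20 : A 2 0 = 0 := by
    apply mul_left_cancel₀ n00
    linear_combination g00 / 2
  have z02 : A 0 2 = 0 := by
    apply mul_left_cancel₀ n22
    linear_combination g22 / 2
  refine ⟨n00, ?_⟩
  have e22 : A 2 2 = (A 0 0)⁻¹ := eq_inv_of_mul_eq_one_right u
  ext i j
  fin_cases i <;> fin_cases j <;> simp [matC, *]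

theorem symmetrySet_so11 (hs : h.IsSymm) (hK : IsTracelessCubic h K) (hb : IsLVB h b)
    (H : HasNormalForm K b .so11) :
    symmetrySet h b .so11 = (cubicStabilizer h K : Set (V ≃ₗ[ℝ] V)) := by
  obtain ⟨b₄, hb₄, H⟩ := H
  apply Set.Subset.antisymm
  · rintro L ⟨l, hl, hL⟩
    refine mem_cubicStabilizer_of_cubic hK (matC_mem_specialIsometryGroup hs hb hl hL)
      fun x => ?_
    obtain ⟨p, q, r, rfl⟩ := exists_coords b x
    rw [matC_apply hL, H.trilinear_eq hs hb, H.trilinear_eq hs hb]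
    field_simp
    ring
  · intro L hL
    -- Modulo a multiple of `h` the trace form is `4 b₄² q²`, so symmetries preserve `q` up to sign;
    -- the value `-2 b₄` of the cubic at `b 1` then fixes the sign.
    have tr : ∀ p q r : ℝ, LinearMap.trace ℝ V
        (K (p • b 0 + q • b 1 + r • b 2) ∘ₗ K (p • b 0 + q • b 1 + r • b 2)) =
        4 * b₄ ^ 2 * q ^ 2 + 2 * b₄ ^ 2 * (p * r + q * q + r * p) := by
      intro p q r
      rw [trace_comp_self, H.1, H.2.1, H.2.2, Matrix.trace_fin_three]
      simp [Matrix.mul_apply, Fin.sum_univ_three]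
      ring
    have hLA := mem_represented_toMatrix b L
    generalize LinearMap.toMatrix b b (L : V →ₗ[ℝ] V) = A at hLA
    have Q : ∀ p q r : ℝ, (A 1 0 * p + A 1 1 * q + A 1 2 * r) ^ 2 = q ^ 2 := by
      intro p q r
      have t1 := trace_comp_apply_of_mem_cubicStabilizer (hb.nondegenerate hs) hL
        (p • b 0 + q • b 1 + r • b 2)
      have t2 := hL.1.1 (p • b 0 + q • b 1 + r • b 2) (p • b 0 + q • b 1 + r • b 2)
      rw [represented_apply hLA, tr, tr] at t1
      rw [represented_apply hLA, hb.apply_eq hs, hb.apply_eq hs] at t2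
      apply mul_left_cancel₀ (show 4 * b₄ ^ 2 ≠ 0 by positivity)
      linear_combination t1 - 2 * b₄ ^ 2 * t2
    obtain ⟨G, hdet⟩ := (hb.mem_specialIsometryGroup_iff hs hLA).1 hL.1
    have q0 := Q 1 0 0
    have q1 := Q 0 1 0
    have q2 := Q 0 0 1
    have g01 := G 1 0 0 0 1 0
    have g11 := G 0 1 0 0 1 0
    have g12 := G 0 1 0 0 0 1
    have t := hL.2 ((0 : ℝ) • b 0 + (1 : ℝ) • b 1 + (0 : ℝ) • b 2)
      ((0 : ℝ) • b 0 + (1 : ℝ) • b 1 + (0 : ℝ) • b 2)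
      ((0 : ℝ) • b 0 + (1 : ℝ) • b 1 + (0 : ℝ) • b 2)
    simp only [represented_apply hLA, H.trilinear_eq hs hb] at t
    clear Q G
    simp only [mul_one, mul_zero, add_zero, zero_add] at t q0 q1 q2 g01 g11 g12
    have z10 : A 1 0 = 0 := by simpa using q0
    have z12 : A 1 2 = 0 := by simpa using q2
    rw [Matrix.det_fin_three, z10, z12] at hdet
    rw [z10] at g01
    rw [z12] at g12
    -- Orthogonality of `L (b 1)` to `L (b 0)` and `L (b 2)` is a homogeneous linear system in `A 0
    -- 1`, `A 2 1`; by `hdet` its determinant is nonzero.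
    have z01 : A 0 1 = 0 := by
      linear_combination -A 0 1 * hdet + A 1 1 * A 0 0 * g12 - A 1 1 * A 0 2 * g01
    have z21 : A 2 1 = 0 := by
      linear_combination -A 2 1 * hdet + A 1 1 * A 2 2 * g01 - A 1 1 * A 2 0 * g12
    rw [z01, z21] at t
    have z11 : A 1 1 = 1 := by
      apply mul_left_cancel₀ hb₄.ne'
      linear_combination -t / 2 - b₄ * A 1 1 * q1
    obtain ⟨hl, hA⟩ := hb.eq_matC hs hLA hL.1 z01 z11 z21
    exact ⟨A 0 0, hl, hA ▸ hLA⟩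

/-- A special isometry fixing a lightlike vector, in terms of its matrix. -/
theorem IsLVB.eq_matN (hs : h.IsSymm) (hb : IsLVB h b) {A : Matrix (Fin 3) (Fin 3) ℝ}
    {L : V ≃ₗ[ℝ] V} (hLA : L ∈ represented b A) (hL : L ∈ specialIsometryGroup h)
    (h20 : A 2 0 = 0) (h21 : A 2 1 = 0) (h22 : A 2 2 = 1) : A = matN (A 1 2) := by
  obtain ⟨G, hdet⟩ := (hb.mem_specialIsometryGroup_iff hs hLA).1 hL
  have g00 := G 1 0 0 1 0 0
  have g02 := G 1 0 0 0 0 1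
  have g12 := G 0 1 0 0 0 1
  have g22 := G 0 0 1 0 0 1
  clear G
  simp only [mul_one, mul_zero, add_zero, zero_add, h20, h21, h22, one_mul, zero_mul]
    at g00 g02 g12 g22
  have z10 : A 1 0 = 0 := by simpa using g00
  rw [Matrix.det_fin_three, h20, h21, h22, z10] at hdet
  rw [z10] at g02
  have z00 : A 0 0 = 1 := by linear_combination g02
  rw [z00] at hdet
  have z11 : A 1 1 = 1 := by linear_combination hdet
  rw [z11] at g12
  have z01 : A 0 1 = -A 1 2 := by linear_combination g12
  have z02 : A 0 2 = -(A 1 2 ^ 2 / 2) := by linear_combination g22 / 2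
  ext i j
  fin_cases i <;> fin_cases j <;> simp [matN, *]

/-- The cubic is `b₇ r³` with `r = h(·, e)`. Real cube roots are unique, so a symmetry preserves the
linear form `r` and hence fixes `e`. -/
theorem symmetrySet_real (hs : h.IsSymm) (hK : IsTracelessCubic h K) (hb : IsLVB h b)
    (H : HasNormalForm K b .real) :
    symmetrySet h b .real = (cubicStabilizer h K : Set (V ≃ₗ[ℝ] V)) := by
  obtain ⟨b₇, hb₇, H⟩ := H
  apply Set.Subset.antisymm
  · rintro L ⟨m, hL⟩
    refine mem_cubicStabilizer_of_cubic hK (matN_mem_specialIsometryGroup hs hb hL)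
      fun x => ?_
    obtain ⟨p, q, r, rfl⟩ := exists_coords b x
    rw [matN_apply hL, H.trilinear_eq hs hb, H.trilinear_eq hs hb]
    ring
  · intro L hL
    have hLA := mem_represented_toMatrix b L
    generalize LinearMap.toMatrix b b (L : V →ₗ[ℝ] V) = A at hLA
    have T : ∀ p q r : ℝ, _ := fun p q r => hL.2 (p • b 0 + q • b 1 + r • b 2)
      (p • b 0 + q • b 1 + r • b 2) (p • b 0 + q • b 1 + r • b 2)
    simp only [represented_apply hLA, H.trilinear_eq hs hb] at T
    have t0 := T 1 0 0
    have t1 := T 0 1 0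
    have t2 := T 0 0 1
    clear T
    simp only [mul_one, mul_zero, add_zero, zero_add, zero_mul, sub_zero] at t0 t1 t2
    have z20 : A 2 0 ^ 3 = 0 := by
      apply mul_left_cancel₀ hb₇.ne'
      linear_combination t0
    have z21 : A 2 1 ^ 3 = 0 := by
      apply mul_left_cancel₀ hb₇.ne'
      linear_combination t1
    have z22 : A 2 2 ^ 3 = 1 := by
      apply mul_left_cancel₀ hb₇.ne'
      linear_combination t2
    have hA := hb.eq_matN hs hLA hL.1 (by simpa using z20) (by simpa using z21)
      (by
        have : (A 2 2 - 1) * (A 2 2 ^ 2 + A 2 2 + 1) = 0 := by linear_combination z22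
        rcases mul_eq_zero.1 this with h0 | h0
        · linarith
        · nlinarith [sq_nonneg (2 * A 2 2 + 1)])
    exact ⟨A 1 2, hA ▸ hLA⟩

/-- Equality can fail for the two excluded labels: `.z2A` with `a₁ = 0` is `.z2z2` in a basis
rotated by `π/4`, and `.z2B` with `a₅ = 0`, `a₆ = 2 a₂` is `.so11` written in an orthonormal basis.
-/
theorem symmetrySet_subset (hs : h.IsSymm) (hK : IsTracelessCubic h K) (c : FormType)
    (hb : IsAdapted h b c) (H : HasNormalForm K b c) :
    symmetrySet h b c ⊆ (cubicStabilizer h K : Set (V ≃ₗ[ℝ] V)) ∧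
      (c ≠ .z2B → c ≠ .z2A →
        symmetrySet h b c = (cubicStabilizer h K : Set (V ≃ₗ[ℝ] V))) := by
  cases c with
  | zero => exact ⟨(symmetrySet_zero H).subset, fun _ _ => symmetrySet_zero H⟩
  | so2 => exact ⟨(symmetrySet_so2 hs hK hb H).subset, fun _ _ => symmetrySet_so2 hs hK hb H⟩
  | s3 => exact ⟨(symmetrySet_s3 hs hK hb H).subset, fun _ _ => symmetrySet_s3 hs hK hb H⟩
  | z3 => exact ⟨(symmetrySet_z3 hs hK hb H).subset, fun _ _ => symmetrySet_z3 hs hK hb H⟩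
  | z2B =>
    obtain ⟨a₂, a₅, a₆, -, -, H⟩ := H
    refine ⟨?_, fun h1 _ => absurd rfl h1⟩
    simpa only [symmetrySet, SetLike.coe_subset_coe, Subgroup.closure_le] using
      z2B_le hs hK hb H
  | z2z2 => exact ⟨(symmetrySet_z2z2 hs hK hb H).subset, fun _ _ => symmetrySet_z2z2 hs hK hb H⟩
  | z2A =>
    obtain ⟨a₁, a₄, -, -, H⟩ := H
    refine ⟨?_, fun _ h1 => absurd rfl h1⟩
    simpa only [symmetrySet, SetLike.coe_subset_coe, Subgroup.closure_le] using
      z2A_le hs hK hb H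
  | so11 => exact ⟨(symmetrySet_so11 hs hK hb H).subset, fun _ _ => symmetrySet_so11 hs hK hb H⟩
  | real => exact ⟨(symmetrySet_real hs hK hb H).subset, fun _ _ => symmetrySet_real hs hK hb H⟩

/-! ### Adapted bases through a prescribed vector -/

theorem exists_basis_of_dual (b : Module.Basis (Fin 3) ℝ V) {x y z : V} {f g k : V →ₗ[ℝ] ℝ}
    (hf : f x ≠ 0 ∧ f y = 0 ∧ f z = 0) (hg : g x = 0 ∧ g y ≠ 0 ∧ g z = 0)
    (hk : k x = 0 ∧ k y = 0 ∧ k z ≠ 0) :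
    ∃ b' : Module.Basis (Fin 3) ℝ V, b' 0 = x ∧ b' 1 = y ∧ b' 2 = z := by
  have li : LinearIndependent ℝ ![x, y, z] := by
    rw [Fintype.linearIndependent_iff]
    intro c hc
    simp only [Fin.sum_univ_three, Matrix.cons_val] at hc
    have h0 := congrArg f hc
    have h1 := congrArg g hc
    have h2 := congrArg k hc
    simp [hf.2, hg.1, hg.2.2, hk.1, hk.2.1, hf.1, hg.2.1, hk.2.2] at h0 h1 h2
    intro i
    fin_cases i
    exacts [h0, h1, h2]
  have card : Fintype.card (Fin 3) = Module.finrank ℝ V := (Module.finrank_eq_card_basis b).symm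
  refine ⟨basisOfLinearIndependentOfCardEqFinrank li card, ?_, ?_, ?_⟩ <;> simp

theorem exists_onb (hs : h.IsSymm) (b : Module.Basis (Fin 3) ℝ V) {x y z : V}
    (h00 : h x x = -1) (h11 : h y y = 1) (h22 : h z z = 1) (h01 : h x y = 0) (h02 : h x z = 0)
    (h12 : h y z = 0) :
    ∃ b' : Module.Basis (Fin 3) ℝ V, IsONB h b' ∧ b' 0 = x ∧ b' 1 = y ∧ b' 2 = z := by
  have h10 : h y x = 0 := (hs.eq y x).trans h01
  have h20 : h z x = 0 := (hs.eq z x).trans h02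
  have h21 : h z y = 0 := (hs.eq z y).trans h12
  obtain ⟨b', rfl, rfl, rfl⟩ := exists_basis_of_dual b (x := x) (y := y) (z := z)
    (f := h x) (g := h y) (k := h z)
    ⟨by simp [h00], h01, h02⟩ ⟨h10, by simp [h11], h12⟩ ⟨h20, h21, by simp [h22]⟩
  exact ⟨b', ⟨h00, h11, h22, h01, h02, h12⟩, rfl, rfl, rfl⟩

theorem exists_lvb (hs : h.IsSymm) (b : Module.Basis (Fin 3) ℝ V) {x y z : V}
    (h00 : h x x = 0) (h11 : h y y = 1) (h22 : h z z = 0) (h01 : h x y = 0) (h02 : h x z = 1)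
    (h21 : h z y = 0) :
    ∃ b' : Module.Basis (Fin 3) ℝ V, IsLVB h b' ∧ b' 0 = x ∧ b' 1 = y ∧ b' 2 = z := by
  have h10 : h y x = 0 := (hs.eq y x).trans h01
  have h20 : h z x = 1 := (hs.eq z x).trans h02
  have h12 : h y z = 0 := (hs.eq y z).trans h21
  obtain ⟨b', rfl, rfl, rfl⟩ := exists_basis_of_dual b (x := x) (y := y) (z := z)
    (f := h z) (g := h y) (k := h x)
    ⟨by simp [h20], h21, h22⟩ ⟨h10, by simp [h11], h12⟩ ⟨h00, h01, by simp [h02]⟩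
  exact ⟨b', ⟨h00, h22, h02, h01, h21, h11⟩, rfl, rfl, rfl⟩

theorem exists_isometry_of_reflection (hs : h.IsSymm) {d : V} (hd : h d d ≠ 0) :
    ∃ g : V →ₗ[ℝ] V, (∀ u v, h (g u) (g v) = h u v) ∧
      ∀ u, g u = u - (2 * h u d / h d d) • d := by
  refine ⟨LinearMap.id - (2 / h d d) • (h.flip d).smulRight d, ?_, ?_⟩
  · intro u v
    have h1 := hs.eq d v
    have h2 : ∀ w, h.flip d w = h w d := fun _ => rfl
    simp only [LinearMap.sub_apply, LinearMap.id_apply, LinearMap.smul_apply,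
      LinearMap.smulRight_apply, map_sub, map_smul, smul_eq_mul, h2]
    rw [h1]
    field_simp
    ring
  · intro u
    simp [smul_smul]
    ring_nf

/-- Isometries act transitively on the vectors of a given nonzero square. -/
theorem exists_isometry_apply_eq (hs : h.IsSymm) {x y : V} (hxy : h x x = h y y)
    (hx : h x x ≠ 0) :
    ∃ g : V →ₗ[ℝ] V, (∀ u v, h (g u) (g v) = h u v) ∧ g x = y := by
  have hyx := hs.eq y x
  -- The squares of `x - y` and `x + y` add up to `4 h x x ≠ 0`, so one of these vectors is not
  -- null. Reflection in `x - y` sends `x` to `y`; reflection in `x + y` sends it to `-y`.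
  by_cases hd : h (x - y) (x - y) = 0
  · have hd' : h (x + y) (x + y) ≠ 0 := by
      intro h0
      apply hx
      simp only [map_sub, map_add, LinearMap.sub_apply, LinearMap.add_apply] at hd h0
      linarith
    obtain ⟨g, hg, hg'⟩ := exists_isometry_of_reflection hs hd'
    refine ⟨-g, fun u v => by simp [hg], ?_⟩
    have : 2 * h x (x + y) / h (x + y) (x + y) = 1 := by
      rw [div_eq_one_iff_eq hd']
      simp only [map_add, LinearMap.add_apply]
      linarith
    rw [LinearMap.neg_apply, hg', this]
    module
  · obtain ⟨g, hg, hg'⟩ := exists_isometry_of_reflection hs hd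
    refine ⟨g, hg, ?_⟩
    have : 2 * h x (x - y) / h (x - y) (x - y) = 1 := by
      rw [div_eq_one_iff_eq hd]
      simp only [map_sub, LinearMap.sub_apply]
      linarith
    rw [hg', this]
    module

theorem IsONB.exists_zero_eq (hs : h.IsSymm) (hb : IsONB h b) {x : V} (hx : h x x = -1) :
    ∃ b' : Module.Basis (Fin 3) ℝ V, IsONB h b' ∧ b' 0 = x := by
  obtain ⟨h1, h2, h3, h4, h5, h6⟩ := hb
  obtain ⟨g, hg, hgx⟩ := exists_isometry_apply_eq hs (h1.trans hx.symm) (by simp [h1])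
  obtain ⟨b', hb', e, -⟩ := exists_onb hs b (x := g (b 0)) (y := g (b 1)) (z := g (b 2))
    (by rw [hg, h1]) (by rw [hg, h2]) (by rw [hg, h3]) (by rw [hg, h4]) (by rw [hg, h5])
    (by rw [hg, h6])
  exact ⟨b', hb', e.trans hgx⟩

theorem IsONB.exists_one_eq (hs : h.IsSymm) (hb : IsONB h b) {x : V} (hx : h x x = 1) :
    ∃ b' : Module.Basis (Fin 3) ℝ V, IsONB h b' ∧ b' 1 = x := by
  obtain ⟨h1, h2, h3, h4, h5, h6⟩ := hb
  obtain ⟨g, hg, hgx⟩ := exists_isometry_apply_eq hs (h2.trans hx.symm) (by simp [h2])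
  obtain ⟨b', hb', -, e, -⟩ := exists_onb hs b (x := g (b 0)) (y := g (b 1)) (z := g (b 2))
    (by rw [hg, h1]) (by rw [hg, h2]) (by rw [hg, h3]) (by rw [hg, h4]) (by rw [hg, h5])
    (by rw [hg, h6])
  exact ⟨b', hb', e.trans hgx⟩

theorem IsONB.exists_isLVB_one_eq (hs : h.IsSymm) (hb : IsONB h b) :
    ∃ b' : Module.Basis (Fin 3) ℝ V, IsLVB h b' ∧ b' 1 = b 1 := by
  obtain ⟨h1, h2, h3, h4, h5, h6⟩ := hb
  have h7 := hs.eq (b 2) (b 1)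
  have h8 := hs.eq (b 2) (b 0)
  have h9 := hs.eq (b 1) (b 0)
  obtain ⟨b', hb', -, e, -⟩ := exists_lvb hs b (x := b 2 + b 0) (y := b 1)
    (z := (1 / 2 : ℝ) • (b 2 - b 0))
    (by simp [*]) (by simp [*]) (by simp [*]) (by simp [*]) (by simp [*]; norm_num)
    (by simp [*])
  exact ⟨b', hb', e⟩

theorem IsONB.exists_isLVB_zero_eq (hs : h.IsSymm) (hb : IsONB h b) {x : V} (hx : h x x = 0)
    (hx0 : x ≠ 0) : ∃ b' : Module.Basis (Fin 3) ℝ V, IsLVB h b' ∧ b' 0 = x := by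
  obtain ⟨p, q, r, rfl⟩ := exists_coords b x
  rw [hb.apply_eq hs] at hx
  have hp : p ≠ 0 := by
    rintro rfl
    have hq : q = 0 := by nlinarith [mul_self_nonneg r, mul_self_nonneg q]
    have hr : r = 0 := by nlinarith [mul_self_nonneg r, mul_self_nonneg q]
    exact hx0 (by simp [hq, hr])
  -- The third vector is the time reversal of `x`, scaled to have product one with `x` since `p² +
  -- q² + r² = 2 p²`; the second is the unit spatial vector perpendicular to both.
  obtain ⟨b', hb', e, -⟩ := exists_lvb hs b (x := p • b 0 + q • b 1 + r • b 2)
    (y := (0 : ℝ) • b 0 + (-r / p) • b 1 + (q / p) • b 2)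
    (z := (-p / (2 * p ^ 2)) • b 0 + (q / (2 * p ^ 2)) • b 1 + (r / (2 * p ^ 2)) • b 2)
    (by rw [hb.apply_eq hs, hx])
    (by rw [hb.apply_eq hs]; field_simp; linear_combination hx)
    (by rw [hb.apply_eq hs]; field_simp; linear_combination hx)
    (by rw [hb.apply_eq hs]; field_simp; ring)
    (by rw [hb.apply_eq hs]; field_simp; linear_combination hx)
    (by rw [hb.apply_eq hs]; field_simp; ring)
  exact ⟨b', hb', e⟩

/-! ### Classification of special isometries by a fixed vector -/

/-- In dimension three every special isometry has a nonzero fixed vector. -/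
theorem exists_fixed_vector (hs : h.IsSymm) (hb : IsONB h b) {L : V ≃ₗ[ℝ] V}
    (hL : L ∈ specialIsometryGroup h) : ∃ x, x ≠ 0 ∧ L x = x := by
  have hLA := mem_represented_toMatrix b L
  generalize hA : LinearMap.toMatrix b b (L : V →ₗ[ℝ] V) = A at hLA
  obtain ⟨G, hdet⟩ := (hb.mem_specialIsometryGroup_iff hs hLA).1 hL
  set J : Matrix (Fin 3) (Fin 3) ℝ := !![-1, 0, 0; 0, 1, 0; 0, 0, 1] with hJ
  have gram : A.transpose * J * A = J := by
    ext i j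
    fin_cases i <;> fin_cases j <;>
      simp [hJ, Matrix.mul_apply, Fin.sum_univ_three]
    · linear_combination G 1 0 0 1 0 0
    · linear_combination G 1 0 0 0 1 0
    · linear_combination G 1 0 0 0 0 1
    · linear_combination G 0 1 0 1 0 0
    · linear_combination G 0 1 0 0 1 0
    · linear_combination G 0 1 0 0 0 1
    · linear_combination G 0 0 1 1 0 0
    · linear_combination G 0 0 1 0 1 0
    · linear_combination G 0 0 1 0 0 1
  -- Taking determinants, the sign `(-1)³` from the odd dimension gives `det (A - 1) = -det (A -
  -- 1)`.
  have e : (A - 1).transpose * J * A = -(J * (A - 1)) := by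
    rw [Matrix.transpose_sub, Matrix.transpose_one, Matrix.sub_mul, Matrix.sub_mul, gram,
      Matrix.one_mul, Matrix.mul_sub, Matrix.mul_one, neg_sub]
  have d := congrArg Matrix.det e
  have dJ : J.det = -1 := by simp [hJ, Matrix.det_fin_three]
  rw [Matrix.det_neg, Matrix.det_mul, Matrix.det_mul, Matrix.det_mul, Matrix.det_transpose,
    hdet, dJ] at d
  norm_num at d
  have d0 : (A - 1).det = 0 := by linarith
  have d1 : LinearMap.det ((L : V →ₗ[ℝ] V) - LinearMap.id) = 0 := by
    rw [← LinearMap.det_toMatrix b, map_sub, hA, LinearMap.toMatrix_id, d0]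
  obtain ⟨x, hx, hx0⟩ := (Submodule.ne_bot_iff _).1 (LinearMap.bot_lt_ker_of_det_eq_zero d1).ne'
  refine ⟨x, hx0, ?_⟩
  simpa [sub_eq_zero] using hx

/-- Every special isometry is a rotation, a boost, possibly composed with a half-turn,
or a null rotation. -/
theorem specialIsometryGroup_cases (hs : h.IsSymm) (hb : IsONB h b) {L : V ≃ₗ[ℝ] V}
    (hL : L ∈ specialIsometryGroup h) :
    (∃ b' : Module.Basis (Fin 3) ℝ V, IsONB h b' ∧ ∃ s, L ∈ represented b' (matA s)) ∨
    (∃ b' : Module.Basis (Fin 3) ℝ V, IsLVB h b' ∧ ∃ l, l ≠ 0 ∧ L ∈ represented b' (matC l)) ∨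
    (∃ b' : Module.Basis (Fin 3) ℝ V, IsLVB h b' ∧ ∃ m, L ∈ represented b' (matN m)) := by
  obtain ⟨x, hx0, hLx⟩ := exists_fixed_vector hs hb hL
  have fixed_smul : ∀ t : ℝ, L (t • x) = t • x := fun t => by rw [map_smul, hLx]
  rcases lt_trichotomy (h x x) 0 with hx | hx | hx
  · left
    have hr : √(-h x x) ≠ 0 := (Real.sqrt_pos.2 (by linarith)).ne'
    have hr2 : √(-h x x) ^ 2 = -h x x := Real.sq_sqrt (by linarith)
    obtain ⟨b', hb', e⟩ := hb.exists_zero_eq hs (x := (√(-h x x))⁻¹ • x) (by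
      simp only [map_smul, LinearMap.smul_apply, smul_eq_mul]
      field_simp
      linear_combination hr2)
    have fix : L (b' 0) = b' 0 := by rw [e, fixed_smul]
    obtain ⟨ε, c, s, -, hcs, hLA⟩ := exists_axisMat hs hb' hL (by
      intro p q r
      have := hb'.apply_eq hs p q r 1 0 0
      simp only [one_smul, zero_smul, add_zero] at this
      nth_rw 2 [← fix]
      rw [hL.1, this]
      ring)
    have hε : ε = 1 := by
      have := mem_represented_iff.1 hLA 0
      rw [fix] at this
      have := congrArg (fun y => b'.repr y 0) this
      simpa [axisMat] using this.symm
    subst hε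
    obtain ⟨t, rfl, rfl⟩ := exists_cos_sin hcs
    exact ⟨b', hb', t, by rwa [matA_eq]⟩
  · right; right
    obtain ⟨b', hb', rfl⟩ := hb.exists_isLVB_zero_eq hs hx hx0
    have hLA := mem_represented_toMatrix b' L
    -- The last coordinate is `h(·, e)`, which `L` preserves because it fixes `e`.
    have row : ∀ j, LinearMap.toMatrix b' b' (L : V →ₗ[ℝ] V) 2 j = h (b' j) (b' 0) := by
      intro j
      rw [LinearMap.toMatrix_apply, (hb'.repr_eq hs _).2.2]
      have := hL.1 (b' j) (b' 0)
      rwa [hLx] at this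
    have hA := hb'.eq_matN hs hLA hL (by rw [row, hb'.1])
      (by rw [row, hs.eq]; exact hb'.2.2.2.1) (by rw [row, hs.eq]; exact hb'.2.2.1)
    exact ⟨b', hb', _, hA⟩
  · right; left
    have hr : √(h x x) ≠ 0 := (Real.sqrt_pos.2 (by linarith)).ne'
    have hr2 : √(h x x) ^ 2 = h x x := Real.sq_sqrt (by linarith)
    obtain ⟨b₁, hb₁, e₁⟩ := hb.exists_one_eq hs (x := (√(h x x))⁻¹ • x) (by
      simp only [map_smul, LinearMap.smul_apply, smul_eq_mul]
      field_simp
      linear_combination -hr2)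
    obtain ⟨b', hb', e⟩ := hb₁.exists_isLVB_one_eq hs
    have fix : L (b' 1) = b' 1 := by rw [e, e₁, fixed_smul]
    have hLA := mem_represented_toMatrix b' L
    have col : ∀ i, LinearMap.toMatrix b' b' (L : V →ₗ[ℝ] V) i 1 = b'.repr (b' 1) i := by
      intro i
      rw [LinearMap.toMatrix_apply]
      exact congrArg (fun y => b'.repr y i) fix
    obtain ⟨hl, hA⟩ := hb'.eq_matC hs hLA hL (by rw [col]; simp) (by rw [col]; simp)
      (by rw [col]; simp)
    exact ⟨b', hb', _, hl, hA⟩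

/-! ### Normalizing the remaining coefficients by a change of basis -/

/-- Orthonormal bases carry no orientation, so time reversal `ε` and spatial reflection `δ` are both
available for adjusting signs. -/
theorem IsONB.exists_isometric (hs : h.IsSymm) (hb : IsONB h b) {ε c s δ : ℝ}
    (hε : ε ^ 2 = 1) (hδ : δ ^ 2 = 1) (hcs : c ^ 2 + s ^ 2 = 1) :
    ∃ b' : Module.Basis (Fin 3) ℝ V, IsONB h b' ∧
      b' 0 = ε • b 0 + (0 : ℝ) • b 1 + (0 : ℝ) • b 2 ∧
      b' 1 = (0 : ℝ) • b 0 + c • b 1 + s • b 2 ∧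
      b' 2 = (0 : ℝ) • b 0 + (-(δ * s)) • b 1 + (δ * c) • b 2 := by
  apply exists_onb hs b <;> rw [hb.apply_eq hs]
  · linear_combination -hε
  · linear_combination hcs
  · linear_combination δ ^ 2 * hcs + hδ
  · ring
  · ring
  · ring

/-- The purely spatial part of the cubic is `Re ((a₆ - i a₇)(q + i r)³)`. Rotating by a third of the
argument of `a₆ + i a₇` makes `a₇` vanish and `a₆` nonnegative; time reversal adjusts the sign of
`a₄`. -/
theorem exists_rotation_axial (hs : h.IsSymm) (hK : IsTracelessCubic h K) (hb : IsONB h b)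
    {a₄ a₆ a₇ : ℝ} (H : HasONBCoeffs K b (2 * a₄) 0 0 a₄ 0 a₆ a₇) :
    ∃ b' : Module.Basis (Fin 3) ℝ V, IsONB h b' ∧ ∃ a₄' a₆', 0 ≤ a₄' ∧ 0 ≤ a₆' ∧
      HasONBCoeffs K b' (2 * a₄') 0 0 a₄' 0 a₆' 0 := by
  obtain ⟨ε, hε, hεa⟩ : ∃ ε : ℝ, ε ^ 2 = 1 ∧ 0 ≤ ε * a₄ := by
    rcases le_total 0 a₄ with h0 | h0
    · exact ⟨1, by norm_num, by linarith⟩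
    · exact ⟨-1, by norm_num, by linarith⟩
  obtain ⟨c, s, hcs, h6, h7⟩ : ∃ c s : ℝ, c ^ 2 + s ^ 2 = 1 ∧
      0 ≤ a₆ * (c ^ 3 - 3 * c * s ^ 2) + a₇ * (3 * c ^ 2 * s - s ^ 3) ∧
      a₇ * (c ^ 3 - 3 * c * s ^ 2) - a₆ * (3 * c ^ 2 * s - s ^ 3) = 0 := by
    rcases (add_nonneg (sq_nonneg a₆) (sq_nonneg a₇)).eq_or_lt' with h0 | h0
    · have e6 : a₆ = 0 := by nlinarith [sq_nonneg a₆, sq_nonneg a₇]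
      have e7 : a₇ = 0 := by nlinarith [sq_nonneg a₆, sq_nonneg a₇]
      exact ⟨1, 0, by norm_num, by simp [e6, e7], by simp [e6, e7]⟩
    · set ρ := √(a₆ ^ 2 + a₇ ^ 2) with hρ
      have hρ0 : 0 < ρ := Real.sqrt_pos.2 h0
      have hρ2 : ρ ^ 2 = a₆ ^ 2 + a₇ ^ 2 := Real.sq_sqrt h0.le
      obtain ⟨t, ht, ht'⟩ := exists_cos_sin (c := a₆ / ρ) (s := a₇ / ρ) (by
        field_simp
        linear_combination -hρ2)
      have c3 := Real.cos_three_mul (t / 3)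
      have s3 := Real.sin_three_mul (t / 3)
      have p := Real.cos_sq_add_sin_sq (t / 3)
      rw [show 3 * (t / 3) = t by ring, ← ht] at c3
      rw [show 3 * (t / 3) = t by ring, ← ht'] at s3
      refine ⟨Real.cos (t / 3), Real.sin (t / 3), p, ?_, ?_⟩
      · have : a₆ * (a₆ / ρ) + a₇ * (a₇ / ρ) = ρ := by
          field_simp
          linear_combination -hρ2
        have e : a₆ * (Real.cos (t / 3) ^ 3 - 3 * Real.cos (t / 3) * Real.sin (t / 3) ^ 2)
            + a₇ * (3 * Real.cos (t / 3) ^ 2 * Real.sin (t / 3) - Real.sin (t / 3) ^ 3) = ρ := by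
          linear_combination this - a₆ * c3 - a₇ * s3 - 3 * a₆ * Real.cos (t / 3) * p
            + 3 * a₇ * Real.sin (t / 3) * p
        rw [e]
        exact hρ0.le
      · have : a₇ * (a₆ / ρ) - a₆ * (a₇ / ρ) = 0 := by ring
        linear_combination this - a₇ * c3 + a₆ * s3 - 3 * a₇ * Real.cos (t / 3) * p
          - 3 * a₆ * Real.sin (t / 3) * p
  obtain ⟨b', hb', e0, e1, e2⟩ := hb.exists_isometric hs hε (one_pow 2) hcs
  refine ⟨b', hb', ε * a₄, _, hεa, h6, (hasONBCoeffs_iff hs hK hb').2 ?_⟩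
  rw [e0, e1, e2]
  simp only [H.trilinear_eq hs hb]
  refine ⟨?_, ?_, ?_, ?_, ?_, ?_, ?_⟩
  · linear_combination 2 * ε * a₄ * hε
  · ring
  · ring
  · linear_combination ε * a₄ * hcs
  · ring
  · ring
  · linear_combination h7

/-- The cubic is `a₁ p³ + 3 p Q(q, r)` with `Q` the quadratic form of entries `a₄`, `a₅`, `a₁ - a₄`.
A rotation by half an angle diagonalizes `Q`, and time reversal changes the sign of `a₁` and `a₄`
together. -/
theorem exists_rotation_z2A (hs : h.IsSymm) (hK : IsTracelessCubic h K) (hb : IsONB h b)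
    {a₁ a₄ a₅ : ℝ} (H : HasONBCoeffs K b a₁ 0 0 a₄ a₅ 0 0) :
    ∃ b' : Module.Basis (Fin 3) ℝ V, IsONB h b' ∧ (b' 0 = b 0 ∨ b' 0 = -b 0) ∧
      ∃ a₁' a₄', (0 < a₁' ∨ 0 < a₄' ∨ a₁' = 0 ∧ a₄' = 0) ∧
      HasONBCoeffs K b' a₁' 0 0 a₄' 0 0 0 := by
  obtain ⟨c, s, hcs, h5⟩ : ∃ c s : ℝ, c ^ 2 + s ^ 2 = 1 ∧
      a₅ * (c ^ 2 - s ^ 2) + (a₁ - 2 * a₄) * (c * s) = 0 := by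
    rcases (add_nonneg (sq_nonneg (2 * a₄ - a₁)) (sq_nonneg (2 * a₅))).eq_or_lt' with h0 | h0
    · have e : a₅ = 0 := by nlinarith [sq_nonneg (2 * a₄ - a₁), sq_nonneg (2 * a₅)]
      exact ⟨1, 0, by norm_num, by simp [e]⟩
    · set ρ := √((2 * a₄ - a₁) ^ 2 + (2 * a₅) ^ 2) with hρ
      have hρ0 : 0 < ρ := Real.sqrt_pos.2 h0
      have hρ2 : ρ ^ 2 = (2 * a₄ - a₁) ^ 2 + (2 * a₅) ^ 2 := Real.sq_sqrt h0.le
      obtain ⟨t, ht, ht'⟩ := exists_cos_sin (c := (2 * a₄ - a₁) / ρ) (s := 2 * a₅ / ρ) (by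
        field_simp
        linear_combination -hρ2)
      have c2 := Real.cos_two_mul (t / 2)
      have s2 := Real.sin_two_mul (t / 2)
      have p := Real.cos_sq_add_sin_sq (t / 2)
      rw [show 2 * (t / 2) = t by ring, ← ht] at c2
      rw [show 2 * (t / 2) = t by ring, ← ht'] at s2
      refine ⟨Real.cos (t / 2), Real.sin (t / 2), p, ?_⟩
      linear_combination -a₅ * c2 + (2 * a₄ - a₁) / 2 * s2 - a₅ * p
  set α := a₄ * c ^ 2 + 2 * a₅ * c * s + (a₁ - a₄) * s ^ 2 with hα
  obtain ⟨ε, hε, hεa⟩ : ∃ ε : ℝ, (ε = 1 ∨ ε = -1) ∧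
      (0 < ε * a₁ ∨ 0 < ε * α ∨ ε * a₁ = 0 ∧ ε * α = 0) := by
    rcases lt_trichotomy 0 a₁ with h1 | h1 | h1
    · exact ⟨1, Or.inl rfl, Or.inl (by linarith)⟩
    · rcases lt_trichotomy 0 α with h2 | h2 | h2
      · exact ⟨1, Or.inl rfl, Or.inr (Or.inl (by linarith))⟩
      · exact ⟨1, Or.inl rfl, Or.inr (Or.inr ⟨by linarith, by linarith⟩)⟩
      · exact ⟨-1, Or.inr rfl, Or.inr (Or.inl (by linarith))⟩
    · exact ⟨-1, Or.inr rfl, Or.inl (by linarith)⟩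
  have hε2 : ε ^ 2 = 1 := by rcases hε with rfl | rfl <;> norm_num
  obtain ⟨b', hb', e0, e1, e2⟩ := hb.exists_isometric hs hε2 (one_pow 2) hcs
  refine ⟨b', hb', ?_, ε * a₁, ε * α, hεa, (hasONBCoeffs_iff hs hK hb').2 ?_⟩
  · rw [e0]
    rcases hε with rfl | rfl
    · left; module
    · right; module
  rw [e0, e1, e2]
  simp only [H.trilinear_eq hs hb]
  refine ⟨?_, ?_, ?_, ?_, ?_, ?_, ?_⟩
  · linear_combination ε * a₁ * hε2
  · ring
  · ring
  · rw [hα]; ring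
  · linear_combination ε * h5
  · ring
  · ring

theorem exists_flip_z2B (hs : h.IsSymm) (hK : IsTracelessCubic h K) (hb : IsONB h b)
    {a₂ a₅ a₆ : ℝ} (H : HasONBCoeffs K b 0 a₂ 0 0 a₅ a₆ 0) :
    ∃ b' : Module.Basis (Fin 3) ℝ V, IsONB h b' ∧ (b' 1 = b 1 ∨ b' 1 = -b 1) ∧
      ∃ a₂' a₅' a₆', 0 ≤ a₆' ∧ 0 ≤ a₅' ∧ HasONBCoeffs K b' 0 a₂' 0 0 a₅' a₆' 0 := by
  obtain ⟨ε, hε, h6⟩ : ∃ ε : ℝ, (ε = 1 ∨ ε = -1) ∧ 0 ≤ ε * a₆ := by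
    rcases le_total 0 a₆ with h0 | h0
    · exact ⟨1, Or.inl rfl, by linarith⟩
    · exact ⟨-1, Or.inr rfl, by linarith⟩
  obtain ⟨δ, hδ, h5⟩ : ∃ δ : ℝ, δ ^ 2 = 1 ∧ 0 ≤ δ * a₅ := by
    rcases le_total 0 a₅ with h0 | h0
    · exact ⟨1, by norm_num, by linarith⟩
    · exact ⟨-1, by norm_num, by linarith⟩
  have hε2 : ε ^ 2 = 1 := by rcases hε with rfl | rfl <;> norm_num
  obtain ⟨b', hb', e0, e1, e2⟩ := hb.exists_isometric hs (one_pow 2) hδ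
    (show ε ^ 2 + 0 ^ 2 = 1 by linarith)
  refine ⟨b', hb', ?_, ε * a₂, δ * a₅, ε * a₆, h6, h5, (hasONBCoeffs_iff hs hK hb').2 ?_⟩
  · rw [e1]
    rcases hε with rfl | rfl
    · left; module
    · right; module
  rw [e0, e1, e2]
  simp only [H.trilinear_eq hs hb]
  refine ⟨?_, ?_, ?_, ?_, ?_, ?_, ?_⟩
  · ring
  · ring
  · ring
  · ring
  · linear_combination δ * a₅ * hε2
  · linear_combination ε * a₆ * hε2
  · ring

/-- Some normal form, with its exact symmetry group, is attained. -/
def AttainsNormalForm (h : BilinForm ℝ V) (K : V →ₗ[ℝ] V →ₗ[ℝ] V) : Prop :=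
  ∃ (c : FormType) (b : Module.Basis (Fin 3) ℝ V), IsAdapted h b c ∧ HasNormalForm K b c ∧
    (cubicStabilizer h K : Set (V ≃ₗ[ℝ] V)) = symmetrySet h b c

theorem attainsNormalForm_of_ne (hs : h.IsSymm) (hK : IsTracelessCubic h K) {c : FormType}
    (hb : IsAdapted h b c) (H : HasNormalForm K b c) (hB : c ≠ .z2B) (hA : c ≠ .z2A) :
    AttainsNormalForm h K :=
  ⟨c, b, hb, H, ((symmetrySet_subset hs hK c hb H).2 hB hA).symm⟩

theorem attainsNormalForm_axial (hs : h.IsSymm) (hK : IsTracelessCubic h K) (hb : IsONB h b)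
    {a₄ a₆ a₇ : ℝ} (H : HasONBCoeffs K b (2 * a₄) 0 0 a₄ 0 a₆ a₇) : AttainsNormalForm h K := by
  obtain ⟨b', hb', a₄, a₆, h4, h6, H⟩ := exists_rotation_axial hs hK hb H
  rcases h4.eq_or_lt with rfl | h4 <;> rcases h6.eq_or_lt with rfl | h6
  · rw [mul_zero, hasONBCoeffs_zero_iff] at H
    exact attainsNormalForm_of_ne hs hK (c := .zero) (b := b') hb' H (by simp) (by simp)
  · rw [mul_zero] at H
    exact attainsNormalForm_of_ne hs hK (c := .s3) (b := b') hb' ⟨a₆, h6, H⟩ (by simp) (by simp)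
  · exact attainsNormalForm_of_ne hs hK (c := .so2) (b := b') hb' ⟨a₄, h4, H⟩ (by simp) (by simp)
  · exact attainsNormalForm_of_ne hs hK (c := .z3) (b := b') hb' ⟨a₄, a₆, h4, h6, H⟩
      (by simp) (by simp)

theorem attainsNormalForm_z2z2 (hs : h.IsSymm) (hK : IsTracelessCubic h K) (hb : IsONB h b)
    {a₅ : ℝ} (H : HasONBCoeffs K b 0 0 0 0 a₅ 0 0) : AttainsNormalForm h K := by
  obtain ⟨δ, hδ, h5⟩ : ∃ δ : ℝ, δ ^ 2 = 1 ∧ 0 ≤ δ * a₅ := by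
    rcases le_total 0 a₅ with h0 | h0
    · exact ⟨1, by norm_num, by linarith⟩
    · exact ⟨-1, by norm_num, by linarith⟩
  obtain ⟨b', hb', e0, e1, e2⟩ := hb.exists_isometric hs (one_pow 2) hδ
    (show (1 : ℝ) ^ 2 + 0 ^ 2 = 1 by norm_num)
  have H' : HasONBCoeffs K b' 0 0 0 0 (δ * a₅) 0 0 := by
    rw [hasONBCoeffs_iff hs hK hb', e0, e1, e2]
    simp only [H.trilinear_eq hs hb]
    refine ⟨?_, ?_, ?_, ?_, ?_, ?_, ?_⟩ <;> ring
  rcases h5.eq_or_lt with h5 | h5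
  · rw [← h5, hasONBCoeffs_zero_iff] at H'
    exact attainsNormalForm_of_ne hs hK (c := .zero) (b := b') hb' H' (by simp) (by simp)
  · exact attainsNormalForm_of_ne hs hK (c := .z2z2) (b := b') hb' ⟨_, h5, H'⟩
      (by simp) (by simp)

theorem IsLVB.exists_isONB (hs : h.IsSymm) (hb : IsLVB h b) :
    ∃ b' : Module.Basis (Fin 3) ℝ V, IsONB h b' := by
  obtain ⟨b', hb', -⟩ := exists_onb hs b
    (x := (1 : ℝ) • b 0 + (0 : ℝ) • b 1 + (-1 / 2 : ℝ) • b 2)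
    (y := (0 : ℝ) • b 0 + (1 : ℝ) • b 1 + (0 : ℝ) • b 2)
    (z := (1 : ℝ) • b 0 + (0 : ℝ) • b 1 + (1 / 2 : ℝ) • b 2)
    (by rw [hb.apply_eq hs]; norm_num) (by rw [hb.apply_eq hs]; norm_num)
    (by rw [hb.apply_eq hs]; norm_num) (by rw [hb.apply_eq hs]; norm_num)
    (by rw [hb.apply_eq hs]; norm_num) (by rw [hb.apply_eq hs]; norm_num)
  exact ⟨b', hb'⟩

theorem IsLVB.exists_flip (hs : h.IsSymm) (hb : IsLVB h b) {ε δ : ℝ} (hε : ε ^ 2 = 1)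
    (hδ : δ ^ 2 = 1) :
    ∃ b' : Module.Basis (Fin 3) ℝ V, IsLVB h b' ∧
      b' 0 = ε • b 0 + (0 : ℝ) • b 1 + (0 : ℝ) • b 2 ∧
      b' 1 = (0 : ℝ) • b 0 + δ • b 1 + (0 : ℝ) • b 2 ∧
      b' 2 = (0 : ℝ) • b 0 + (0 : ℝ) • b 1 + ε • b 2 := by
  apply exists_lvb hs b <;> rw [hb.apply_eq hs]
  · ring
  · linear_combination hδ
  · ring
  · ring
  · linear_combination hε
  · ring

theorem attainsNormalForm_so11 (hs : h.IsSymm) (hK : IsTracelessCubic h K) (hb : IsLVB h b)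
    {b₄ : ℝ} (H : HasLVBCoeffs K b 0 0 0 b₄ 0 0 0) : AttainsNormalForm h K := by
  obtain ⟨δ, hδ, h4⟩ : ∃ δ : ℝ, δ ^ 2 = 1 ∧ 0 ≤ δ * b₄ := by
    rcases le_total 0 b₄ with h0 | h0
    · exact ⟨1, by norm_num, by linarith⟩
    · exact ⟨-1, by norm_num, by linarith⟩
  obtain ⟨b', hb', e0, e1, e2⟩ := hb.exists_flip hs (one_pow 2) hδ
  have H' : HasLVBCoeffs K b' 0 0 0 (δ * b₄) 0 0 0 := by
    rw [hasLVBCoeffs_iff hs hK hb', e0, e1, e2]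
    simp only [H.trilinear_eq hs hb]
    refine ⟨?_, ?_, ?_, ?_, ?_, ?_, ?_⟩ <;> ring
  rcases h4.eq_or_lt with h4 | h4
  -- For `b₄ = 0` the form is `.zero`, whose adapted bases are orthonormal, so a new basis is
  -- needed.
  · rw [← h4, hasLVBCoeffs_zero_iff] at H'
    obtain ⟨b₁, hb₁⟩ := hb.exists_isONB hs
    exact attainsNormalForm_of_ne hs hK (c := .zero) (b := b₁) hb₁ H' (by simp) (by simp)
  · exact attainsNormalForm_of_ne hs hK (c := .so11) (b := b') hb' ⟨_, h4, H'⟩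
      (by simp) (by simp)

theorem attainsNormalForm_real (hs : h.IsSymm) (hK : IsTracelessCubic h K) (hb : IsLVB h b)
    {b₇ : ℝ} (H : HasLVBCoeffs K b 0 0 0 0 0 0 b₇) : AttainsNormalForm h K := by
  obtain ⟨ε, hε, h7⟩ : ∃ ε : ℝ, ε ^ 2 = 1 ∧ 0 ≤ ε * b₇ := by
    rcases le_total 0 b₇ with h0 | h0
    · exact ⟨1, by norm_num, by linarith⟩
    · exact ⟨-1, by norm_num, by linarith⟩
  obtain ⟨b', hb', e0, e1, e2⟩ := hb.exists_flip hs hε (one_pow 2)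
  have H' : HasLVBCoeffs K b' 0 0 0 0 0 0 (ε * b₇) := by
    rw [hasLVBCoeffs_iff hs hK hb', e0, e1, e2]
    simp only [H.trilinear_eq hs hb]
    refine ⟨?_, ?_, ?_, ?_, ?_, ?_, ?_⟩ <;> first | ring1 | linear_combination ε * b₇ * hε
  rcases h7.eq_or_lt with h7 | h7
  · rw [← h7, hasLVBCoeffs_zero_iff] at H'
    obtain ⟨b₁, hb₁⟩ := hb.exists_isONB hs
    exact attainsNormalForm_of_ne hs hK (c := .zero) (b := b₁) hb₁ H' (by simp) (by simp)
  · exact attainsNormalForm_of_ne hs hK (c := .real) (b := b') hb' ⟨_, h7, H'⟩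
      (by simp) (by simp)

/-! ### Consequences of a symmetry that is not a half-turn -/

/-- Under the rotation the pair `(a₂, a₃)` turns through `s` and the pair `(a₁ - 2 a₄, 2 a₅)`
through `2 s`. Neither angle is a multiple of `2π` when `sin s ≠ 0`, so both pairs vanish and an
axial cubic is left. -/
theorem attainsNormalForm_of_rotation (hs : h.IsSymm) (hK : IsTracelessCubic h K)
    (hb : IsONB h b) {L : V ≃ₗ[ℝ] V} (hL : L ∈ cubicStabilizer h K) {s : ℝ}
    (hLs : L ∈ represented b (matA s)) (hsin : Real.sin s ≠ 0) : AttainsNormalForm h K := by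
  obtain ⟨a₁, a₂, a₃, a₄, a₅, a₆, a₇, H⟩ := exists_hasONBCoeffs hs hK hb
  rw [matA_eq] at hLs
  have T : ∀ p q r p' q' r' p'' q'' r'' : ℝ, _ := fun p q r p' q' r' p'' q'' r'' =>
    hL.2 (p • b 0 + q • b 1 + r • b 2) (p' • b 0 + q' • b 1 + r' • b 2)
      (p'' • b 0 + q'' • b 1 + r'' • b 2)
  simp only [axisMat_apply hLs, H.trilinear_eq hs hb] at T
  have t2 := T 1 0 0 1 0 0 0 1 0
  have t3 := T 1 0 0 1 0 0 0 0 1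
  have t4 := T 1 0 0 0 1 0 0 1 0
  have t5 := T 1 0 0 0 1 0 0 0 1
  clear T
  have hcs := Real.cos_sq_add_sin_sq s
  set c := Real.cos s
  set σ := Real.sin s
  simp only [mul_one, mul_zero, add_zero, zero_add, zero_mul, sub_zero, one_mul,
    zero_sub] at t2 t3 t4 t5
  -- The determinant of the plane rotation minus the identity.
  have hpos : (c - 1) ^ 2 + σ ^ 2 ≠ 0 := by positivity
  have z2 : a₂ = 0 := by
    apply mul_left_cancel₀ hpos
    linear_combination (c - 1) * t2 - σ * t3
  have z3 : a₃ = 0 := by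
    apply mul_left_cancel₀ hpos
    linear_combination σ * t2 + (c - 1) * t3
  have z1 : a₁ = 2 * a₄ := by
    apply mul_left_cancel₀ hsin
    apply mul_left_cancel₀ hsin
    linear_combination σ ^ 2 * t4 + c * σ * t5 - ((a₁ - a₄) * σ ^ 2
      + c * σ * a₅) * hcs
  have z5 : a₅ = 0 := by
    apply mul_left_cancel₀ hsin
    apply mul_left_cancel₀ hsin
    rw [z1] at t5
    linear_combination -t5 / 2 + a₅ / 2 * hcs
  subst z1 z2 z3 z5
  exact attainsNormalForm_axial hs hK hb H

/-- The coefficients are weight vectors: `b₁, b₂, b₃` scale by `l, l², l³`, `b₅, b₆, b₇` by the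
inverses, and `b₄` is fixed. As `l² ≠ 1`, none of these powers is one. -/
theorem attainsNormalForm_of_boost (hs : h.IsSymm) (hK : IsTracelessCubic h K)
    (hb : IsLVB h b) {L : V ≃ₗ[ℝ] V} (hL : L ∈ cubicStabilizer h K) {l : ℝ} (hl : l ≠ 0)
    (hLl : L ∈ represented b (matC l)) (hl2 : l ^ 2 ≠ 1) : AttainsNormalForm h K := by
  obtain ⟨b₁, b₂, b₃, b₄, b₅, b₆, b₇, H⟩ := exists_hasLVBCoeffs hs hK hb
  have T : ∀ p q r p' q' r' p'' q'' r'' : ℝ, _ := fun p q r p' q' r' p'' q'' r'' =>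
    hL.2 (p • b 0 + q • b 1 + r • b 2) (p' • b 0 + q' • b 1 + r' • b 2)
      (p'' • b 0 + q'' • b 1 + r'' • b 2)
  simp only [matC_apply hLl, H.trilinear_eq hs hb] at T
  have t1 := T 1 0 0 1 0 0 0 0 1
  have t2 := T 1 0 0 1 0 0 0 1 0
  have t3 := T 1 0 0 1 0 0 1 0 0
  have t5 := T 1 0 0 0 0 1 0 0 1
  have t6 := T 0 1 0 0 0 1 0 0 1
  have t7 := T 0 0 1 0 0 1 0 0 1
  clear T
  simp only [mul_one, mul_zero, add_zero, zero_add, zero_mul, sub_zero, one_mul,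
    one_div] at t1 t2 t3 t5 t6 t7
  field_simp at t1 t2 t3 t5 t6 t7
  have hl1 : l - 1 ≠ 0 := fun h0 => hl2 (by rw [sub_eq_zero.1 h0]; norm_num)
  have hl2' : l ^ 2 - 1 ≠ 0 := sub_ne_zero.2 hl2
  have hl3 : l ^ 3 - 1 ≠ 0 := by
    have : l ^ 3 - 1 = (l - 1) * (l ^ 2 + l + 1) := by ring
    rw [this]
    exact mul_ne_zero hl1 (by nlinarith [sq_nonneg (2 * l + 1)])
  have z1 : b₁ = 0 := by
    apply mul_left_cancel₀ hl1
    linear_combination t1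
  have z2 : b₂ = 0 := by
    apply mul_left_cancel₀ hl2'
    linear_combination t2
  have z3 : b₃ = 0 := by
    apply mul_left_cancel₀ hl3
    linear_combination t3
  have z5 : b₅ = 0 := by
    apply mul_left_cancel₀ hl1
    linear_combination -t5
  have z6 : b₆ = 0 := by
    apply mul_left_cancel₀ hl2'
    linear_combination -t6
  have z7 : b₇ = 0 := by
    apply mul_left_cancel₀ hl3
    linear_combination -t7
  subst z1 z2 z3 z5 z6 z7
  exact attainsNormalForm_so11 hs hK hb H

/-- `N_m` is unipotent and shifts the coefficients along the chain `b₃, b₂, b₁, b₄, b₅, b₆, b₇`.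
Once the earlier ones vanish, each equation is a nonzero multiple of `m` times the next; only `b₇`
survives. -/
theorem attainsNormalForm_of_null (hs : h.IsSymm) (hK : IsTracelessCubic h K)
    (hb : IsLVB h b) {L : V ≃ₗ[ℝ] V} (hL : L ∈ cubicStabilizer h K) {m : ℝ} (hm : m ≠ 0)
    (hLm : L ∈ represented b (matN m)) : AttainsNormalForm h K := by
  obtain ⟨b₁, b₂, b₃, b₄, b₅, b₆, b₇, H⟩ := exists_hasLVBCoeffs hs hK hb
  have T : ∀ p q r p' q' r' p'' q'' r'' : ℝ, _ := fun p q r p' q' r' p'' q'' r'' =>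
    hL.2 (p • b 0 + q • b 1 + r • b 2) (p' • b 0 + q' • b 1 + r' • b 2)
      (p'' • b 0 + q'' • b 1 + r'' • b 2)
  simp only [matN_apply hLm, H.trilinear_eq hs hb] at T
  have t3 := T 1 0 0 1 0 0 0 1 0
  have t2 := T 1 0 0 0 1 0 0 1 0
  have t1 := T 0 1 0 0 1 0 0 1 0
  have t4 := T 0 1 0 0 1 0 0 0 1
  have t5 := T 0 1 0 0 0 1 0 0 1
  have t6 := T 0 0 1 0 0 1 0 0 1
  clear T
  have z3 : b₃ = 0 := by
    apply mul_left_cancel₀ hm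
    linear_combination -t3
  subst z3
  have z2 : b₂ = 0 := by
    apply mul_left_cancel₀ hm
    linear_combination -t2 / 2
  subst z2
  have z1 : b₁ = 0 := by
    apply mul_left_cancel₀ hm
    linear_combination t1 / 6
  subst z1
  have z4 : b₄ = 0 := by
    apply mul_left_cancel₀ hm
    linear_combination -t4 / 4
  subst z4
  have z5 : b₅ = 0 := by
    apply mul_left_cancel₀ hm
    linear_combination -t5 / 5
  subst z5
  have z6 : b₆ = 0 := by
    apply mul_left_cancel₀ hm
    linear_combination t6 / 3
  subst z6
  exact attainsNormalForm_real hs hK hb H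

/-! ### Half-turns -/

/-- `L` is the half-turn about the line spanned by the unit vector `u`. -/
def IsHalfTurn (h : BilinForm ℝ V) (L : V ≃ₗ[ℝ] V) (u : V) : Prop :=
  h u u ^ 2 = 1 ∧ ∀ x, L x = -x + (2 * h x u * h u u) • u

theorem IsHalfTurn.apply_self {L : V ≃ₗ[ℝ] V} {u : V} (hL : IsHalfTurn h L u) : L u = u := by
  rw [hL.2, mul_assoc, ← pow_two, hL.1]
  module

theorem IsHalfTurn.of_eq_or_neg {L : V ≃ₗ[ℝ] V} {u v : V} (hL : IsHalfTurn h L u)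
    (huv : v = u ∨ v = -u) : IsHalfTurn h L v := by
  rcases huv with rfl | rfl
  · exact hL
  · simpa [IsHalfTurn] using hL

theorem IsHalfTurn.mem_represented_matA (hs : h.IsSymm) (hb : IsONB h b) {L : V ≃ₗ[ℝ] V}
    (hL : IsHalfTurn h L (b 0)) : L ∈ represented b (matA Real.pi) := by
  have h1 := hs.eq (b 1) (b 0)
  have h2 := hs.eq (b 2) (b 0)
  rw [mem_represented_iff]
  intro j
  obtain ⟨g1, g2, g3, g4, g5, g6⟩ := hb
  fin_cases j <;> simp [matA, hL.2, g1, g4, g5, h1, h2]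
  module

theorem IsHalfTurn.mem_represented_matB (hs : h.IsSymm) (hb : IsONB h b) {L : V ≃ₗ[ℝ] V}
    (hL : IsHalfTurn h L (b 1)) : L ∈ represented b matB := by
  have h2 := hs.eq (b 2) (b 1)
  rw [mem_represented_iff]
  intro j
  obtain ⟨g1, g2, g3, g4, g5, g6⟩ := hb
  fin_cases j <;> simp [matB, hL.2, g2, g4, g6, h2]
  module

theorem isHalfTurn_of_mem_represented_matA (hs : h.IsSymm) (hb : IsONB h b) {L : V ≃ₗ[ℝ] V}
    (hL : L ∈ represented b (matA Real.pi)) : IsHalfTurn h L (b 0) := by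
  refine ⟨by simp [hb.1], fun x => ?_⟩
  obtain ⟨p, q, r, rfl⟩ := exists_coords b x
  rw [matA_eq] at hL
  have := hb.apply_eq hs p q r 1 0 0
  simp only [one_smul, zero_smul, add_zero] at this
  rw [axisMat_apply hL, this, hb.1, Real.cos_pi, Real.sin_pi]
  module

theorem isHalfTurn_of_mem_represented_matC (hs : h.IsSymm) (hb : IsLVB h b) {L : V ≃ₗ[ℝ] V}
    (hL : L ∈ represented b (matC (-1))) : IsHalfTurn h L (b 1) := by
  refine ⟨by simp [hb.2.2.2.2.2], fun x => ?_⟩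
  obtain ⟨p, q, r, rfl⟩ := exists_coords b x
  have := hb.apply_eq hs p q r 0 1 0
  simp only [one_smul, zero_smul, add_zero, zero_add] at this
  rw [matC_apply hL, this, hb.2.2.2.2.2]
  module

theorem matC_one : matC 1 = 1 := by
  ext i j
  fin_cases i <;> fin_cases j <;> simp [matC]

theorem matN_zero : matN 0 = 1 := by
  ext i j
  fin_cases i <;> fin_cases j <;> simp [matN]

/-- A nontrivial symmetry which is not a half-turn forces a normal form. -/
theorem attainsNormalForm_or_isHalfTurn (hs : h.IsSymm) (hK : IsTracelessCubic h K)
    (hb : IsONB h b) {L : V ≃ₗ[ℝ] V} (hL : L ∈ cubicStabilizer h K) (hL1 : L ≠ 1) :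
    AttainsNormalForm h K ∨ ∃ u, IsHalfTurn h L u := by
  rcases specialIsometryGroup_cases hs hb hL.1 with
    ⟨b', hb', s, hLs⟩ | ⟨b', hb', l, hl, hLl⟩ | ⟨b', hb', m, hLm⟩
  · by_cases hsin : Real.sin s = 0
    · right
      rw [matA_eq, hsin] at hLs
      rcases Real.sin_eq_zero_iff_cos_eq.1 hsin with hc | hc
      · rw [hc, axisMat_one] at hLs
        exact absurd (eq_one_of_mem_represented hLs) hL1
      · refine ⟨b' 0, isHalfTurn_of_mem_represented_matA hs hb' ?_⟩
        rwa [matA_eq, Real.cos_pi, Real.sin_pi, ← hc]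
    · exact Or.inl (attainsNormalForm_of_rotation hs hK hb' hL hLs hsin)
  · by_cases hl2 : l ^ 2 = 1
    · right
      rcases (show l = 1 ∨ l = -1 by simpa using hl2) with rfl | rfl
      · rw [matC_one] at hLl
        exact absurd (eq_one_of_mem_represented hLl) hL1
      · exact ⟨b' 1, isHalfTurn_of_mem_represented_matC hs hb' hLl⟩
    · exact Or.inl (attainsNormalForm_of_boost hs hK hb' hL hl hLl hl2)
  · left
    refine attainsNormalForm_of_null hs hK hb' hL (m := m) ?_ hLm
    rintro rfl
    rw [matN_zero] at hLm
    exact hL1 (eq_one_of_mem_represented hLm)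

theorem IsHalfTurn.mul_self {L : V ≃ₗ[ℝ] V} {u : V} (hL : IsHalfTurn h L u) : L * L = 1 := by
  ext x
  rw [LinearEquiv.mul_apply, LinearEquiv.coe_one, id, hL.2 x, map_add, map_neg, map_smul,
    hL.apply_self, hL.2 x]
  module

theorem IsHalfTurn.eq_of_smul {L M : V ≃ₗ[ℝ] V} {u v : V} (hL : IsHalfTurn h L u)
    (hM : IsHalfTurn h M v) {t : ℝ} (huv : u = t • v) : L = M := by
  subst huv
  ext x
  rw [hL.2, hM.2]
  have h1 := hL.1
  have h2 := hM.1
  simp only [map_smul, LinearMap.smul_apply, smul_eq_mul] at h1 ⊢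
  have : t ^ 4 = 1 := by linear_combination h1 - t ^ 4 * h2
  rw [smul_smul]
  congr 2
  linear_combination 2 * h x v * h v v * this

/-- The axes of two distinct commuting half-turns are orthogonal. -/
theorem IsHalfTurn.orthogonal (hs : h.IsSymm) {L M : V ≃ₗ[ℝ] V} {u v : V}
    (hL : IsHalfTurn h L u) (hM : IsHalfTurn h M v) (hne : L ≠ M) (hLM : L * M = M * L) :
    h u v = 0 := by
  by_contra h0
  have hvu := hs.eq v u
  have e : L (M u) = M (L u) := congrArg (fun N : V ≃ₗ[ℝ] V => N u) hLM
  rw [hL.apply_self, hM.2 u, map_add, map_neg, map_smul, hL.apply_self, hL.2 v, hvu] at e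
  have hu := hL.1
  have hv := hM.1
  have hv0 : h v v ≠ 0 := by
    intro h1
    simp [h1] at hv
  have hu0 : h u u ≠ 0 := by
    intro h1
    simp [h1] at hu
  refine hne (hL.eq_of_smul hM (t := (h u v * h u u)⁻¹) ?_)
  rw [eq_inv_smul_iff₀ (mul_ne_zero h0 hu0)]
  -- Commutation applied to `u` says that `L` fixes `M u`. When `h u v ≠ 0` this forces `v` to equal
  -- its projection on `u`, and the two half-turns coincide.
  have e2 : (4 * (h u v * h v v)) • (v - (h u v * h u u) • u) = 0 := by
    rw [← sub_eq_zero] at e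
    rw [← neg_eq_zero, ← e]
    module
  rcases smul_eq_zero.1 e2 with h1 | h1
  · exact absurd h1 (mul_ne_zero (by norm_num) (mul_ne_zero h0 hv0))
  · exact (sub_eq_zero.1 h1).symm

theorem coeffs_of_matA_pi (hs : h.IsSymm) (hb : IsONB h b) {a₁ a₂ a₃ a₄ a₅ a₆ a₇ : ℝ}
    (H : HasONBCoeffs K b a₁ a₂ a₃ a₄ a₅ a₆ a₇) {L : V ≃ₗ[ℝ] V}
    (hL : L ∈ cubicStabilizer h K) (hLA : L ∈ represented b (matA Real.pi)) :
    a₂ = 0 ∧ a₃ = 0 ∧ a₆ = 0 ∧ a₇ = 0 := by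
  rw [matA_eq, Real.cos_pi, Real.sin_pi] at hLA
  have T : ∀ p q r p' q' r' p'' q'' r'' : ℝ, _ := fun p q r p' q' r' p'' q'' r'' =>
    hL.2 (p • b 0 + q • b 1 + r • b 2) (p' • b 0 + q' • b 1 + r' • b 2)
      (p'' • b 0 + q'' • b 1 + r'' • b 2)
  simp only [axisMat_apply hLA, H.trilinear_eq hs hb] at T
  refine ⟨?_, ?_, ?_, ?_⟩
  · linear_combination -T 1 0 0 1 0 0 0 1 0 / 2
  · linear_combination -T 1 0 0 1 0 0 0 0 1 / 2
  · linear_combination -T 0 1 0 0 1 0 0 1 0 / 2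
  · linear_combination -T 0 1 0 0 1 0 0 0 1 / 2

theorem coeffs_of_matB (hs : h.IsSymm) (hb : IsONB h b) {a₁ a₂ a₃ a₄ a₅ a₆ a₇ : ℝ}
    (H : HasONBCoeffs K b a₁ a₂ a₃ a₄ a₅ a₆ a₇) {L : V ≃ₗ[ℝ] V}
    (hL : L ∈ cubicStabilizer h K) (hLB : L ∈ represented b matB) :
    a₁ = 0 ∧ a₃ = 0 ∧ a₄ = 0 ∧ a₇ = 0 := by
  rw [matB_eq] at hLB
  have T : ∀ p q r p' q' r' p'' q'' r'' : ℝ, _ := fun p q r p' q' r' p'' q'' r'' =>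
    hL.2 (p • b 0 + q • b 1 + r • b 2) (p' • b 0 + q' • b 1 + r' • b 2)
      (p'' • b 0 + q'' • b 1 + r'' • b 2)
  simp only [axisMat_apply hLB, H.trilinear_eq hs hb] at T
  refine ⟨?_, ?_, ?_, ?_⟩
  · linear_combination -T 1 0 0 1 0 0 1 0 0 / 2
  · linear_combination -T 1 0 0 1 0 0 0 0 1 / 2
  · linear_combination -T 1 0 0 0 1 0 0 1 0 / 2
  · linear_combination -T 0 1 0 0 1 0 0 0 1 / 2

theorem attainsNormalForm_of_matA_matB (hs : h.IsSymm) (hK : IsTracelessCubic h K)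
    (hb : IsONB h b) {L M : V ≃ₗ[ℝ] V} (hL : L ∈ cubicStabilizer h K)
    (hM : M ∈ cubicStabilizer h K) (hLA : L ∈ represented b (matA Real.pi))
    (hMB : M ∈ represented b matB) : AttainsNormalForm h K := by
  obtain ⟨a₁, a₂, a₃, a₄, a₅, a₆, a₇, H⟩ := exists_hasONBCoeffs hs hK hb
  obtain ⟨rfl, rfl, rfl, rfl⟩ := coeffs_of_matA_pi hs hb H hL hLA
  obtain ⟨rfl, -, rfl, -⟩ := coeffs_of_matB hs hb H hM hMB
  exact attainsNormalForm_z2z2 hs hK hb H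

theorem IsHalfTurn.sq_cases {L : V ≃ₗ[ℝ] V} {u : V} (hL : IsHalfTurn h L u) :
    h u u = 1 ∨ h u u = -1 := by
  simpa using hL.1

/-- The complement of a timelike vector is positive definite, so `v` is spacelike and a rotation of
the spatial plane makes it `b 1`. -/
theorem attainsNormalForm_of_timelike_axis (hs : h.IsSymm) (hK : IsTracelessCubic h K)
    (hb : IsONB h b) {L M : V ≃ₗ[ℝ] V} (hL : L ∈ cubicStabilizer h K)
    (hM : M ∈ cubicStabilizer h K) {u v : V} (hLu : IsHalfTurn h L u) (hMv : IsHalfTurn h M v)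
    (hu : h u u = -1) (huv : h u v = 0) : AttainsNormalForm h K := by
  obtain ⟨b', hb', rfl⟩ := hb.exists_zero_eq hs hu
  obtain ⟨p, q, r, rfl⟩ := exists_coords b' v
  have e := hb'.apply_eq hs 1 0 0 p q r
  simp only [one_smul, zero_smul, add_zero] at e
  rw [e] at huv
  have hp : p = 0 := by linarith
  subst hp
  have hqr : q ^ 2 + r ^ 2 = 1 := by
    have := hMv.sq_cases
    rw [hb'.apply_eq hs] at this
    rcases this with h1 | h1
    · linarith
    · nlinarith [sq_nonneg q, sq_nonneg r]
  obtain ⟨b₁, hb₁, e0, e1, -⟩ := hb'.exists_isometric hs (one_pow 2) (one_pow 2) hqr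
  rw [← e1] at hMv
  have e0' : b₁ 0 = b' 0 := by rw [e0]; module
  rw [← e0'] at hLu
  exact attainsNormalForm_of_matA_matB hs hK hb₁ hL hM (hLu.mem_represented_matA hs hb₁)
    (hMv.mem_represented_matB hs hb₁)

theorem attainsNormalForm_of_two_halfTurns (hs : h.IsSymm) (hK : IsTracelessCubic h K)
    (hb : IsONB h b) {L M : V ≃ₗ[ℝ] V} (hL : L ∈ cubicStabilizer h K)
    (hM : M ∈ cubicStabilizer h K) {u v : V} (hLu : IsHalfTurn h L u) (hMv : IsHalfTurn h M v)
    (huv : h u v = 0) : AttainsNormalForm h K := by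
  rcases hLu.sq_cases with hu | hu
  · rcases hMv.sq_cases with hv | hv
    · obtain ⟨b', hb', rfl⟩ := hb.exists_one_eq hs hu
      obtain ⟨p, q, r, rfl⟩ := exists_coords b' v
      have e := hb'.apply_eq hs 0 1 0 p q r
      simp only [one_smul, zero_smul, add_zero, zero_add] at e
      rw [e] at huv
      have hq : q = 0 := by linarith
      subst hq
      rw [hb'.apply_eq hs] at hv
      -- With both axes spacelike, the vector orthogonal to them is timelike, and the product of the
      -- two half-turns is the half-turn about it.
      obtain ⟨b₁, hb₁, e0, e1, e2⟩ := exists_onb hs b'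
        (x := r • b' 0 + (0 : ℝ) • b' 1 + p • b' 2)
        (y := (0 : ℝ) • b' 0 + (1 : ℝ) • b' 1 + (0 : ℝ) • b' 2)
        (z := p • b' 0 + (0 : ℝ) • b' 1 + r • b' 2)
        (by rw [hb'.apply_eq hs]; linear_combination -hv)
        (by rw [hb'.apply_eq hs]; ring) (by rw [hb'.apply_eq hs]; linear_combination hv)
        (by rw [hb'.apply_eq hs]; ring) (by rw [hb'.apply_eq hs]; ring)
        (by rw [hb'.apply_eq hs]; ring)
      have e1' : b₁ 1 = b' 1 := by rw [e1]; module
      rw [← e1'] at hLu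
      rw [← e2] at hMv
      have hLM : L * M ∈ represented b₁ (matA Real.pi) := by
        have h01 := hb₁.2.2.2.1
        have h02 := hb₁.2.2.2.2.1
        have h12 := hb₁.2.2.2.2.2
        have h21 := (hs.eq (b₁ 2) (b₁ 1)).trans h12
        rw [mem_represented_iff]
        intro j
        fin_cases j <;>
          simp [matA, LinearEquiv.mul_apply, hLu.2, hMv.2, h01, h02, h12, h21, hb₁.2.1, hb₁.2.2.1]
        · module
        · module
      exact attainsNormalForm_of_matA_matB hs hK hb₁ (mul_mem hL hM) hL hLM
        (hLu.mem_represented_matB hs hb₁)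
    · exact attainsNormalForm_of_timelike_axis hs hK hb hM hL hMv hLu hv
        ((hs.eq v u).trans huv)
  · exact attainsNormalForm_of_timelike_axis hs hK hb hL hM hLu hMv hu huv

/-! ### Existence of a normal form -/

theorem closure_singleton_eq {L : V ≃ₗ[ℝ] V} (hL : L ∈ cubicStabilizer h K)
    (H : ∀ M ∈ cubicStabilizer h K, M = 1 ∨ M = L) {A : Matrix (Fin 3) (Fin 3) ℝ}
    (hA : L ∈ represented b A) :
    (cubicStabilizer h K : Set (V ≃ₗ[ℝ] V)) = Subgroup.closure (represented b A) := by
  have e : cubicStabilizer h K = Subgroup.closure (represented b A) := by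
    apply le_antisymm
    · intro M hM
      rcases H M hM with rfl | rfl
      · exact one_mem _
      · exact Subgroup.subset_closure hA
    · rw [Subgroup.closure_le]
      intro M hM
      rwa [represented_inj hM hA]
  rw [e]

/-- A half-turn about a spacelike axis leads to `.z2B`, about a timelike one to `.z2A`. The
parameter values excluded there (`a₂ = a₆ = 0`, respectively `a₁ = 2 a₄`) are passed to the forms
already settled. -/
theorem attainsNormalForm_of_stabilizer_eq (hs : h.IsSymm) (hK : IsTracelessCubic h K)
    (hb : IsONB h b) {L : V ≃ₗ[ℝ] V} (hL : L ∈ cubicStabilizer h K)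
    (H : ∀ M ∈ cubicStabilizer h K, M = 1 ∨ M = L) {u : V} (hLu : IsHalfTurn h L u) :
    AttainsNormalForm h K := by
  rcases hLu.sq_cases with hu | hu
  · obtain ⟨b', hb', rfl⟩ := hb.exists_one_eq hs hu
    obtain ⟨a₁, a₂, a₃, a₄, a₅, a₆, a₇, Ha⟩ := exists_hasONBCoeffs hs hK hb'
    obtain ⟨rfl, rfl, rfl, rfl⟩ := coeffs_of_matB hs hb' Ha hL (hLu.mem_represented_matB hs hb')
    obtain ⟨b₁, hb₁, e, a₂', a₅', a₆', h6, -, Ha⟩ := exists_flip_z2B hs hK hb' Ha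
    by_cases hz : (a₂', a₆') = (0, 0)
    · obtain ⟨rfl, rfl⟩ := Prod.mk.inj hz
      exact attainsNormalForm_z2z2 hs hK hb₁ Ha
    · exact ⟨.z2B, b₁, hb₁, ⟨_, _, _, h6, hz, Ha⟩, closure_singleton_eq hL H
        ((hLu.of_eq_or_neg e).mem_represented_matB hs hb₁)⟩
  · obtain ⟨b', hb', rfl⟩ := hb.exists_zero_eq hs hu
    obtain ⟨a₁, a₂, a₃, a₄, a₅, a₆, a₇, Ha⟩ := exists_hasONBCoeffs hs hK hb'
    obtain ⟨rfl, rfl, rfl, rfl⟩ :=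
      coeffs_of_matA_pi hs hb' Ha hL (hLu.mem_represented_matA hs hb')
    obtain ⟨b₁, hb₁, e, a₁', a₄', hpos, Ha⟩ := exists_rotation_z2A hs hK hb' Ha
    by_cases hz : a₁' = 2 * a₄'
    · subst hz
      exact attainsNormalForm_axial hs hK hb₁ Ha
    · refine ⟨.z2A, b₁, hb₁, ⟨_, _, ?_, hz, Ha⟩, closure_singleton_eq hL H
        ((hLu.of_eq_or_neg e).mem_represented_matA hs hb₁)⟩
      rcases hpos with h1 | h1 | ⟨rfl, rfl⟩
      · exact Or.inl h1
      · exact Or.inr h1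
      · simp at hz

/-- If no form were attained, every symmetry would square to one and the stabilizer would be
abelian. A second half-turn would have an axis orthogonal to the first and give a form, so only one
half-turn remains, which also gives a form. -/
theorem attainsNormalForm (hs : h.IsSymm) (hK : IsTracelessCubic h K) (hb : IsONB h b)
    (hstab : ∃ L ∈ cubicStabilizer h K, L ≠ 1) : AttainsNormalForm h K := by
  by_contra hn
  have key : ∀ L ∈ cubicStabilizer h K, L ≠ 1 → ∃ u, IsHalfTurn h L u := fun L hL hL1 =>
    (attainsNormalForm_or_isHalfTurn hs hK hb hL hL1).resolve_left hn
  have sq : ∀ L ∈ cubicStabilizer h K, L * L = 1 := by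
    intro L hL
    by_cases hL1 : L = 1
    · rw [hL1, one_mul]
    · obtain ⟨u, hu⟩ := key L hL hL1
      exact hu.mul_self
  obtain ⟨L, hL, hL1⟩ := hstab
  obtain ⟨u, hu⟩ := key L hL hL1
  refine hn (attainsNormalForm_of_stabilizer_eq hs hK hb hL (fun M hM => ?_) hu)
  by_contra! hM1
  obtain ⟨v, hv⟩ := key M hM hM1.1
  refine hn (attainsNormalForm_of_two_halfTurns hs hK hb hL hM hu hv
    (hu.orthogonal hs hv hM1.2.symm ?_))
  have e1 := sq _ (mul_mem hL hM)
  have e2 := sq L hL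
  have e3 := sq M hM
  calc L * M = L * M * ((M * L) * (M * L)) := by rw [sq _ (mul_mem hM hL), mul_one]
    _ = L * (M * M) * (L * (M * L)) := by simp only [mul_assoc]
    _ = (L * L) * (M * L) := by rw [e3, mul_one, ← mul_assoc]
    _ = M * L := by rw [e2, one_mul]

/-! ### Isomorphism types of the stabilizers -/

/-- Both groups are quotients of `G` by the same kernel. The stabilizer and its model are compared
through a common parameter group (`ℝ`, `ℝˣ` or `ℤˣ × ℤˣ`), with no choice of parameter to be made on
either side. -/
theorem nonempty_mulEquiv_of_ker_eq {G H H' : Type*} [Group G] [Group H] [Group H']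
    (φ : G →* H) (ψ : G →* H') (hφ : Function.Surjective φ) (hψ : Function.Surjective ψ)
    (hker : ∀ g, φ g = 1 ↔ ψ g = 1) : Nonempty (H ≃* H') := by
  have e : φ.ker = ψ.ker := by
    ext g
    exact hker g
  exact ⟨((QuotientGroup.quotientKerEquivOfSurjective φ hφ).symm.trans
    (QuotientGroup.quotientMulEquivOfEq e)).trans
    (QuotientGroup.quotientKerEquivOfSurjective ψ hψ)⟩

/-- A multiplicative family of matrices parametrizing a subgroup is a surjective homomorphism. -/
theorem exists_surjective_hom {G : Type*} [Group G] (F : G → Matrix (Fin 3) (Fin 3) ℝ)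
    (hdet : ∀ g, (F g).det = 1) (hmul : ∀ g g', F (g * g') = F g * F g')
    {S : Subgroup (V ≃ₗ[ℝ] V)} (hS : (S : Set (V ≃ₗ[ℝ] V)) = {L | ∃ g, L ∈ represented b (F g)}) :
    ∃ φ : G →* S, Function.Surjective φ ∧ ∀ g, φ g = 1 ↔ F g = 1 := by
  choose f hf using fun g => exists_represented b (hdet g)
  have hfS : ∀ g, f g ∈ S := fun g => by
    rw [← SetLike.mem_coe, hS]
    exact ⟨g, hf g⟩
  refine ⟨MonoidHom.mk' (fun g => (⟨f g, hfS g⟩ : S)) fun g g' => Subtype.ext ?_, ?_, ?_⟩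
  · exact represented_inj (hf _) (by rw [hmul]; exact represented_mul (hf g) (hf g'))
  · rintro ⟨L, hL⟩
    rw [← SetLike.mem_coe, hS] at hL
    obtain ⟨g, hg⟩ := hL
    exact ⟨g, Subtype.ext (represented_inj (hf g) hg)⟩
  · intro g
    change (⟨f g, hfS g⟩ : S) = 1 ↔ _
    rw [Subtype.ext_iff]
    change f g = 1 ↔ _
    constructor
    · intro e
      have := hf g
      rw [e] at this
      exact this.symm.trans (one_mem_represented b)
    · intro e
      have := hf g
      rw [e] at this
      exact eq_one_of_mem_represented this

theorem exists_subgroup_represented {G : Type*} [Group G] (b : Module.Basis (Fin 3) ℝ V)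
    (F : G → Matrix (Fin 3) (Fin 3) ℝ) (hmul : ∀ g g', F (g * g') = F g * F g')
    (hone : F 1 = 1) :
    ∃ S : Subgroup (V ≃ₗ[ℝ] V), (S : Set (V ≃ₗ[ℝ] V)) = {L | ∃ g, L ∈ represented b (F g)} := by
  refine ⟨{ carrier := {L | ∃ g, L ∈ represented b (F g)}
            one_mem' := ⟨1, by rw [hone]; exact one_mem_represented b⟩
            mul_mem' := ?_
            inv_mem' := ?_ }, rfl⟩
  · rintro L M ⟨g, hg⟩ ⟨g', hg'⟩
    exact ⟨g * g', by rw [hmul]; exact represented_mul hg hg'⟩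
  · rintro L ⟨g, hg⟩
    refine ⟨g⁻¹, ?_⟩
    have e : F g⁻¹ * F g = 1 := by rw [← hmul, inv_mul_cancel, hone]
    have hi : L⁻¹ ∈ represented b (LinearMap.toMatrix b b (L⁻¹ : V ≃ₗ[ℝ] V)) := rfl
    have e' : F g * LinearMap.toMatrix b b (L⁻¹ : V ≃ₗ[ℝ] V) = 1 := by
      have := represented_mul hg hi
      rw [mul_inv_cancel] at this
      exact this.symm.trans (one_mem_represented b)
    rwa [left_inv_eq_right_inv e e']

theorem matA_add (s t : ℝ) : matA (s + t) = matA s * matA t := by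
  rw [matA_eq, matA_eq, matA_eq, axisMat_mul, axisMat, Real.cos_add, Real.sin_add]
  ext i j
  fin_cases i <;> fin_cases j <;> simp
  ring

theorem axisMat_eq_one_iff {ε c s : ℝ} : axisMat ε c s = 1 ↔ ε = 1 ∧ c = 1 ∧ s = 0 := by
  constructor
  · intro e
    have e0 := congrFun (congrFun e 0) 0
    have e1 := congrFun (congrFun e 1) 1
    have e2 := congrFun (congrFun e 2) 1
    simp [axisMat] at e0 e1 e2
    exact ⟨e0, e1, e2⟩
  · rintro ⟨rfl, rfl, rfl⟩
    exact axisMat_one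

theorem rotation_mem_specialOrthogonalGroup (s : ℝ) :
    !![Real.cos s, -Real.sin s; Real.sin s, Real.cos s] ∈
      Matrix.specialOrthogonalGroup (Fin 2) ℝ :=
  Matrix.of_mem_specialOrthogonalGroup_fin_two_iff.2 ⟨rfl, rfl, by
    rw [neg_sq]; exact Real.cos_sq_add_sin_sq _⟩

theorem hasIsoType_so2
    (hS : (cubicStabilizer h K : Set (V ≃ₗ[ℝ] V)) = symmetrySet h b .so2) :
    HasIsoType (cubicStabilizer h K) .so2 := by
  obtain ⟨φ, hφ, kφ⟩ := exists_surjective_hom (b := b)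
    (fun s : Multiplicative ℝ => matA s.toAdd) (fun s => matA_det _) (fun s t => matA_add _ _)
    (S := cubicStabilizer h K) hS
  let ψ : Multiplicative ℝ →* Matrix.specialOrthogonalGroup (Fin 2) ℝ :=
    MonoidHom.mk' (fun s => ⟨_, rotation_mem_specialOrthogonalGroup s.toAdd⟩) (by
      intro s t
      apply Subtype.ext
      simp only [toAdd_mul, Real.cos_add, Real.sin_add, Submonoid.coe_mul, Matrix.mul_fin_two]
      ext i j
      fin_cases i <;> fin_cases j <;> simp <;> ring)
  refine nonempty_mulEquiv_of_ker_eq φ ψ hφ ?_ ?_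
  · rintro ⟨M, hM⟩
    obtain ⟨h1, h2, h3⟩ := Matrix.mem_specialOrthogonalGroup_fin_two_iff.1 hM
    obtain ⟨t, hc, hs⟩ := exists_cos_sin (c := M 0 0) (s := M 1 0) (by
      rw [h2] at h3
      linear_combination h3)
    refine ⟨Multiplicative.ofAdd t, Subtype.ext ?_⟩
    change !![Real.cos t, -Real.sin t; Real.sin t, Real.cos t] = M
    rw [← hc, ← hs]
    ext i j
    fin_cases i <;> fin_cases j <;> simp [h2, h1]
  · intro s
    rw [kφ, matA_eq, axisMat_eq_one_iff, Subtype.ext_iff]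
    change _ ↔ !![Real.cos s.toAdd, -Real.sin s.toAdd; Real.sin s.toAdd, Real.cos s.toAdd] =
      (1 : Matrix (Fin 2) (Fin 2) ℝ)
    rw [Matrix.one_fin_two]
    constructor
    · rintro ⟨-, h1, h2⟩
      rw [h1, h2, neg_zero]
    · intro e
      have e1 := congrFun (congrFun e 0) 0
      have e2 := congrFun (congrFun e 1) 0
      exact ⟨rfl, e1, e2⟩

theorem lorentzForm_one_apply (x y : Fin 2 → ℝ) :
    lorentzForm 1 x y = -(x 0 * y 0) + x 1 * y 1 := by
  simp [lorentzForm, Matrix.toBilin'_apply, Fin.sum_univ_two, Matrix.diagonal]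

theorem lorentzForm_two_apply (x y : Fin 3 → ℝ) :
    lorentzForm 2 x y = -(x 0 * y 0) + x 1 * y 1 + x 2 * y 2 := by
  have : (Fin.cons (-1) (fun _ => 1) : Fin 3 → ℝ) 2 = 1 := rfl
  simp [lorentzForm, Matrix.toBilin'_apply, Fin.sum_univ_three, Matrix.diagonal, this]

/-- The hyperbolic rotation of the Lorentzian plane with eigenvalues `l` and `l⁻¹`. -/
noncomputable def boostMat (l : ℝˣ) : Matrix (Fin 2) (Fin 2) ℝ :=
  !![(l + (l : ℝ)⁻¹) / 2, (l - (l : ℝ)⁻¹) / 2; (l - (l : ℝ)⁻¹) / 2, (l + (l : ℝ)⁻¹) / 2]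

theorem boostMat_mul (l m : ℝˣ) : boostMat (l * m) = boostMat l * boostMat m := by
  rw [boostMat, boostMat, boostMat, Matrix.mul_fin_two, Units.val_mul, mul_inv]
  ext i j
  fin_cases i <;> fin_cases j <;> simp <;> ring

theorem boostMat_one : boostMat 1 = 1 := by
  rw [Matrix.one_fin_two]
  simp [boostMat]

/-- The hyperbolic rotations as linear automorphisms. -/
noncomputable def boostEquiv (l : ℝˣ) : (Fin 2 → ℝ) ≃ₗ[ℝ] (Fin 2 → ℝ) :=
  Matrix.toLin'OfInv (M := boostMat l⁻¹) (M' := boostMat l)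
    (by rw [← boostMat_mul, inv_mul_cancel, boostMat_one])
    (by rw [← boostMat_mul, mul_inv_cancel, boostMat_one])

theorem boostEquiv_apply (l : ℝˣ) (x : Fin 2 → ℝ) :
    boostEquiv l x = (boostMat l).mulVec x := by
  rw [boostEquiv]
  exact Matrix.toLin'_apply _ _

theorem boostEquiv_mem (l : ℝˣ) : boostEquiv l ∈ SO1 1 := by
  constructor
  · intro x y
    rw [boostEquiv_apply, boostEquiv_apply, lorentzForm_one_apply, lorentzForm_one_apply]
    have := l.ne_zero
    simp [boostMat, Matrix.mulVec, dotProduct, Fin.sum_univ_two]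
    field_simp
    ring
  · have : ((boostEquiv l : (Fin 2 → ℝ) ≃ₗ[ℝ] (Fin 2 → ℝ)) : (Fin 2 → ℝ) →ₗ[ℝ] (Fin 2 → ℝ)) =
        Matrix.toLin' (boostMat l) := by
      refine LinearMap.ext fun x => ?_
      rw [Matrix.toLin'_apply]
      exact boostEquiv_apply l x
    have hl := l.ne_zero
    rw [this, LinearMap.det_toLin', boostMat, Matrix.det_fin_two_of]
    field_simp
    ring

theorem exists_boostEquiv_eq {L : (Fin 2 → ℝ) ≃ₗ[ℝ] (Fin 2 → ℝ)} (hL : L ∈ SO1 1) :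
    ∃ l, boostEquiv l = L := by
  obtain ⟨h1, h2⟩ := hL
  set A := LinearMap.toMatrix' (L : (Fin 2 → ℝ) →ₗ[ℝ] (Fin 2 → ℝ)) with hA
  have hLA : ∀ x, L x = A.mulVec x := fun x => (LinearMap.toMatrix'_mulVec _ x).symm
  rw [← LinearMap.det_toMatrix', ← hA, Matrix.det_fin_two] at h2
  have G : ∀ p q p' q' : ℝ, -((A 0 0 * p + A 0 1 * q) * (A 0 0 * p' + A 0 1 * q')) +
      (A 1 0 * p + A 1 1 * q) * (A 1 0 * p' + A 1 1 * q') = -(p * p') + q * q' := by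
    intro p q p' q'
    have := h1 ![p, q] ![p', q']
    rw [hLA, hLA, lorentzForm_one_apply, lorentzForm_one_apply] at this
    simpa [Matrix.mulVec, dotProduct, Fin.sum_univ_two] using this
  have g00 := G 1 0 1 0
  have g01 := G 1 0 0 1
  clear G
  simp only [mul_one, mul_zero, add_zero, zero_add] at g00 g01
  have e11 : A 1 1 = A 0 0 := by
    linear_combination A 0 0 * h2 + A 1 1 * g00 - A 1 0 * g01
  have e01 : A 0 1 = A 1 0 := by
    linear_combination A 1 0 * h2 + A 0 1 * g00 - A 0 0 * g01
  have u : (A 0 0 + A 1 0) * (A 0 0 - A 1 0) = 1 := by linear_combination -g00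
  -- The parameter is the eigenvalue on the null direction `(1, 1)`; negative values give the second
  -- component of `SO(1,1)`.
  refine ⟨⟨A 0 0 + A 1 0, A 0 0 - A 1 0, u, by rw [mul_comm, u]⟩, ?_⟩
  ext1 x
  rw [boostEquiv_apply, hLA]
  congr 1
  have hinv : (A 0 0 + A 1 0)⁻¹ = A 0 0 - A 1 0 := inv_eq_of_mul_eq_one_right u
  ext i j
  fin_cases i <;> fin_cases j <;> simp [boostMat, hinv, e11, e01]

theorem boostEquiv_eq_one_iff (l : ℝˣ) : boostEquiv l = 1 ↔ l = 1 := by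
  constructor
  · intro e
    have e0 := congrFun (congrArg (fun N : (Fin 2 → ℝ) ≃ₗ[ℝ] (Fin 2 → ℝ) => N ![1, 1]) e) 0
    rw [boostEquiv_apply] at e0
    simp [boostMat, Matrix.mulVec, dotProduct, Fin.sum_univ_two] at e0
    apply Units.ext
    rw [Units.val_one]
    linear_combination e0
  · rintro rfl
    ext1 x
    rw [boostEquiv_apply, boostMat_one, Matrix.one_mulVec]
    rfl

theorem matC_mul (l m : ℝ) : matC (l * m) = matC l * matC m := by
  ext i j
  fin_cases i <;> fin_cases j <;> simp [matC, Matrix.mul_apply, Fin.sum_univ_three, mul_comm]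

theorem hasIsoType_so11
    (hS : (cubicStabilizer h K : Set (V ≃ₗ[ℝ] V)) = symmetrySet h b .so11) :
    HasIsoType (cubicStabilizer h K) .so11 := by
  obtain ⟨φ, hφ, kφ⟩ := exists_surjective_hom (b := b)
    (fun l : ℝˣ => matC l) (fun l => matC_det l.ne_zero)
    (fun l m => by rw [Units.val_mul, matC_mul])
    (S := cubicStabilizer h K) (by
      rw [hS]
      ext L
      constructor
      · rintro ⟨l, hl, hL⟩
        exact ⟨Units.mk0 l hl, hL⟩
      · rintro ⟨l, hL⟩
        exact ⟨l, l.ne_zero, hL⟩)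
  let ψ : ℝˣ →* SO1 1 :=
    MonoidHom.mk' (fun l => ⟨_, boostEquiv_mem l⟩) (by
      intro l m
      apply Subtype.ext
      ext1 x
      change boostEquiv (l * m) x = boostEquiv l (boostEquiv m x)
      rw [boostEquiv_apply, boostEquiv_apply, boostEquiv_apply, Matrix.mulVec_mulVec,
        boostMat_mul])
  refine nonempty_mulEquiv_of_ker_eq φ ψ hφ ?_ ?_
  · rintro ⟨L, hL⟩
    obtain ⟨l, rfl⟩ := exists_boostEquiv_eq hL
    exact ⟨l, rfl⟩
  · intro l
    rw [kφ, Subtype.ext_iff]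
    change _ ↔ boostEquiv l = 1
    rw [boostEquiv_eq_one_iff]
    constructor
    · intro e
      have := congrFun (congrFun e 0) 0
      exact Units.ext (by simpa [matC] using this)
    · rintro rfl
      exact matC_one

theorem matN_add (m n : ℝ) : matN (m + n) = matN m * matN n := by
  ext i j
  fin_cases i <;> fin_cases j <;> simp [matN, Matrix.mul_apply, Fin.sum_univ_three] <;> ring

theorem hasIsoType_real
    (hS : (cubicStabilizer h K : Set (V ≃ₗ[ℝ] V)) = symmetrySet h b .real) :
    HasIsoType (cubicStabilizer h K) .real := by
  obtain ⟨φ, hφ, kφ⟩ := exists_surjective_hom (b := b)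
    (fun m : Multiplicative ℝ => matN m.toAdd) (fun m => matN_det _) (fun m n => matN_add _ _)
    (S := cubicStabilizer h K) hS
  refine nonempty_mulEquiv_of_ker_eq φ (MonoidHom.id _) hφ Function.surjective_id ?_
  intro m
  rw [kφ, MonoidHom.id_apply]
  constructor
  · intro e
    have := congrFun (congrFun e 1) 2
    simpa [matN] using this
  · rintro rfl
    exact matN_zero

theorem hasIsoType_zero (hs : h.IsSymm) (hb : IsONB h b)
    (hS : (cubicStabilizer h K : Set (V ≃ₗ[ℝ] V)) = symmetrySet h b .zero) :
    HasIsoType (cubicStabilizer h K) .zero := by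
  have hS' : cubicStabilizer h K = specialIsometryGroup h := SetLike.coe_injective hS
  rw [hS']
  have he : ∀ x y, lorentzForm 2 (b.equivFun x) (b.equivFun y) = h x y := by
    intro x y
    rw [lorentzForm_two_apply]
    have e := hb.apply_eq hs (b.equivFun x 0) (b.equivFun x 1) (b.equivFun x 2)
      (b.equivFun y 0) (b.equivFun y 1) (b.equivFun y 2)
    have sx := b.sum_equivFun x
    have sy := b.sum_equivFun y
    rw [Fin.sum_univ_three] at sx sy
    rw [← e, sx, sy]
  have he' : ∀ x y, h (b.equivFun.symm x) (b.equivFun.symm y) = lorentzForm 2 x y := by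
    intro x y
    rw [← he, b.equivFun.apply_symm_apply, b.equivFun.apply_symm_apply]
  refine ⟨{
    toFun := fun L => ⟨(b.equivFun.symm.trans L.1).trans b.equivFun, ?_, ?_⟩
    invFun := fun L => ⟨(b.equivFun.trans L.1).trans b.equivFun.symm, ?_, ?_⟩
    left_inv := ?_
    right_inv := ?_
    map_mul' := ?_ }⟩
  · intro x y
    simp only [LinearEquiv.trans_apply]
    rw [he, L.2.1, he']
  · rw [← L.2.2]
    exact LinearMap.det_conj (L.1 : V →ₗ[ℝ] V) b.equivFun
  · intro x y
    simp only [LinearEquiv.trans_apply]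
    rw [he', L.2.1, he]
  · rw [← L.2.2]
    exact LinearMap.det_conj (L.1 : (Fin 3 → ℝ) →ₗ[ℝ] (Fin 3 → ℝ)) b.equivFun.symm
  · intro L
    apply Subtype.ext
    ext1 x
    simp only [LinearEquiv.trans_apply, LinearEquiv.symm_apply_apply]
  · intro L
    apply Subtype.ext
    ext1 x
    simp only [LinearEquiv.trans_apply, LinearEquiv.apply_symm_apply]
  · intro L M
    apply Subtype.ext
    ext1 x
    simp [LinearEquiv.mul_apply]

theorem represented_eq_singleton {A : Matrix (Fin 3) (Fin 3) ℝ} {L : V ≃ₗ[ℝ] V}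
    (hL : L ∈ represented b A) : represented b A = {L} :=
  Set.eq_singleton_iff_unique_mem.2 ⟨hL, fun _ hM => represented_inj hM hL⟩

theorem nat_card_closure_represented {A : Matrix (Fin 3) (Fin 3) ℝ} (hdet : A.det = 1) {p : ℕ}
    [Fact p.Prime] (hA : A ≠ 1) (hp : A ^ p = 1) :
    Nat.card (Subgroup.closure (represented b A)) = p := by
  obtain ⟨L, hL⟩ := exists_represented b hdet
  have hpow : ∀ n, L ^ n ∈ represented b (A ^ n) := by
    intro n
    induction n with
    | zero => exact one_mem_represented b
    | succ n ih => rw [pow_succ, pow_succ]; exact represented_mul ih hL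
  rw [represented_eq_singleton hL, ← Subgroup.zpowers_eq_closure, Nat.card_zpowers]
  refine orderOf_eq_prime (eq_one_of_mem_represented (b := b) (hp ▸ hpow p)) ?_
  rintro rfl
  exact hA (hL.symm.trans (one_mem_represented b))

theorem nonempty_mulEquiv_zmod {S : Subgroup (V ≃ₗ[ℝ] V)} {A : Matrix (Fin 3) (Fin 3) ℝ}
    (hdet : A.det = 1) {p : ℕ} [Fact p.Prime] (hA : A ≠ 1) (hp : A ^ p = 1)
    (hS : (S : Set (V ≃ₗ[ℝ] V)) = Subgroup.closure (represented b A)) :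
    Nonempty (S ≃* Multiplicative (ZMod p)) := by
  have hS' : S = Subgroup.closure (represented b A) := SetLike.coe_injective hS
  subst hS'
  exact ⟨mulEquivOfPrimeCardEq (nat_card_closure_represented hdet hA hp) (by simp)⟩

theorem hasIsoType_z3
    (hS : (cubicStabilizer h K : Set (V ≃ₗ[ℝ] V)) = symmetrySet h b .z3) :
    HasIsoType (cubicStabilizer h K) .z3 := by
  refine nonempty_mulEquiv_zmod (p := 3) (matA_det _) ?_ ?_ hS
  · rw [matA_eq, Ne, axisMat_eq_one_iff, cos_two_pi_div_three]
    norm_num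
  · rw [pow_succ, pow_two, ← matA_add, ← matA_add, matA_eq, axisMat_eq_one_iff]
    rw [show 2 * Real.pi / 3 + 2 * Real.pi / 3 + 2 * Real.pi / 3 = 2 * Real.pi by ring]
    simp

theorem matB_mul_self : matB * matB = 1 := by
  ext i j
  fin_cases i <;> fin_cases j <;> simp [matB, Matrix.mul_apply, Fin.sum_univ_three]

theorem hasIsoType_z2B
    (hS : (cubicStabilizer h K : Set (V ≃ₗ[ℝ] V)) = symmetrySet h b .z2B) :
    HasIsoType (cubicStabilizer h K) .z2B := by
  refine nonempty_mulEquiv_zmod (p := 2) matB_det ?_ (by rw [pow_two, matB_mul_self]) hS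
  rw [matB_eq, Ne, axisMat_eq_one_iff]
  norm_num

theorem hasIsoType_z2A
    (hS : (cubicStabilizer h K : Set (V ≃ₗ[ℝ] V)) = symmetrySet h b .z2A) :
    HasIsoType (cubicStabilizer h K) .z2A := by
  refine nonempty_mulEquiv_zmod (p := 2) (matA_det _) ?_ ?_ hS
  · rw [matA_eq, Ne, axisMat_eq_one_iff, Real.cos_pi]
    norm_num
  · rw [pow_two, ← matA_add, matA_eq, axisMat_eq_one_iff,
      show Real.pi + Real.pi = 2 * Real.pi by ring]
    simp

theorem units_int_cast_sq (u : ℤˣ) : ((u : ℤ) : ℝ) ^ 2 = 1 := by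
  rcases Int.units_eq_one_or u with rfl | rfl <;> norm_num

theorem axisMat_diag_mul (ε c ε' c' : ℝ) :
    axisMat (ε * ε') (c * c') 0 = axisMat ε c 0 * axisMat ε' c' 0 := by
  rw [axisMat_mul, axisMat]
  ext i j
  fin_cases i <;> fin_cases j <;> simp
  ring

theorem hasIsoType_z2z2
    (hS : (cubicStabilizer h K : Set (V ≃ₗ[ℝ] V)) = symmetrySet h b .z2z2) :
    HasIsoType (cubicStabilizer h K) .z2z2 := by
  have hdet : ∀ g : ℤˣ × ℤˣ, (axisMat ((g.1 : ℤ) : ℝ) ((g.2 : ℤ) : ℝ) 0).det = 1 := fun g =>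
    axisMat_det (units_int_cast_sq _) (by rw [units_int_cast_sq]; norm_num)
  have hmul : ∀ g g' : ℤˣ × ℤˣ, axisMat (((g * g').1 : ℤ) : ℝ) (((g * g').2 : ℤ) : ℝ) 0 =
      axisMat ((g.1 : ℤ) : ℝ) ((g.2 : ℤ) : ℝ) 0 * axisMat ((g'.1 : ℤ) : ℝ) ((g'.2 : ℤ) : ℝ) 0 := by
    intro g g'
    rw [← axisMat_diag_mul]
    simp
  obtain ⟨R, hR⟩ := exists_subgroup_represented b
    (fun g : ℤˣ × ℤˣ => axisMat ((g.1 : ℤ) : ℝ) ((g.2 : ℤ) : ℝ) 0) hmul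
    (by simpa using axisMat_one)
  have hS' : cubicStabilizer h K = R := by
    rw [SetLike.coe_injective (hS : (cubicStabilizer h K : Set (V ≃ₗ[ℝ] V)) =
      ((Subgroup.closure (represented b (matA Real.pi) ∪ represented b matB) :
        Subgroup (V ≃ₗ[ℝ] V)) : Set (V ≃ₗ[ℝ] V)))]
    apply le_antisymm
    · rw [Subgroup.closure_le, hR]
      rintro L (hL | hL)
      · refine ⟨(1, -1), ?_⟩
        rw [matA_eq, Real.cos_pi, Real.sin_pi] at hL
        simpa using hL
      · refine ⟨(-1, 1), ?_⟩
        rw [matB_eq] at hL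
        simpa using hL
    · intro L hL
      rw [← SetLike.mem_coe, hR] at hL
      obtain ⟨g, hg⟩ := hL
      exact mem_closure_z2z2 (units_int_cast_sq _) (units_int_cast_sq _) hg
  obtain ⟨φ, hφ, kφ⟩ := exists_surjective_hom (b := b) _ hdet hmul (S := cubicStabilizer h K)
    (by rw [hS', hR])
  have e : ℤˣ ≃* Multiplicative (ZMod 2) :=
    mulEquivOfPrimeCardEq (p := 2) (by simp) (by simp)
  refine nonempty_mulEquiv_of_ker_eq φ (MulEquiv.prodCongr e e).toMonoidHom hφ
    (MulEquiv.prodCongr e e).surjective fun g => ?_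
  rw [kφ, axisMat_eq_one_iff]
  change _ ↔ MulEquiv.prodCongr e e g = 1
  rw [MulEquiv.map_eq_one_iff, Prod.ext_iff]
  simp

/-- Three unit spacelike vectors at mutual angles `2π/3`. -/
noncomputable def triad (b : Module.Basis (Fin 3) ℝ V) : Fin 3 → V :=
  ![b 1, (-1 / 2 : ℝ) • b 1 + (√3 / 2) • b 2, (-1 / 2 : ℝ) • b 1 + (-(√3 / 2)) • b 2]

theorem triad_zero (b : Module.Basis (Fin 3) ℝ V) : triad b 0 = b 1 := rfl

theorem triad_one (b : Module.Basis (Fin 3) ℝ V) :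
    triad b 1 = (-1 / 2 : ℝ) • b 1 + (√3 / 2) • b 2 := rfl

theorem triad_two (b : Module.Basis (Fin 3) ℝ V) :
    triad b 2 = (-1 / 2 : ℝ) • b 1 + (-(√3 / 2)) • b 2 := rfl

theorem triad_injective (b : Module.Basis (Fin 3) ℝ V) : Function.Injective (triad b) := by
  have h3 : 0 < √3 := by positivity
  have e : ∀ k, b.repr (triad b k) 2 = (![0, √3 / 2, -(√3 / 2)] : Fin 3 → ℝ) k := by
    intro k
    fin_cases k <;> simp [triad]
  intro i j hij
  have hij := congrArg (fun x => b.repr x 2) hij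
  simp only [e] at hij
  fin_cases i <;> fin_cases j <;> first
    | rfl
    | (exfalso; simp [h3.ne'] at hij; done)
    | (exfalso; simp at hij; linarith)

theorem matA_triad {L : V ≃ₗ[ℝ] V} (hL : L ∈ represented b (matA (2 * Real.pi / 3)))
    (k : Fin 3) : L (triad b k) = triad b (finRotate 3 k) := by
  have h3 : √3 * √3 = (3 : ℝ) := Real.mul_self_sqrt (by norm_num)
  rw [matA_eq, cos_two_pi_div_three, sin_two_pi_div_three] at hL
  have hA := axisMat_apply hL 0
  simp only [mul_zero, zero_smul, zero_add] at hA
  fin_cases k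
  · change L (triad b 0) = triad b 1
    have := hA 1 0
    rw [triad_zero, triad_one]
    simpa using this
  · change L (triad b 1) = triad b 2
    rw [triad_one, triad_two, hA]
    congr 2
    · linear_combination -h3 / 4
    · ring
  · change L (triad b 2) = triad b 0
    rw [triad_two, triad_zero, hA]
    have e1 : -1 / 2 * (-1 / 2) - 1 * (√3 / 2) * -(√3 / 2) = 1 := by linear_combination h3 / 4
    have e2 : √3 / 2 * (-1 / 2) + 1 * (-1 / 2) * -(√3 / 2) = 0 := by ring
    rw [e1, e2]
    module

theorem matB_triad {L : V ≃ₗ[ℝ] V} (hL : L ∈ represented b matB)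
    (k : Fin 3) : L (triad b k) = triad b (Equiv.swap 1 2 k) := by
  rw [matB_eq] at hL
  have hA := axisMat_apply hL 0
  simp only [mul_zero, zero_smul, zero_add] at hA
  fin_cases k
  · change L (triad b 0) = triad b 0
    have := hA 1 0
    rw [triad_zero]
    simpa using this
  · change L (triad b 1) = triad b 2
    rw [triad_one, triad_two, hA]
    module
  · change L (triad b 2) = triad b 1
    rw [triad_two, triad_one, hA]
    module

/-- The group generated by the rotation of order three and the half-turn permutes the triad. -/
theorem exists_perm_action {L : V ≃ₗ[ℝ] V} (b : Module.Basis (Fin 3) ℝ V)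
    (hL : L ∈ Subgroup.closure (represented b (matA (2 * Real.pi / 3)) ∪ represented b matB)) :
    ∃ σ : Equiv.Perm (Fin 3), ∀ k, L (triad b k) = triad b (σ k) := by
  induction hL using Subgroup.closure_induction with
  | mem L hL =>
    rcases hL with hL | hL
    · exact ⟨finRotate 3, matA_triad hL⟩
    · exact ⟨Equiv.swap 1 2, matB_triad hL⟩
  | one => exact ⟨1, fun k => rfl⟩
  | mul L M _ _ hL hM =>
    obtain ⟨σ, hσ⟩ := hL
    obtain ⟨τ, hτ⟩ := hM
    exact ⟨σ * τ, fun k => by rw [LinearEquiv.mul_apply, hτ, hσ, Equiv.Perm.mul_apply]⟩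
  | inv L _ hL =>
    obtain ⟨σ, hσ⟩ := hL
    refine ⟨σ.symm, fun k => ?_⟩
    have := hσ (σ.symm k)
    rw [Equiv.apply_symm_apply] at this
    rw [← this]
    exact L.symm_apply_apply _

/-- Orthogonality keeps `b 0` on its own line, and determinant one then fixes it. -/
theorem eq_one_of_fixed (hs : h.IsSymm) (hb : IsONB h b) {L : V ≃ₗ[ℝ] V}
    (hL : L ∈ specialIsometryGroup h) (h1 : L (b 1) = b 1) (h2 : L (b 2) = b 2) : L = 1 := by
  have hLA := mem_represented_toMatrix b L
  have col : ∀ i j, LinearMap.toMatrix b b (L : V →ₗ[ℝ] V) i j = b.repr (L (b j)) i :=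
    fun i j => LinearMap.toMatrix_apply ..
  have c01 := col 0 1
  have c11 := col 1 1
  have c21 := col 2 1
  have c02 := col 0 2
  have c12 := col 1 2
  have c22 := col 2 2
  rw [h1] at c01 c11 c21
  rw [h2] at c02 c12 c22
  generalize LinearMap.toMatrix b b (L : V →ₗ[ℝ] V) = A at *
  simp at c01 c11 c21 c02 c12 c22
  obtain ⟨G, hdet⟩ := (hb.mem_specialIsometryGroup_iff hs hLA).1 hL
  have g01 := G 1 0 0 0 1 0
  have g02 := G 1 0 0 0 0 1
  simp only [c01, c11, c21, c02, c12, c22, mul_one, mul_zero, add_zero, zero_add] at g01 g02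
  rw [Matrix.det_fin_three, c01, c11, c21, c02, c12, c22] at hdet
  clear col
  have z10 : A 1 0 = 0 := by linear_combination g01
  have z20 : A 2 0 = 0 := by linear_combination g02
  have z00 : A 0 0 = 1 := by linear_combination hdet
  apply eq_one_of_mem_represented (b := b)
  convert hLA
  ext i j
  fin_cases i <;> fin_cases j <;> simp [*]

/-- The isomorphism is the action on the triad: faithful because the triad spans the spatial plane,
onto because a 3-cycle and a transposition occur. -/
theorem hasIsoType_s3 (hs : h.IsSymm) (hb : IsONB h b)
    (hS : (cubicStabilizer h K : Set (V ≃ₗ[ℝ] V)) = symmetrySet h b .s3) :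
    HasIsoType (cubicStabilizer h K) .s3 := by
  have hcl : cubicStabilizer h K =
      Subgroup.closure (represented b (matA (2 * Real.pi / 3)) ∪ represented b matB) :=
    SetLike.coe_injective hS
  have key : ∀ L : cubicStabilizer h K, ∃ σ : Equiv.Perm (Fin 3),
      ∀ k, L.1 (triad b k) = triad b (σ k) := fun L => exists_perm_action b (hcl ▸ L.2)
  choose f hf using key
  have huniq : ∀ σ τ : Equiv.Perm (Fin 3), (∀ k, triad b (σ k) = triad b (τ k)) → σ = τ :=
    fun σ τ H => Equiv.ext fun k => triad_injective b (H k)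
  let φ : cubicStabilizer h K →* Equiv.Perm (Fin 3) := MonoidHom.mk' f fun L M =>
    huniq _ _ fun k => by
      rw [← hf, Subgroup.coe_mul, LinearEquiv.mul_apply, hf, hf, Equiv.Perm.mul_apply]
  refine ⟨MulEquiv.ofBijective φ ⟨?_, ?_⟩⟩
  · rw [injective_iff_map_eq_one]
    intro L hL
    have h0 := hf L 0
    have h1 := hf L 1
    rw [show f L = 1 from hL, Equiv.Perm.one_apply] at h0 h1
    have e1 : L.1 (b 1) = b 1 := by
      rw [← triad_zero b]
      exact h0
    have e2 : L.1 (b 2) = b 2 := by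
      have h3 : √3 ≠ 0 := by positivity
      have : b 2 = (√3 / 3) • (triad b 0 + (2 : ℝ) • triad b 1) := by
        rw [triad_zero, triad_one, smul_add, smul_smul, smul_add, smul_smul, smul_smul]
        have e3 : √3 / 3 * 2 * (√3 / 2) = 1 := by
          have : √3 ^ 2 = (3 : ℝ) := Real.sq_sqrt (by norm_num)
          linear_combination this / 3
        rw [e3]
        module
      rw [this, map_smul, map_add, map_smul, h0, h1]
    exact Subtype.ext (eq_one_of_fixed hs hb L.2.1 e1 e2)
  · rw [← MonoidHom.range_eq_top]
    obtain ⟨r, hr⟩ := exists_represented b (matA_det (2 * Real.pi / 3))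
    obtain ⟨B, hB⟩ := exists_represented b matB_det
    have hrm : r ∈ cubicStabilizer h K := hcl ▸ Subgroup.subset_closure (Or.inl hr)
    have hBm : B ∈ cubicStabilizer h K := hcl ▸ Subgroup.subset_closure (Or.inr hB)
    have m1 : finRotate 3 ∈ φ.range := ⟨⟨r, hrm⟩, huniq _ _ fun k => by
      rw [← matA_triad hr]
      exact (hf ⟨r, hrm⟩ k).symm⟩
    have m2 : Equiv.swap 1 2 ∈ φ.range := ⟨⟨B, hBm⟩, huniq _ _ fun k => by
      rw [← matB_triad hB]
      exact (hf ⟨B, hBm⟩ k).symm⟩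
    rw [eq_top_iff]
    intro σ _
    have gen : ∀ σ : Equiv.Perm (Fin 3), σ = 1 ∨ σ = finRotate 3 ∨ σ = finRotate 3 * finRotate 3 ∨
        σ = Equiv.swap 1 2 ∨ σ = finRotate 3 * Equiv.swap 1 2 ∨
        σ = finRotate 3 * finRotate 3 * Equiv.swap 1 2 := by decide
    rcases gen σ with rfl | rfl | rfl | rfl | rfl | rfl
    · exact one_mem _
    · exact m1
    · exact mul_mem m1 m1
    · exact m2
    · exact mul_mem m1 m2
    · exact mul_mem (mul_mem m1 m1) m2

theorem hasIsoType (hs : h.IsSymm) (c : FormType) (hb : IsAdapted h b c)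
    (hS : (cubicStabilizer h K : Set (V ≃ₗ[ℝ] V)) = symmetrySet h b c) :
    HasIsoType (cubicStabilizer h K) c := by
  cases c with
  | zero => exact hasIsoType_zero hs hb hS
  | so2 => exact hasIsoType_so2 hS
  | s3 => exact hasIsoType_s3 hs hb hS
  | z3 => exact hasIsoType_z3 hS
  | z2B => exact hasIsoType_z2B hS
  | z2z2 => exact hasIsoType_z2z2 hS
  | z2A => exact hasIsoType_z2A hS
  | so11 => exact hasIsoType_so11 hS
  | real => exact hasIsoType_real hS

/-! ### Invariants separating the normal forms -/

theorem HasNormalForm.ne_zero (hs : h.IsSymm) (hK : IsTracelessCubic h K) {c : FormType}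
    (hb : IsAdapted h b c) (H : HasNormalForm K b c) (hc : c ≠ .zero) : K ≠ 0 := by
  rintro rfl
  cases c with
  | zero => exact hc rfl
  | so2 =>
    obtain ⟨a, ha, H⟩ := H
    have := (hasONBCoeffs_iff hs hK hb).1 H
    simp at this
    linarith
  | s3 =>
    obtain ⟨a, ha, H⟩ := H
    have := (hasONBCoeffs_iff hs hK hb).1 H
    simp at this
    linarith
  | z3 =>
    obtain ⟨a, a', ha, -, H⟩ := H
    have := (hasONBCoeffs_iff hs hK hb).1 H
    simp at this
    linarith
  | z2B =>
    obtain ⟨a₂, a₅, a₆, -, ha, H⟩ := H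
    have := (hasONBCoeffs_iff hs hK hb).1 H
    simp at this
    exact ha (by rw [← this.1, ← this.2.2])
  | z2z2 =>
    obtain ⟨a, ha, H⟩ := H
    have := (hasONBCoeffs_iff hs hK hb).1 H
    simp at this
    linarith
  | z2A =>
    obtain ⟨a, a', ha, -, H⟩ := H
    have := (hasONBCoeffs_iff hs hK hb).1 H
    simp at this
    rcases ha with ha | ha <;> linarith
  | so11 =>
    obtain ⟨a, ha, H⟩ := H
    have := (hasLVBCoeffs_iff hs hK hb).1 H
    simp at this
    linarith
  | real =>
    obtain ⟨a, ha, H⟩ := H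
    have := (hasLVBCoeffs_iff hs hK hb).1 H
    simp at this
    linarith

/-- `Nat.card` takes the value `0` on infinite types, and this is how `Signature` records an
infinite stabilizer. -/
theorem nat_card_eq_zero_of_injective {S : Subgroup (V ≃ₗ[ℝ] V)}
    (f : ℕ → Matrix (Fin 3) (Fin 3) ℝ) (hf : Function.Injective f) (hdet : ∀ n, (f n).det = 1)
    (hS : ∀ n, represented b (f n) ⊆ S) : Nat.card S = 0 := by
  choose L hL using fun n => exists_represented b (hdet n)
  have : Function.Injective fun n => (⟨L n, hS n (hL n)⟩ : S) := by
    intro m n hmn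
    apply hf
    have e : L m = L n := congrArg Subtype.val hmn
    have := hL m
    rw [e] at this
    exact this.symm.trans (hL n)
  have := Infinite.of_injective _ this
  exact Nat.card_eq_zero_of_infinite

theorem mem_closure_matB {L : V ≃ₗ[ℝ] V} (hL : L ∈ Subgroup.closure (represented b matB)) :
    L = 1 ∨ L ∈ represented b matB := by
  obtain ⟨B, hB⟩ := exists_represented b matB_det
  have hBB : B * B = 1 := eq_one_of_mem_represented (b := b) (by
    rw [← matB_mul_self]
    exact represented_mul hB hB)
  rw [represented_eq_singleton hB, Set.mem_singleton_iff]
  rw [represented_eq_singleton hB] at hL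
  induction hL using Subgroup.closure_induction with
  | mem L hL => exact Or.inr hL
  | one => exact Or.inl rfl
  | mul L M _ _ hL hM =>
    rcases hL with rfl | rfl <;> rcases hM with rfl | rfl <;> simp [hBB]
  | inv L _ hL =>
    rcases hL with rfl | rfl
    · simp
    · exact Or.inr (inv_eq_of_mul_eq_one_left hBB)

/-- Properties of the cubic form and of its stabilizer which tell the normal forms apart. -/
def Signature (h : BilinForm ℝ V) (K : V →ₗ[ℝ] V →ₗ[ℝ] V) : FormType → Prop
  | .zero => K = 0
  | .so2 => K ≠ 0 ∧ Nat.card (cubicStabilizer h K) = 0 ∧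
      ∃ L ∈ cubicStabilizer h K, LinearMap.trace ℝ V (L : V →ₗ[ℝ] V) = 2
  | .s3 => K ≠ 0 ∧ Nat.card (cubicStabilizer h K) = 6
  | .z3 => K ≠ 0 ∧ Nat.card (cubicStabilizer h K) = 3
  | .z2B => K ≠ 0 ∧ Nat.card (cubicStabilizer h K) = 2 ∧
      ¬ ∃ L ∈ cubicStabilizer h K, L ≠ 1 ∧ ∃ u, L u = u ∧ h u u < 0
  | .z2z2 => K ≠ 0 ∧ Nat.card (cubicStabilizer h K) = 4
  | .z2A => K ≠ 0 ∧ Nat.card (cubicStabilizer h K) = 2 ∧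
      ∃ L ∈ cubicStabilizer h K, L ≠ 1 ∧ ∃ u, L u = u ∧ h u u < 0
  | .so11 => K ≠ 0 ∧ Nat.card (cubicStabilizer h K) = 0 ∧
      (¬ ∃ L ∈ cubicStabilizer h K, LinearMap.trace ℝ V (L : V →ₗ[ℝ] V) = 2) ∧
      ∃ L ∈ cubicStabilizer h K, 3 < LinearMap.trace ℝ V (L : V →ₗ[ℝ] V)
  | .real => K ≠ 0 ∧ Nat.card (cubicStabilizer h K) = 0 ∧
      (¬ ∃ L ∈ cubicStabilizer h K, LinearMap.trace ℝ V (L : V →ₗ[ℝ] V) = 2) ∧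
      ¬ ∃ L ∈ cubicStabilizer h K, 3 < LinearMap.trace ℝ V (L : V →ₗ[ℝ] V)

theorem Signature.unique {c c' : FormType} (hc : Signature h K c) (hc' : Signature h K c') :
    c = c' := by
  cases c <;> cases c' <;> first
    | rfl
    | (exfalso
       simp only [Signature] at hc hc'
       generalize Nat.card (cubicStabilizer h K) = n at hc hc'
       first
         | exact absurd hc hc'.1
         | exact absurd hc' hc.1
         | exact absurd hc.2.2 hc'.2.2
         | exact absurd hc'.2.2 hc.2.2
         | exact absurd hc.2.2 hc'.2.2.1
         | exact absurd hc'.2.2 hc.2.2.1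
         | exact absurd hc.2.2.2 hc'.2.2.2
         | exact absurd hc'.2.2.2 hc.2.2.2
         | exact absurd (hc.2.1.symm.trans hc'.2.1) (by norm_num)
         | exact absurd (hc.2.1.symm.trans hc'.2) (by norm_num)
         | exact absurd (hc.2.symm.trans hc'.2.1) (by norm_num)
         | exact absurd (hc.2.symm.trans hc'.2) (by norm_num))

/-- The three infinite groups other than that of `K = 0` differ in their traces: `1 + 2 cos s` takes
the value `2`, `1 + l + 1/l` never does but exceeds `3`, and null rotations always have trace `3`.
For order two the axis is timelike for `A_π` and spacelike for `B`. -/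
theorem signature (hs : h.IsSymm) (hK : IsTracelessCubic h K) (c : FormType)
    (hb : IsAdapted h b c) (H : HasNormalForm K b c)
    (hS : (cubicStabilizer h K : Set (V ≃ₗ[ℝ] V)) = symmetrySet h b c)
    (hI : HasIsoType (cubicStabilizer h K) c) : Signature h K c := by
  have ne := H.ne_zero hs hK hb
  have mem : ∀ L, L ∈ cubicStabilizer h K ↔ L ∈ symmetrySet h b c := fun L => by
    rw [← hS, SetLike.mem_coe]
  cases c with
  | zero => exact H
  | so2 =>
    refine ⟨ne (by simp), ?_, ?_⟩
    · refine nat_card_eq_zero_of_injective (b := b)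
        -- Angles with distinct cosines, so that one matrix entry shows the rotations to be
        -- distinct.
        (fun n : ℕ => matA (Real.arccos (1 / (n + 1)))) ?_ (fun n => matA_det _)
        (fun n L hL => (mem L).2 ⟨_, hL⟩)
      intro m n hmn
      have e := congrFun (congrFun hmn 1) 1
      have hcos : ∀ k : ℕ, Real.cos (Real.arccos (1 / ((k : ℝ) + 1))) = 1 / ((k : ℝ) + 1) := by
        intro k
        apply Real.cos_arccos
        · have : (0 : ℝ) ≤ 1 / ((k : ℝ) + 1) := by positivity
          linarith
        · rw [div_le_one (by positivity)]
          have : (0 : ℝ) ≤ k := by positivity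
          linarith
      simp only [matA, Matrix.of_apply, Matrix.cons_val, hcos] at e
      field_simp at e
      exact_mod_cast (by linarith : (m : ℝ) = n)
    · obtain ⟨L, hL⟩ := exists_represented b (matA_det (Real.pi / 3))
      refine ⟨L, (mem L).2 ⟨_, hL⟩, ?_⟩
      rw [trace_of_mem_represented hL]
      simp [matA]
      norm_num
  | s3 =>
    obtain ⟨e⟩ := hI
    refine ⟨ne (by simp), ?_⟩
    rw [Nat.card_congr e.toEquiv, Nat.card_perm, Nat.card_fin]
    rfl
  | z3 =>
    obtain ⟨e⟩ := hI
    refine ⟨ne (by simp), ?_⟩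
    rw [Nat.card_congr e.toEquiv]
    simp
  | z2B =>
    obtain ⟨e⟩ := hI
    refine ⟨ne (by simp), ?_, ?_⟩
    · rw [Nat.card_congr e.toEquiv]
      simp
    · rintro ⟨L, hL, hL1, u, hu, hneg⟩
      have hLB := (mem_closure_matB ((mem L).1 hL)).resolve_left hL1
      obtain ⟨p, q, r, rfl⟩ := exists_coords b u
      rw [matB_eq] at hLB
      rw [axisMat_apply hLB] at hu
      have e0 := congrArg (fun y => b.repr y 0) hu
      have e2 := congrArg (fun y => b.repr y 2) hu
      simp at e0 e2
      have hb' : IsONB h b := hb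
      rw [hb'.apply_eq hs] at hneg
      have hp : p = 0 := by linarith
      have hr : r = 0 := by linarith
      subst hp hr
      nlinarith [mul_self_nonneg q]
  | z2z2 =>
    obtain ⟨e⟩ := hI
    refine ⟨ne (by simp), ?_⟩
    rw [Nat.card_congr e.toEquiv]
    simp
  | z2A =>
    obtain ⟨e⟩ := hI
    refine ⟨ne (by simp), ?_, ?_⟩
    · rw [Nat.card_congr e.toEquiv]
      simp
    · obtain ⟨L, hL⟩ := exists_represented b (matA_det Real.pi)
      refine ⟨L, (mem L).2 (Subgroup.subset_closure hL), ?_, b 0, ?_, ?_⟩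
      · rintro rfl
        have := hL.symm.trans (one_mem_represented b)
        rw [matA_eq, axisMat_eq_one_iff, Real.cos_pi] at this
        norm_num at this
      · have := mem_represented_iff.1 hL 0
        simpa [matA] using this
      · have hb' : IsONB h b := hb
        rw [hb'.1]
        norm_num
  | so11 =>
    refine ⟨ne (by simp), ?_, ?_, ?_⟩
    · refine nat_card_eq_zero_of_injective (b := b)
        (fun n : ℕ => matC ((n : ℝ) + 1)) ?_ (fun n => matC_det (by positivity))
        (fun n L hL => (mem L).2 ⟨_, by positivity, hL⟩)
      intro m n hmn
      have e := congrFun (congrFun hmn 0) 0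
      simpa [matC] using e
    · rintro ⟨L, hL, htr⟩
      obtain ⟨l, hl, hLl⟩ := (mem L).1 hL
      rw [trace_of_mem_represented hLl] at htr
      simp only [matC, Matrix.of_apply, Matrix.cons_val] at htr
      field_simp at htr
      nlinarith [sq_nonneg (2 * l - 1)]
    · obtain ⟨L, hL⟩ := exists_represented b (matC_det (l := 2) (by norm_num))
      refine ⟨L, (mem L).2 ⟨2, by norm_num, hL⟩, ?_⟩
      rw [trace_of_mem_represented hL]
      simp only [matC, Matrix.of_apply, Matrix.cons_val]
      norm_num
  | real =>
    have tr : ∀ L ∈ cubicStabilizer h K, LinearMap.trace ℝ V (L : V →ₗ[ℝ] V) = 3 := by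
      intro L hL
      obtain ⟨m, hLm⟩ := (mem L).1 hL
      rw [trace_of_mem_represented hLm]
      simp only [matN, Matrix.of_apply, Matrix.cons_val]
      norm_num
    refine ⟨ne (by simp), ?_, ?_, ?_⟩
    · refine nat_card_eq_zero_of_injective (b := b)
        (fun n : ℕ => matN n) ?_ (fun n => matN_det _) (fun n L hL => (mem L).2 ⟨_, hL⟩)
      intro m n hmn
      have e := congrFun (congrFun hmn 1) 2
      simpa [matN] using e
    · rintro ⟨L, hL, htr⟩
      rw [tr L hL] at htr
      norm_num at htr
    · rintro ⟨L, hL, htr⟩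
      rw [tr L hL] at htr
      norm_num at htr

end LorentzCubic

/-! ### The classification theorem -/

open LorentzCubic in
theorem theorem4p1 {V : Type*} [AddCommGroup V] [Module ℝ V]
    (h : LinearMap.BilinForm ℝ V) (hsymm : h.IsSymm)
    (hsig : ∃ b : Module.Basis (Fin 3) ℝ V, IsONB h b)
    (K : V →ₗ[ℝ] V →ₗ[ℝ] V) (hK : IsTracelessCubic h K)
    (hstab : ∃ L ∈ cubicStabilizer h K, L ≠ 1) :
    (∃! c : FormType, ∃ b : Module.Basis (Fin 3) ℝ V,
      IsAdapted h b c ∧ HasNormalForm K b c ∧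
        (cubicStabilizer h K : Set (V ≃ₗ[ℝ] V)) = symmetrySet h b c ∧
        HasIsoType (cubicStabilizer h K) c) ∧
    (∀ (c : FormType) (b : Module.Basis (Fin 3) ℝ V),
      IsAdapted h b c → HasNormalForm K b c →
        symmetrySet h b c ⊆ (cubicStabilizer h K : Set (V ≃ₗ[ℝ] V)) ∧
        (c ≠ .z2B → c ≠ .z2A →
          symmetrySet h b c = (cubicStabilizer h K : Set (V ≃ₗ[ℝ] V)))) := by
  obtain ⟨b₀, hb₀⟩ := hsig
  refine ⟨?_, fun c b hb H => symmetrySet_subset hsymm hK c hb H⟩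
  obtain ⟨c, b, hb, H, hS⟩ := attainsNormalForm hsymm hK hb₀ hstab
  have hI := hasIsoType hsymm c hb hS
  refine ⟨c, ⟨b, hb, H, hS, hI⟩, ?_⟩
  rintro c' ⟨b', hb', H', hS', hI'⟩
  exact (signature hsymm hK c' hb' H' hS' hI').unique (signature hsymm hK c hb H hS hI)
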